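/- \textbf{Setting.} In prediction from experts (PFE) with $n$ actions and $T$ rounds, an oblivious (possibly randomized) adversary draws losses $\ell_t(i)\in[0,1]$, $t\in[T]$, $i\in[n]$, before the game, independently of the player's randomness. In round $t$ the (randomized) player picks $i_t\in[n]$ knowing $\ell_1,\dots,\ell_{t-1}$ in full. The regret is $\mathrm{Reg}=\sum_t \ell_t(i_t)-\min_{i}\sum_t\ell_t(i)$. An $S$-budget algorithm is a player for which the number of $t\ge 2$ with $i_t\ne i_{t-1}$ is always at most $S$. The minimax rate $R^*(T,n,S)$ is the infimum over $S$-budget algorithms of the supremum over oblivious adversaries of $\mathbb E[\mathrm{Reg}]$. An algorithm is efficient if it is carried out by one fixed program of a real RAM (exact real arithmetic $+,-,\times,/,\log,\exp$, comparisons, integer addition and subtraction, indirect addressing, independent uniform random numbers in $[0,1]$, unit costs), which gets $T,n,S$ (and $\delta$, in part 3) as input and makes at most polynomially many (in $nT$) steps in the whole game. \textbf{Theorem (low-switching regime).} Let $C>0$. Below, $T,n,S$ range over all integers with $n\ge2$, $1\le S\le T$ and $S\le C\sqrt{T\log n}$. There are constants $c,K>0$, depending only on $C$ (and, in part 5, $c$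 also on $\delta_0$), such that: 1. (Optimal rate.) If $T\ge 2$, then $$c\,\min\Big(T,\frac{T\log n}{S}\Big)\le R^*(T,n,S)\le \min\Big(T,\;K\,\frac{T\log n\,\log T}{S}\Big).$$ 2. (Expectation upper bound.) If $T\ge2$, there is an efficient $S$-budget algorithm with $\mathbb E[\mathrm{Reg}]\le K\,\frac{T\log n\log T}{S}$ against every oblivious adversary. 3. (High-probability upper bound.) For every $\delta\in(0,\tfrac12)$ there is an efficient $S$-budget algorithm such that, against every oblivious adversary, $\mathrm{Reg}\le K\,\frac{T\log n\log(1/\delta)}{S}$ with probability at least $1-\delta$. 4. (Expectation lower bound.) There is an oblivious adversary that forces every $S$-budget algorithm to have $\mathbb E[\mathrm{Reg}]\ge c\,\min\big(T,\frac{T\log n}{S}\big)$. It can be taken to be a batched Bernoulli adversary: for some $1\le m\le T$ the rounds are cut into consecutive epochs of length $m$ (the last one possibly shorter), and for each epoch and each action one independent $\mathrm{Ber}(\tfrac12)$ variable is the loss of that action in all rounds of that epoch. 5. (High-probability lower bound.) There is an absolute $n_0$ such that the following holds for every $\delta_0<\tfrac12$. For every $\delta\in(0,\tfrac12)$, if $\delta\le\delta_0$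 or $n\ge n_0$, there is an oblivious adversary that forces every $S$-budget algorithm to incur $$\mathrm{Reg}\ge c\,\min\Big(T,\frac{T\big(\log n+\sqrt{\log(1/\delta)}\big)}{S}\Big)$$ with probability at least $\delta$. If $\delta\le\tfrac14$, it can be taken to be a batched Bernoulli adversary as in part 4. -/

import Mathlib

open MeasureTheory ProbabilityTheory
open scoped unitInterval

/-! ## The game

There are `n` actions and `T` rounds, numbered `0, …, T - 1`. -/

/-- The losses of all actions in all rounds: `ℓ t i ∈ [0, 1]`. -/
abbrev LossSeq (T n : ℕ) : Type := Fin T → Fin n → I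

/-- An oblivious, possibly randomized adversary draws all the losses before the game starts,
independently of the randomness of the player. A deterministic one is a Dirac mass. -/
abbrev Adversary (T n : ℕ) : Type := ProbabilityMeasure (LossSeq T n)

/-- A randomized player for prediction from experts. It draws its randomness `ω` from `μ`, and in
round `t` it plays `act t ℓ ω`, which depends on the losses of the earlier rounds only. -/
structure PFEAlgorithm (T n : ℕ) where
  Ω : Type
  [mΩ : MeasurableSpace Ω]
  μ : Measure Ω
  [prob : IsProbabilityMeasure μ]
  act : Fin T → LossSeq T n → Ω → Fin n
  measurable_act : ∀ t, Measurable fun p : LossSeq T n × Ω => act t p.1 p.2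
  nonanticipating : ∀ (t : Fin T) (ℓ ℓ' : LossSeq T n) (ω : Ω),
    (∀ s < t, ℓ s = ℓ' s) → act t ℓ ω = act t ℓ' ω

attribute [instance] PFEAlgorithm.mΩ PFEAlgorithm.prob

/-- The regret of playing the actions `a` against the losses `ℓ`. -/
noncomputable def regretOf {T n : ℕ} (a : Fin T → Fin n) (ℓ : LossSeq T n) : ℝ :=
  ∑ t, (ℓ t (a t) : ℝ) - ⨅ i, ∑ t, (ℓ t i : ℝ)

/-- The number of switches in a sequence of actions: the number of rounds (other than the first)
whose action differs from the action of the round before. -/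
def switchesOf {T n : ℕ} (a : Fin T → Fin n) : ℕ :=
  (Finset.univ.filter fun t : Fin T => ∃ s : Fin T, s.val + 1 = t.val ∧ a s ≠ a t).card

namespace PFEAlgorithm

variable {T n : ℕ}

/-- The algorithm never makes more than `S` switches: a hard cap, whatever the losses are and
whatever its randomness is. -/
def IsBudget (A : PFEAlgorithm T n) (S : ℕ) : Prop :=
  ∀ (ℓ : LossSeq T n) (ω : A.Ω), switchesOf (fun t => A.act t ℓ ω) ≤ S

/-- The regret as a random variable of the losses and of the randomness of the player. -/
noncomputable def regret (A : PFEAlgorithm T n) (p : LossSeq T n × A.Ω) : ℝ :=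
  regretOf (fun t => A.act t p.1 p.2) p.1

/-- The joint law of the losses and of the randomness of the player. -/
noncomputable def law (A : PFEAlgorithm T n) (D : Adversary T n) : Measure (LossSeq T n × A.Ω) :=
  (D : Measure (LossSeq T n)).prod A.μ

noncomputable def expRegret (A : PFEAlgorithm T n) (D : Adversary T n) : ℝ :=
  ∫ p, A.regret p ∂(A.law D)

end PFEAlgorithm

/-- The minimax rate: infimum over the `S`-budget algorithms of the supremum over the oblivious
adversaries of the expected regret. -/
noncomputable def minimaxRegret (T n S : ℕ) : EReal :=
  ⨅ (A : PFEAlgorithm T n) (_ : A.IsBudget S), ⨆ D : Adversary T n, ((A.expRegret D : ℝ) : EReal)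

/-- The low-switching regime `S = O(√(T log n))`, with the constant `C`. -/
def LowSwitching (C : ℝ) (T n S : ℕ) : Prop :=
  2 ≤ n ∧ 1 ≤ S ∧ S ≤ T ∧ (S : ℝ) ≤ C * √(T * Real.log n)

/-! ## The batched Bernoulli adversary -/

/-- The fair coin with values `0` and `1` in `[0, 1]`. -/
noncomputable def fairCoin : Measure I := bernoulliMeasure 1 0 ⟨1 / 2, by norm_num, by norm_num⟩

instance : IsProbabilityMeasure fairCoin := by unfold fairCoin; infer_instance

/-- The rounds are cut into consecutive epochs of length `m` (the last one may be shorter). One fair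
coin is tossed for every epoch and every action, all independent, and it is the loss of that action
in every round of that epoch. -/
noncomputable def batchedBernoulli (T n m : ℕ) : Adversary T n :=
  ⟨(Measure.pi fun _ : Fin T => Measure.pi fun _ : Fin n => fairCoin).map
      fun (X : LossSeq T n) (t : Fin T) =>
        X ⟨t.val / m, (Nat.div_le_self t.val m).trans_lt t.isLt⟩,
    Measure.isProbabilityMeasure_map
      (measurable_pi_lambda _ fun _ => measurable_pi_apply _).aemeasurable⟩

/-! ## Efficient algorithms: a real RAM with a step count

The machine has an integer memory and a real memory, both with indirect addressing, a read-only
vector that holds the losses of the last round, and a source of independent uniform random numbers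
in `[0, 1]`. Comparisons, integer addition and (truncated) subtraction, and the real operations
`+`, `-`, `*`, `/`, `log`, `exp` take one step each, and so do constants, memory accesses, conversions
from integers to reals, and random draws. There is no rounding of reals. -/

namespace RAM

/-- The random numbers that the machine draws, in this order. -/
abbrev Tape : Type := ℕ → I

/-- The law of independent uniform random numbers. -/
noncomputable def tapeLaw : Measure Tape := Measure.infinitePi fun _ => volume

structure Config where
  /-- integer memory -/
  idx : ℕ → ℕ
  /-- real memory -/
  mem : ℕ → ℝ
  /-- the losses of the last round, read-only -/
  loss : ℕ → ℝ
  /-- the number of random numbers drawn so far -/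
  drawn : ℕ
  /-- the number of steps made so far -/
  steps : ℕ

def Config.tick (s : Config) (k : ℕ) : Config := { s with steps := s.steps + k }

/-- Integer expressions. -/
inductive NExpr where
  | const (k : ℕ)
  | load (a : NExpr)
  | add (x y : NExpr)
  | sub (x y : NExpr)

def NExpr.eval (s : Config) : NExpr → ℕ
  | const k => k
  | load a => s.idx (a.eval s)
  | add x y => x.eval s + y.eval s
  | sub x y => x.eval s - y.eval s

/-- The number of steps that the evaluation takes. -/
def NExpr.size : NExpr → ℕ
  | const _ => 1
  | load a => a.size + 1
  | add x y => x.size + y.size + 1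
  | sub x y => x.size + y.size + 1

/-- Real expressions. -/
inductive RExpr where
  | const (k : ℕ)
  | cast (a : NExpr)
  | load (a : NExpr)
  | loss (a : NExpr)
  | add (x y : RExpr)
  | sub (x y : RExpr)
  | mul (x y : RExpr)
  | div (x y : RExpr)
  | log (x : RExpr)
  | exp (x : RExpr)

noncomputable def RExpr.eval (s : Config) : RExpr → ℝ
  | const k => k
  | cast a => (a.eval s : ℝ)
  | load a => s.mem (a.eval s)
  | loss a => s.loss (a.eval s)
  | add x y => x.eval s + y.eval s
  | sub x y => x.eval s - y.eval s
  | mul x y => x.eval s * y.eval s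
  | div x y => x.eval s / y.eval s
  | log x => Real.log (x.eval s)
  | exp x => Real.exp (x.eval s)

/-- The number of steps that the evaluation takes. -/
def RExpr.size : RExpr → ℕ
  | const _ => 1
  | cast a => a.size + 1
  | load a => a.size + 1
  | loss a => a.size + 1
  | add x y => x.size + y.size + 1
  | sub x y => x.size + y.size + 1
  | mul x y => x.size + y.size + 1
  | div x y => x.size + y.size + 1
  | log x => x.size + 1
  | exp x => x.size + 1

/-- Tests. -/
inductive Test where
  | ltN (x y : NExpr)
  | ltR (x y : RExpr)

def Test.holds (s : Config) : Test → Prop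
  | ltN x y => x.eval s < y.eval s
  | ltR x y => x.eval s < y.eval s

def Test.size : Test → ℕ
  | ltN x y => x.size + y.size + 1
  | ltR x y => x.size + y.size + 1

/-- Commands. -/
inductive Cmd where
  /-- do nothing -/
  | skip
  /-- write the value of `e` to the integer cell with address `a` -/
  | setN (a e : NExpr)
  /-- write the value of `e` to the real cell with address `a` -/
  | setR (a : NExpr) (e : RExpr)
  /-- draw a random number and write it to the real cell with address `a` -/
  | draw (a : NExpr)
  | seq (c d : Cmd)
  | ite (b : Test) (c d : Cmd)
  /-- evaluate `e` once, and execute `c` that many times -/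
  | rep (e : NExpr) (c : Cmd)

open Classical in
/-- The effect of a command, including its effect on the step counter. -/
noncomputable def Cmd.run (u : Tape) : Cmd → Config → Config
  | skip => fun s => s.tick 1
  | setN a e => fun s =>
      { s with
        idx := Function.update s.idx (a.eval s) (e.eval s)
        steps := s.steps + (a.size + e.size + 1) }
  | setR a e => fun s =>
      { s with
        mem := Function.update s.mem (a.eval s) (e.eval s)
        steps := s.steps + (a.size + e.size + 1) }
  | draw a => fun s =>
      { s with
        mem := Function.update s.mem (a.eval s) (u s.drawn : ℝ)
        drawn := s.drawn + 1
        steps := s.steps + (a.size + 1) }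
  | seq c d => fun s => d.run u (c.run u s)
  | ite b c d => fun s =>
      if b.holds s then c.run u (s.tick b.size) else d.run u (s.tick b.size)
  | rep e c => fun s =>
      (fun s' => c.run u (s'.tick 1))^[e.eval s] (s.tick e.size)

/-- An online program: `init` is executed once, before the game, and `step` once in every round. -/
structure Program where
  init : Cmd
  step : Cmd

/-- The initial configuration, with the inputs in the first cells and zeros elsewhere. -/
def start (ns : List ℕ) (xs : List ℝ) : Config where
  idx i := ns.getD i 0
  mem i := xs.getD i 0
  loss _ := 0
  drawn := 0
  steps := 0

/-- The loss vector that is visible in round `t`: the losses of the round before (zeros in the first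
round). -/
noncomputable def visible {T n : ℕ} (ℓ : LossSeq T n) (t i : ℕ) : ℝ :=
  if h : 1 ≤ t ∧ t - 1 < T ∧ i < n then (ℓ ⟨t - 1, h.2.1⟩ ⟨i, h.2.2⟩ : ℝ) else 0

/-- The configuration after the initialization and `t` rounds. -/
noncomputable def Program.after (P : Program) (ns : List ℕ) (xs : List ℝ) {T n : ℕ}
    (u : Tape) (ℓ : LossSeq T n) : ℕ → Config
  | 0 => P.init.run u (start ns xs)
  | t + 1 => P.step.run u { P.after ns xs u ℓ t with loss := visible ℓ t }

/-- On the inputs `ns` and `xs` the program plays as the algorithm `A` does, and it makes at most `N`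
steps in the whole game. The algorithm reads its randomness as a sequence of independent uniform
random numbers, and the action of a round is what `step` leaves in the integer cell `0`. -/
def Program.Implements (P : Program) (ns : List ℕ) (xs : List ℝ) {T n : ℕ}
    (A : PFEAlgorithm T n) (N : ℕ) : Prop :=
  ∃ U : A.Ω → Tape, MeasurePreserving U A.μ tapeLaw ∧
    ∀ (ℓ : LossSeq T n) (ω : A.Ω),
      (∀ t : Fin T, (P.after ns xs (U ω) ℓ (t.val + 1)).idx 0 = (A.act t ℓ ω).val) ∧
      (P.after ns xs (U ω) ℓ T).steps ≤ N

end RAM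

/-! ## Follow the perturbed leader with restarts -/

namespace FPL

/-! Upper bounds. The player follows the perturbed leader: it minimizes noise plus `η` times the
cumulative loss, where the noise is the logarithm of a uniform number, that is, minus a truncated
exponential variable with values in `[-log (2 n), 0]`. By near memorylessness a round changes the
leader with probability at most `2 η` (`volume_leader_change_le`), and the be-the-leader argument
charges one unit of loss to every leader change and `log (2 n) / η` to every draw of noise
(`regret_potential`).

This controls the number of changes only in expectation. The hard cap and the confidence come from
restarts: with `J` about `log₂ (1 / δ)` there are `Q = 2 J` attempts, each with fresh noise and a
share `S / Q` of the budget. For `η = S / (128 T)`, Markov's inequality shows that an attempt uses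
up its share within about `T / J` rounds with probability at most `1 / 8`. The losses are oblivious
and the noises independent, so all attempts end before `T` with probability at most `8 ^ J / 4 ^ (2
J) = 2 ^ (-J) ≤ δ` (`volume_exhausted_le`). Otherwise the regret is at most `Q log (2 n) / η + S +
1` (`regret_le`), and `S ≤ C √(T log n)` absorbs the last terms. If `S < Q`, then the claimed bound
exceeds `T` and the player never moves. The bound in expectation takes `δ = 1 / (T + 1)`. The
program is verified by the simulation invariant `Represents`.

Lower bounds. They hold for all `S ≤ T`. If the losses are constant on epochs of length `m`, then a
switch inside an epoch affects at most `m - 1` rounds; up to a price `(m - 1) S` the player decides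
once per epoch (`exists_epoch_choice`). The coins that it meets are then as good as one fixed
column: swapping the chosen action with a fixed one, row by row, is a bijection of the coin matrices
(`prob_chosen`). With `N = T / m` epochs a column deviates by order `m √(N b)` with probability at
least `4 ^ (-b) / 2`, because `b` blocks of `N / b` coins may all deviate in the same direction
(`le_prob_le_dev`). For `b` of order `log n` some action is that good, which gives the bound in
expectation and, for many actions, a bound with probability `1 / 2`; for `b` of order `log (1 / δ)`
the player itself is that unlucky compared with the average action (`gap`). Choosing `N b` of order
`S ^ 2` makes the gain beat the price `m S` and leaves `T b / S` (`exists_epoch_length`). Failure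
probabilities near `1 / 2` with few actions or bounded `T` need two other adversaries
(`le_law_twoClass`, `half_le_law_hidden`). -/

/-- The first index below `n` at which `g` is minimal. -/
noncomputable def leader (g : ℕ → ℝ) : ℕ → ℕ
  | 0 => 0
  | k + 1 => if g k < g (leader g k) then k else leader g k

theorem leader_lt (g : ℕ → ℝ) {n : ℕ} (hn : 0 < n) : leader g n < n := by
  induction n with
  | zero => omega
  | succ k ih =>
    rw [leader]
    split_ifs
    · omega
    · rcases Nat.eq_zero_or_pos k with rfl | hk
      · simp [leader]
      · have := ih hk
        omega

theorem leader_le (g : ℕ → ℝ) {n i : ℕ} (hi : i < n) : g (leader g n) ≤ g i := by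
  induction n with
  | zero => omega
  | succ k ih =>
    rw [leader]
    rcases Nat.lt_succ_iff_lt_or_eq.mp hi with h | rfl
    · have := ih h
      split_ifs <;> linarith
    · split_ifs <;> linarith

theorem leader_first (g : ℕ → ℝ) {n i : ℕ} (hi : i < leader g n) : g (leader g n) < g i := by
  induction n with
  | zero => simp [leader] at hi
  | succ k ih =>
    rw [leader] at hi ⊢
    split_ifs at hi ⊢ with h
    · exact h.trans_le (leader_le g hi)
    · exact ih hi

/-- Ties go to the smallest index, which the strict inequality records; this makes the leader
unique. -/
theorem leader_eq_iff (g : ℕ → ℝ) {n i : ℕ} (hi : i < n) :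
    leader g n = i ↔ ∀ j < n, g i ≤ g j ∧ (j < i → g i < g j) := by
  constructor
  · rintro rfl j hj
    exact ⟨leader_le g hj, leader_first g⟩
  · intro h
    rcases lt_trichotomy (leader g n) i with hlt | heq | hgt
    · have h1 := (h _ (hlt.trans hi)).2 hlt
      have h2 := leader_le g hi
      linarith
    · exact heq
    · have h1 := leader_first g hgt
      have h2 := (h _ (leader_lt g (by omega))).1
      linarith

theorem leader_congr {g g' : ℕ → ℝ} {n : ℕ} (h : ∀ i < n, g i = g' i) :
    leader g n = leader g' n := by
  rcases Nat.eq_zero_or_pos n with rfl | hn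
  · rfl
  · rw [leader_eq_iff g (leader_lt g' hn)]
    intro j hj
    rw [h _ hj, h _ (leader_lt g' hn)]
    exact ⟨leader_le g' hj, leader_first g'⟩

/-- The state of the algorithm: the perturbed cumulative losses, the current action, the tokens
that the current attempt has used up, and the number of attempts started. -/
structure State where
  score : ℕ → ℝ
  act : ℕ
  tok : ℕ
  used : ℕ

open Classical in
/-- One round. The losses `x` are added to the scores; if the leader changes, then the player either
follows it and pays `Q` tokens, or starts a new attempt with fresh noise, or is frozen. -/
noncomputable def step (η : ℝ) (n S Q cap : ℕ) (z : ℕ → ℕ → ℝ) (x : ℕ → ℝ) (s : State) : State :=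
  if leader (fun i => s.score i + η * x i) n = s.act then
    { s with score := fun i => s.score i + η * x i }
  else if S < s.tok + Q then
    if s.used < cap then ⟨z s.used, leader (z s.used) n, Q, s.used + 1⟩
    else { s with score := fun i => s.score i + η * x i }
  else ⟨fun i => s.score i + η * x i, leader (fun i => s.score i + η * x i) n, s.tok + Q, s.used⟩

/-- The state after `t` rounds. -/
noncomputable def state (η : ℝ) (n S Q cap : ℕ) (z : ℕ → ℕ → ℝ) (x : ℕ → ℕ → ℝ) : ℕ → State
  -- A dummy attempt without tokens. For `n ≥ 2` its leader differs from its action already at the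
  -- zero losses of the first round, which therefore starts the first attempt, or stays at action
  -- `0` if `cap = 0`.
  | 0 => ⟨fun i => if i = 0 then 1 else 0, 0, S, 0⟩
  | t + 1 => step η n S Q cap z (x t) (state η n S Q cap z x t)

variable {η : ℝ} {n S Q cap : ℕ} {z : ℕ → ℕ → ℝ} {x : ℕ → ℕ → ℝ}

theorem step_congr {z' : ℕ → ℕ → ℝ} {x x' : ℕ → ℝ} (s : State) (hx : ∀ i, x i = x' i)
    (hz : s.used < cap → z s.used = z' s.used) :
    step η n S Q cap z x s = step η n S Q cap z' x' s := by
  obtain rfl : x = x' := funext hx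
  unfold step
  split_ifs with h1 h2 h3
  · rfl
  · rw [hz h3]
  · rfl
  · rfl

theorem state_act_lt (hn : 0 < n) (t : ℕ) : (state η n S Q cap z x t).act < n := by
  induction t with
  | zero => exact hn
  | succ t ih =>
    rw [state, step]
    split_ifs
    · exact ih
    · exact leader_lt _ hn
    · exact ih
    · exact leader_lt _ hn

theorem state_used_le (t : ℕ) : (state η n S Q cap z x t).used ≤ cap := by
  induction t with
  | zero => simp [state]
  | succ t ih =>
    rw [state, step]
    split_ifs <;> simp <;> omega

theorem state_tok_le (hQ : 0 < cap → Q ≤ S) (t : ℕ) : (state η n S Q cap z x t).tok ≤ S := by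
  induction t with
  | zero => simp [state]
  | succ t ih =>
    rw [state, step]
    split_ifs with h1 h2 h3
    · exact ih
    · exact hQ (by omega)
    · exact ih
    · simpa using h2

/-- The number of switches among the first `t + 1` rounds. -/
noncomputable def switches (η : ℝ) (n S Q cap : ℕ) (z : ℕ → ℕ → ℝ) (x : ℕ → ℕ → ℝ) (t : ℕ) : ℕ :=
  ((Finset.range t).filter fun r =>
    (state η n S Q cap z x (r + 1)).act ≠ (state η n S Q cap z x (r + 2)).act).card

theorem switches_succ_le (t : ℕ) :
    switches η n S Q cap z x (t + 1) ≤ switches η n S Q cap z x t + 1 := by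
  unfold switches
  rw [Finset.range_add_one, Finset.filter_insert]
  split_ifs
  · exact Finset.card_insert_le _ _
  · omega

theorem switches_succ_of_eq {t : ℕ}
    (h : (state η n S Q cap z x (t + 1)).act = (state η n S Q cap z x (t + 2)).act) :
    switches η n S Q cap z x (t + 1) = switches η n S Q cap z x t := by
  unfold switches
  rw [Finset.range_add_one, Finset.filter_insert, if_neg (by simpa using h)]

/-- The dummy attempt has no tokens left, so every change of the leader is refused. -/
theorem state_of_cap_eq_zero (hQ : 0 < Q) (t : ℕ) :
    (state η n S Q 0 z x t).act = 0 ∧ (state η n S Q 0 z x t).tok = S := by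
  induction t with
  | zero => exact ⟨rfl, rfl⟩
  | succ t ih =>
    rw [state, step]
    split_ifs with h1 h2 h3
    · exact ih
    · omega
    · exact ih
    · omega

theorem leader_initial (hn : 2 ≤ n) (hx : ∀ i, x 0 i = 0) :
    leader (fun i => (if i = 0 then (1 : ℝ) else 0) + η * x 0 i) n = 1 := by
  rw [leader_eq_iff _ (by omega)]
  intro j _
  simp only [hx]
  rcases j with _ | j
  · norm_num
  · simp

theorem state_one (hn : 2 ≤ n) (hQ : 0 < Q) (hcap : 0 < cap) (hx : ∀ i, x 0 i = 0) :
    state η n S Q cap z x 1 = ⟨z 0, leader (z 0) n, Q, 1⟩ := by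
  rw [state, state, step]
  simp only [leader_initial hn hx]
  rw [if_neg (by norm_num), if_pos (by omega), if_pos hcap]

/-- Every switch is paid with `Q` tokens, whether it follows the leader or comes with a restart; an
attempt brings `S` tokens and the unspent ones are forfeited. The summand `1` is the start of the
first attempt, which is paid for but is no switch. -/
theorem switches_potential (hn : 2 ≤ n) (hQ : 0 < Q) (hcap : 0 < cap) (hQS : Q ≤ S)
    (hx : ∀ i, x 0 i = 0) (t : ℕ) :
    Q * (1 + switches η n S Q cap z x t) + S ≤
      (state η n S Q cap z x (t + 1)).used * S + (state η n S Q cap z x (t + 1)).tok := by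
  induction t with
  | zero => rw [zero_add, state_one hn hQ hcap hx]; simp [switches]; omega
  | succ t ih =>
    have h1 := switches_succ_le (η := η) (n := n) (S := S) (Q := Q) (cap := cap) (z := z) (x := x) t
    have htok := state_tok_le (η := η) (n := n) (z := z) (x := x) (fun _ : 0 < cap => hQS) (t + 1)
    have hmul : Q * (1 + switches η n S Q cap z x (t + 1)) ≤
        Q * (1 + switches η n S Q cap z x t) + Q := by nlinarith
    have hsame : (state η n S Q cap z x (t + 1)).act = (state η n S Q cap z x (t + 2)).act →
        Q * (1 + switches η n S Q cap z x (t + 1)) =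
        Q * (1 + switches η n S Q cap z x t) := fun h => by rw [switches_succ_of_eq h]
    have e : state η n S Q cap z x (t + 2) =
        step η n S Q cap z (x (t + 1)) (state η n S Q cap z x (t + 1)) := rfl
    rw [e] at hsame
    rw [show t + 1 + 1 = t + 2 from rfl, e]
    revert hsame ih htok
    generalize state η n S Q cap z x (t + 1) = s
    intro ih htok
    unfold step
    split_ifs with h2 h3 h4
    · intro h; rw [h rfl]; exact ih
    · intro _
      have : (s.used + 1) * S = s.used * S + S := by ring
      dsimp only
      omega
    · intro h; rw [h rfl]; exact ih
    · intro _
      dsimp only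
      omega

/-- At most `cap ≤ Q` attempts bring at most `Q * S` tokens, at a price of `Q` per switch. -/
theorem switches_le (hn : 2 ≤ n) (hQ : 0 < Q) (hQS : 0 < cap → Q ≤ S) (hcapQ : cap ≤ Q)
    (hx : ∀ i, x 0 i = 0) (t : ℕ) : switches η n S Q cap z x t ≤ S := by
  rcases Nat.eq_zero_or_pos cap with rfl | hcap
  · simp [switches, (state_of_cap_eq_zero (η := η) (n := n) (S := S) (z := z) (x := x) hQ _).1]
  · have h := switches_potential (η := η) (z := z) hn hQ hcap (hQS hcap) hx t
    have h1 := state_tok_le (η := η) (n := n) (z := z) (x := x) hQS (t + 1)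
    have h2 : (state η n S Q cap z x (t + 1)).used * S ≤ Q * S :=
      Nat.mul_le_mul_right _ ((state_used_le _).trans hcapQ)
    have h3 : Q * (1 + switches η n S Q cap z x t) ≤ Q * S := by omega
    have := Nat.le_of_mul_le_mul_left h3 hQ
    omega

/-- The player is blocked in a round if it can neither follow the leader nor start a new attempt. -/
def Blocked (η : ℝ) (n S Q cap : ℕ) (z : ℕ → ℕ → ℝ) (x : ℕ → ℕ → ℝ) (t : ℕ) : Prop :=
  leader (fun i => (state η n S Q cap z x t).score i + η * x t i) n ≠ (state η n S Q cap z x t).act ∧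
    S < (state η n S Q cap z x t).tok + Q ∧ cap ≤ (state η n S Q cap z x t).used

/-- The potential of the regret against a fixed action. -/
theorem regret_potential {M : ℝ} (hη : 0 ≤ η) (hn : 2 ≤ n) (hQ : 0 < Q) (hcap : 0 < cap)
    (hQS : Q ≤ S) (hx0 : ∀ i, x 0 i = 0) (hx : ∀ t i, 0 ≤ x t i ∧ x t i ≤ 1)
    (hz : ∀ j i, -M ≤ z j i ∧ z j i ≤ 0) {i : ℕ} (hi : i < n) (t : ℕ)
    (hb : ∀ r ≤ t, ¬ Blocked η n S Q cap z x r) :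
    (state η n S Q cap z x (t + 1)).act = leader (state η n S Q cap z x (t + 1)).score n ∧
    η * ∑ r ∈ Finset.range t, x (r + 1) (state η n S Q cap z x (r + 1)).act +
      (state η n S Q cap z x (t + 1)).score i + η * S / Q ≤
    η * ∑ r ∈ Finset.range t, x (r + 1) i +
      (state η n S Q cap z x (t + 1)).score (state η n S Q cap z x (t + 1)).act +
      (state η n S Q cap z x (t + 1)).used * (M + η * S / Q) +
      η * (state η n S Q cap z x (t + 1)).tok / Q := by
  have hQ' : (0 : ℝ) < Q := by exact_mod_cast hQ
  induction t with
  | zero =>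
    rw [zero_add, state_one hn hQ hcap hx0]
    simp only [Finset.range_zero, Finset.sum_empty, true_and, mul_zero, zero_add, Nat.cast_one,
      one_mul]
    have h1 := (hz 0 i).2
    have h2 := (hz 0 (leader (z 0) n)).1
    have : 0 ≤ η * Q / Q := by positivity
    linarith
  | succ t ih =>
    obtain ⟨ih1, ih2⟩ := ih fun r hr => hb r (hr.trans t.le_succ)
    have hb' := hb (t + 1) le_rfl
    have htok := state_tok_le (η := η) (n := n) (z := z) (x := x) (fun _ : 0 < cap => hQS) (t + 1)
    unfold Blocked at hb'
    rw [Finset.sum_range_succ, Finset.sum_range_succ, show t + 1 + 1 = (t + 1) + 1 from rfl,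
      state]
    revert ih1 ih2 hb' htok
    generalize state η n S Q cap z x (t + 1) = s
    generalize ∑ r ∈ Finset.range t, x (r + 1) (state η n S Q cap z x (r + 1)).act = PL
    generalize ∑ r ∈ Finset.range t, x (r + 1) i = CL
    intro ih1 ih2 hb' htok
    have hact : s.act < n := ih1 ▸ leader_lt _ (by omega)
    have hloss := mul_le_mul_of_nonneg_left (hx (t + 1) s.act).2 hη
    have hloss0 := mul_nonneg hη (hx (t + 1) s.act).1
    have hlead : ∀ j < n, s.score s.act ≤ s.score j := fun j hj => by
      rw [ih1]; exact leader_le _ hj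
    unfold step
    split_ifs with h2 h3 h4
    -- No change: the loss of the player is exactly the growth of the score of the leader.
    · refine ⟨h2.symm, ?_⟩
      dsimp only
      linarith
    -- Restart: the old leader's score is at most that of `i`, so the old scores drop out. The new
    -- noise costs `M`, and the round costs at most `η`, which the first `Q` tokens of the new
    -- attempt pay.
    · refine ⟨rfl, ?_⟩
      dsimp only
      have e1 := (hz s.used i).2
      have e2 := (hz s.used (leader (z s.used) n)).1
      have e3 : η * Q / Q = η := by field_simp
      have e4 := hlead i hi
      have e5 : η * s.tok / Q ≤ η * S / Q := by
        gcongr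
      have e6 := mul_nonneg hη (hx (t + 1) i).1
      push_cast
      rw [mul_add η PL, mul_add η CL]
      linarith
    · exact absurd ⟨h2, h3, by omega⟩ hb'
    -- Change of leader: the new leader's score is at least the old leader's score before the round,
    -- so the round is lost by at most `η`, the value of `Q` tokens.
    · refine ⟨rfl, ?_⟩
      dsimp only
      have hl := leader_lt (fun i => s.score i + η * x (t + 1) i) (show 0 < n by omega)
      have e1 := hlead _ hl
      have e2 := mul_nonneg hη (hx (t + 1) (leader (fun i => s.score i + η * x (t + 1) i) n)).1
      have e3 : η * ((s.tok + Q : ℕ) : ℝ) / Q = η * s.tok / Q + η := by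
        push_cast; field_simp
      rw [mul_add η PL, mul_add η CL, e3]
      linarith

end FPL

/-! ### Attempts as functions of their starting round and their noise -/

namespace FPL

/-- The scores in round `t` of an attempt that starts in round `τ` with the noise `z`. -/
def attemptScore (η : ℝ) (x : ℕ → ℕ → ℝ) (τ : ℕ) (z : ℕ → ℝ) (t i : ℕ) : ℝ :=
  z i + η * ∑ r ∈ Finset.Ioc τ t, x r i

noncomputable def attemptLeader (η : ℝ) (n : ℕ) (x : ℕ → ℕ → ℝ) (τ : ℕ) (z : ℕ → ℝ) (t : ℕ) : ℕ :=
  leader (attemptScore η x τ z t) n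

/-- The number of leader changes in an attempt. -/
noncomputable def changes (η : ℝ) (n : ℕ) (x : ℕ → ℕ → ℝ) (τ : ℕ) (z : ℕ → ℝ) (t : ℕ) : ℕ :=
  ((Finset.Ico τ t).filter fun r =>
    attemptLeader η n x τ z r ≠ attemptLeader η n x τ z (r + 1)).card

open Classical in
/-- The round before the horizon `T` in which an attempt runs out of tokens, or `T`. -/
noncomputable def attemptEnd (η : ℝ) (n S Q : ℕ) (x : ℕ → ℕ → ℝ) (T τ : ℕ) (z : ℕ → ℝ) : ℕ :=
  if h : ∃ t, t < T ∧ τ < t ∧ S < Q * (1 + changes η n x τ z t) then Nat.find h else T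

/-- With `q` attempts left, the first of which starts in round `τ`, all are used up before `T`. -/
def Exhausted (η : ℝ) (n S Q : ℕ) (x : ℕ → ℕ → ℝ) (T : ℕ) : ℕ → ℕ → (ℕ → ℕ → ℝ) → Prop
  | 0, τ, _ => τ < T
  | q + 1, τ, z => Exhausted η n S Q x T q (attemptEnd η n S Q x T τ (z 0)) fun j => z (j + 1)

variable {η : ℝ} {n S Q cap : ℕ} {x : ℕ → ℕ → ℝ}

theorem changes_mono (τ : ℕ) (z : ℕ → ℝ) {t t' : ℕ} (h : t ≤ t') :
    changes η n x τ z t ≤ changes η n x τ z t' :=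
  Finset.card_le_card (Finset.filter_subset_filter _ (Finset.Ico_subset_Ico_right h))

theorem changes_self (τ : ℕ) (z : ℕ → ℝ) : changes η n x τ z τ = 0 := by simp [changes]

theorem changes_succ (τ : ℕ) (z : ℕ → ℝ) {t : ℕ} (h : τ ≤ t) :
    changes η n x τ z (t + 1) = changes η n x τ z t +
      if attemptLeader η n x τ z t ≠ attemptLeader η n x τ z (t + 1) then 1 else 0 := by
  unfold changes
  rw [← Finset.insert_Ico_right_eq_Ico_add_one h, Finset.filter_insert]
  split_ifs
  · rw [Finset.card_insert_of_notMem (by simp)]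
  · rfl

theorem attemptScore_self (τ : ℕ) (z : ℕ → ℝ) : attemptScore η x τ z τ = z := by
  funext i; simp [attemptScore]

theorem attemptScore_succ (τ : ℕ) (z : ℕ → ℝ) {t : ℕ} (h : τ ≤ t) :
    attemptScore η x τ z (t + 1) = fun i => attemptScore η x τ z t i + η * x (t + 1) i := by
  funext i
  unfold attemptScore
  rw [← Finset.insert_Ioc_right_eq_Ioc_add_one h, Finset.sum_insert (by simp)]
  ring

theorem attemptEnd_eq {T τ t : ℕ} {z : ℕ → ℝ} (ht : τ ≤ t) (htT : t + 1 < T)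
    (h1 : Q * (1 + changes η n x τ z t) ≤ S) (h2 : S < Q * (1 + changes η n x τ z (t + 1))) :
    attemptEnd η n S Q x T τ z = t + 1 := by
  have h : ∃ t, t < T ∧ τ < t ∧ S < Q * (1 + changes η n x τ z t) := ⟨t + 1, htT, by omega, h2⟩
  rw [attemptEnd, dif_pos h, Nat.find_eq_iff]
  refine ⟨⟨htT, by omega, h2⟩, ?_⟩
  rintro r hr ⟨-, -, h3⟩
  have := changes_mono (η := η) (n := n) (x := x) τ z (show r ≤ t by omega)
  have : Q * (1 + changes η n x τ z r) ≤ Q * (1 + changes η n x τ z t) := by gcongr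
  omega

/-- Between restarts the state depends only on the start and the noise of the current attempt, which
is what lets the attempts be analyzed one by one. The last conjunct carries the recursion
`Exhausted` along; a restart unfolds it once. -/
theorem state_eq_attempt {T : ℕ} {z : ℕ → ℕ → ℝ} (hn : 2 ≤ n) (hQ : 0 < Q) (hQS : Q ≤ S)
    (hx0 : ∀ i, x 0 i = 0) (hexh : ¬ Exhausted η n S Q x T Q 0 z) {t : ℕ} (ht : t < T) :
    ∃ τ ≤ t, ∃ j q, j + 1 + q = Q ∧
      state η n S Q Q z x (t + 1) = ⟨attemptScore η x τ (z j) t, attemptLeader η n x τ (z j) t,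
        Q * (1 + changes η n x τ (z j) t), j + 1⟩ ∧
      Q * (1 + changes η n x τ (z j) t) ≤ S ∧
      ¬ Exhausted η n S Q x T q (attemptEnd η n S Q x T τ (z j)) fun k => z (j + 1 + k) := by
  induction t with
  | zero =>
    obtain ⟨q, rfl⟩ : ∃ q, Q = q + 1 := ⟨Q - 1, by omega⟩
    refine ⟨0, le_rfl, 0, q, by omega, ?_, ?_, ?_⟩
    · rw [zero_add, state_one hn hQ hQ hx0, attemptScore_self, attemptLeader, attemptScore_self,
        changes_self, add_zero, mul_one]
    · rw [changes_self]; omega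
    · rw [Exhausted] at hexh
      convert hexh using 4
      omega
  | succ t ih =>
    obtain ⟨τ, hτ, j, q, hq, hs, htok, hex⟩ := ih (by omega)
    have hc := changes_succ (η := η) (n := n) (x := x) τ (z j) hτ
    have hsc := attemptScore_succ (η := η) (x := x) τ (z j) hτ
    rw [state, hs, step]
    dsimp only
    rw [← hsc]
    change ∃ τ' ≤ t + 1, ∃ j' q', _ ∧ (if attemptLeader η n x τ (z j) (t + 1) = _ then _ else _) = _ ∧ _
    by_cases h1 : attemptLeader η n x τ (z j) (t + 1) = attemptLeader η n x τ (z j) t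
    · rw [if_neg (by simp [h1]), add_zero] at hc
      refine ⟨τ, by omega, j, q, hq, ?_, ?_, hex⟩
      · rw [if_pos h1, hc, h1]
      · rw [hc]; exact htok
    · rw [if_pos (fun h => h1 h.symm)] at hc
      have htok' : Q * (1 + changes η n x τ (z j) (t + 1)) =
          Q * (1 + changes η n x τ (z j) t) + Q := by rw [hc]; ring
      by_cases h2 : S < Q * (1 + changes η n x τ (z j) t) + Q
      · have hend := attemptEnd_eq (T := T) hτ (by omega) htok (by omega)
        rw [hend] at hex
        rcases q with _ | q
        · exact absurd (show t + 1 < T from ht) hex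
        · refine ⟨t + 1, le_rfl, j + 1, q, by omega, ?_, ?_, ?_⟩
          · rw [if_neg h1, if_pos h2, if_pos (by omega), attemptScore_self, attemptLeader,
              attemptScore_self, changes_self]
            simp
          · rw [changes_self]; omega
          · rw [Exhausted] at hex
            convert hex using 4
            omega
      · refine ⟨τ, by omega, j, q, hq, ?_, ?_, hex⟩
        · rw [if_neg h1, if_neg h2, htok']
          rfl
        · omega

/-- A blocked round would be the end of the last attempt, before `T`: the base case of `Exhausted`.
-/
theorem not_blocked {T : ℕ} {z : ℕ → ℕ → ℝ} (hn : 2 ≤ n) (hQ : 0 < Q) (hQS : Q ≤ S)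
    (hx0 : ∀ i, x 0 i = 0) (hexh : ¬ Exhausted η n S Q x T Q 0 z) {t : ℕ} (ht : t < T) :
    ¬ Blocked η n S Q Q z x t := by
  rintro ⟨h1, h2, h3⟩
  rcases t with _ | t
  · simp [state] at h3; omega
  · obtain ⟨τ, hτ, j, q, hq, hs, htok, hex⟩ :=
      state_eq_attempt (η := η) hn hQ hQS hx0 hexh (show t < T by omega)
    have hc := changes_succ (η := η) (n := n) (x := x) τ (z j) hτ
    have hsc := attemptScore_succ (η := η) (x := x) τ (z j) hτ
    rw [hs] at h1 h2 h3
    dsimp only at h1 h2 h3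
    rw [← hsc] at h1
    rw [if_pos (fun h => h1 h.symm)] at hc
    have htok' : Q * (1 + changes η n x τ (z j) (t + 1)) =
        Q * (1 + changes η n x τ (z j) t) + Q := by rw [hc]; ring
    have hend := attemptEnd_eq (T := T) hτ (by omega) htok (by omega)
    obtain rfl : q = 0 := by omega
    rw [hend] at hex
    exact hex (show t + 1 < T from ht)

/-- If the attempts are not exhausted, then the regret is small. -/
theorem regret_le {M : ℝ} {T : ℕ} {z : ℕ → ℕ → ℝ} (hη : 0 < η) (hn : 2 ≤ n) (hQ : 0 < Q)
    (hQS : Q ≤ S) (hT : 0 < T) (hx0 : ∀ i, x 0 i = 0) (hx : ∀ t i, 0 ≤ x t i ∧ x t i ≤ 1)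
    (hz : ∀ j i, -M ≤ z j i ∧ z j i ≤ 0) (hM : 0 ≤ M) {i : ℕ} (hi : i < n)
    (hexh : ¬ Exhausted η n S Q x T Q 0 z) :
    ∑ r ∈ Finset.range T, x (r + 1) (state η n S Q Q z x (r + 1)).act ≤
      ∑ r ∈ Finset.range T, x (r + 1) i + (Q * M / η + S + 1) := by
  -- The potential covers all rounds but the last, which adds at most one.
  obtain ⟨t, rfl⟩ : ∃ t, T = t + 1 := ⟨T - 1, by omega⟩
  have hQ' : (0 : ℝ) < Q := by exact_mod_cast hQ
  obtain ⟨h1, h2⟩ := regret_potential hη.le hn hQ hQ hQS hx0 hx hz hi t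
    fun r hr => not_blocked hn hQ hQS hx0 hexh (by omega)
  rw [Finset.sum_range_succ, Finset.sum_range_succ]
  have hlead : (state η n S Q Q z x (t + 1)).score (state η n S Q Q z x (t + 1)).act ≤
      (state η n S Q Q z x (t + 1)).score i := by
    rw [h1]; exact leader_le _ hi
  have h3 := (hx (t + 1) (state η n S Q Q z x (t + 1)).act).2
  have h4 := (hx (t + 1) i).1
  have hused : ((state η n S Q Q z x (t + 1)).used : ℝ) ≤ Q := by
    exact_mod_cast state_used_le (t + 1)
  have htok : ((state η n S Q Q z x (t + 1)).tok : ℝ) ≤ S := by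
    exact_mod_cast state_tok_le (fun _ => hQS) (t + 1)
  have h5 : ((state η n S Q Q z x (t + 1)).used : ℝ) * (M + η * S / Q) ≤ Q * (M + η * S / Q) := by
    gcongr
  have h6 : η * (state η n S Q Q z x (t + 1)).tok / Q ≤ η * S / Q := by gcongr
  have h7 : Q * (M + η * S / Q) = Q * M + η * S := by field_simp
  have h8 : η * ∑ r ∈ Finset.range t, x (r + 1) (state η n S Q Q z x (r + 1)).act ≤
      η * (∑ r ∈ Finset.range t, x (r + 1) i + (Q * M / η + S)) := by
    have : η * (Q * M / η) = Q * M := by field_simp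
    rw [mul_add, mul_add, this]
    linarith
  have h9 := le_of_mul_le_mul_left h8 hη
  linarith

end FPL

/-! ### Stability of the perturbed leader -/

namespace FPL

/-- The map `v ↦ κ v - c` scales measure by `κ`, and the part of the image that leaves the unit
interval lies in `[-c, 0)`. -/
theorem volume_affine_le {a b : Set I} {κ c : ℝ} (hκ : 0 < κ) (hκ1 : κ ≤ 1) (hc : 0 ≤ c)
    (h : ∀ v ∈ a, ∀ w : I, (w : ℝ) = κ * v - c → w ∈ b) :
    ENNReal.ofReal κ * volume a ≤ volume b + ENNReal.ofReal c := by
  have e : ∀ s : Set I, volume s = volume (((↑) : I → ℝ) '' s) := fun s =>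
    (volume_image_subtype_coe measurableSet_Icc s).symm
  rw [e a, e b]
  have h1 : volume ((fun y : ℝ => y + -c) ⁻¹' (((↑) : I → ℝ) '' b ∪ Set.Ico (-c) 0)) ≤
      volume (((↑) : I → ℝ) '' b) + ENNReal.ofReal c := by
    rw [measure_preimage_add_right]
    refine (measure_union_le _ _).trans ?_
    rw [Real.volume_Ico]
    simp
  refine le_trans ?_ h1
  have h2 := Measure.addHaar_smul (volume : Measure ℝ) κ (((↑) : I → ℝ) '' a)
  rw [Module.finrank_self, pow_one, abs_of_pos hκ] at h2
  rw [← h2]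
  apply measure_mono
  rintro _ ⟨_, ⟨v, hv, rfl⟩, rfl⟩
  simp only [smul_eq_mul, Set.mem_preimage]
  have hv0 := v.2.1
  have hv1 := v.2.2
  by_cases hneg : κ * v + -c < 0
  · right
    exact ⟨by nlinarith [mul_nonneg hκ.le hv0], hneg⟩
  · left
    refine ⟨⟨κ * v + -c, by linarith, by nlinarith⟩, h v hv _ (by ring), rfl⟩

/-- Fubini: the one-dimensional bound on every line parallel to the axis `i`, integrated over the
other coordinates. -/
theorem volume_coordinate_affine_le {k : ℕ} (i : Fin (k + 1)) {A B : Set (Fin (k + 1) → I)}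
    (hA : MeasurableSet A) (hB : MeasurableSet B) {κ c : ℝ} (hκ : 0 < κ) (hκ1 : κ ≤ 1)
    (hc : 0 ≤ c) (h : ∀ v ∈ A, ∀ w : I, (w : ℝ) = κ * v i - c → Function.update v i w ∈ B) :
    ENNReal.ofReal κ * volume A ≤ volume B + ENNReal.ofReal c := by
  have hmp := (volume_preserving_piFinSuccAbove (fun _ : Fin (k + 1) => I) i).symm
  rw [← hmp.measure_preimage hA.nullMeasurableSet, ← hmp.measure_preimage hB.nullMeasurableSet,
    Measure.volume_eq_prod, Measure.prod_apply_symm (hmp.measurable hA),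
    Measure.prod_apply_symm (hmp.measurable hB),
    ← lintegral_const_mul _ (measurable_measure_prodMk_right (hmp.measurable hA))]
  calc _ ≤ ∫⁻ y, (volume ((fun u : I => (u, y)) ⁻¹'
        ((MeasurableEquiv.piFinSuccAbove (fun _ : Fin (k + 1) => I) i).symm ⁻¹' B)) +
          ENNReal.ofReal c) ∂(volume : Measure (Fin k → I)) := by
        apply lintegral_mono
        intro y
        apply volume_affine_le hκ hκ1 hc
        intro v hv w hw
        have := h _ hv w (by simpa [Fin.insertNthEquiv] using hw)
        simpa [Fin.insertNthEquiv] using this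
    _ = _ := by
        rw [lintegral_add_right _ measurable_const]
        simp

theorem measurable_apply_nat {α : Type*} [MeasurableSpace α] {g : α → ℕ → ℝ} {f : α → ℕ}
    (hg : ∀ i, Measurable fun a => g a i) (hf : Measurable f) : Measurable fun a => g a (f a) := by
  have : Measurable fun p : ℕ × α => g p.2 p.1 := measurable_from_prod_countable_right hg
  exact this.comp (hf.prodMk measurable_id)

theorem measurable_leader {α : Type*} [MeasurableSpace α] {g : α → ℕ → ℝ}
    (hg : ∀ i, Measurable fun a => g a i) (n : ℕ) : Measurable fun a => leader (g a) n := by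
  induction n with
  | zero => exact measurable_const
  | succ k ih =>
    exact Measurable.ite (measurableSet_lt (hg k) (measurable_apply_nat hg ih)) measurable_const ih

/-- The logarithm of a uniform random number in `[1 / (2 n), 1]`. -/
noncomputable def logNoise (n : ℕ) (v : ℝ) : ℝ :=
  Real.log (1 / (2 * n) + (1 - 1 / (2 * n)) * v)

-- Minus this noise is an exponential variable conditioned to be at most `log (2 n)`: almost
-- memoryless, yet surely bounded.
open Classical in
noncomputable def noise (n : ℕ) (v : Fin n → I) (i : ℕ) : ℝ :=
  if h : i < n then logNoise n (v ⟨i, h⟩) else 0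

theorem measurable_noise (n i : ℕ) : Measurable fun v : Fin n → I => noise n v i := by
  unfold noise logNoise
  split_ifs
  · fun_prop
  · exact measurable_const

theorem noise_bounds {n : ℕ} (hn : 0 < n) (v : Fin n → I) (i : ℕ) :
    -Real.log (2 * n) ≤ noise n v i ∧ noise n v i ≤ 0 := by
  have hn' : (1 : ℝ) ≤ n := by exact_mod_cast hn
  have hlog : 0 ≤ Real.log (2 * n) := Real.log_nonneg (by linarith)
  unfold noise logNoise
  split_ifs with h
  · have h0 := (v ⟨i, h⟩).2.1
    have h1 := (v ⟨i, h⟩).2.2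
    have e1 : 0 < (1 : ℝ) / (2 * n) := by positivity
    have e2 : (1 : ℝ) / (2 * n) ≤ 1 := by rw [div_le_one (by positivity)]; linarith
    have e3 : 0 ≤ (1 - 1 / (2 * n)) * (v ⟨i, h⟩ : ℝ) := mul_nonneg (by linarith) h0
    constructor
    · rw [← Real.log_inv]
      apply Real.log_le_log (by positivity)
      rw [← one_div]
      linarith
    · apply Real.log_nonpos (by linarith)
      nlinarith
  · exact ⟨by linarith, le_rfl⟩

/-- Multiplying the number inside the logarithm by `exp (-η)` lowers the noise by `η`; the formula
for `w` is this scaling in the coordinate `v i`. -/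
theorem noise_update {n : ℕ} {η : ℝ} (hn : 2 ≤ n) (v : Fin n → I) (i : Fin n) (w : I)
    (hw : (w : ℝ) = Real.exp (-η) * v i -
      (1 - Real.exp (-η)) * (1 / (2 * n)) / (1 - 1 / (2 * n))) (j : ℕ) :
    noise n (Function.update v i w) j = noise n v j - if j = i then η else 0 := by
  have hn' : (2 : ℝ) ≤ n := by exact_mod_cast hn
  unfold noise logNoise
  split_ifs with h1 h2 h2
  · subst h2
    have h0 := (v i).2.1
    have e1 : 0 < (1 : ℝ) / (2 * n) := by positivity
    have e2 : (1 : ℝ) / (2 * n) < 1 := by rw [div_lt_one (by positivity)]; linarith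
    have e3 : 0 ≤ (1 - 1 / (2 * n)) * (v i : ℝ) := mul_nonneg (by linarith) h0
    have key : 1 / (2 * n) + (1 - 1 / (2 * n)) * (w : ℝ) =
        (1 / (2 * n) + (1 - 1 / (2 * n)) * (v i : ℝ)) * Real.exp (-η) := by
      rw [hw]
      have : (1 : ℝ) - 1 / (2 * n) ≠ 0 := by linarith
      generalize (1 : ℝ) / (2 * n) = e at *
      field_simp
      ring
    simp only [Fin.eta, Function.update_self]
    rw [key, Real.log_mul (by positivity) (Real.exp_pos _).ne', Real.log_exp]
    ring
  · rw [Function.update_of_ne (fun h => h2 (by rw [← h])), sub_zero]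
  · omega
  · simp

/-- The leader rarely changes. -/
theorem volume_leader_change_le {n : ℕ} {η : ℝ} (hη : 0 ≤ η) (hn : 2 ≤ n) {L L' : ℕ → ℝ}
    (h1 : ∀ i < n, L i ≤ L' i) (h2 : ∀ i < n, L' i ≤ L i + η) :
    volume {v : Fin n → I | leader (fun i => noise n v i + L i) n ≠
      leader (fun i => noise n v i + L' i) n} ≤ ENNReal.ofReal (2 * η) := by
  have hn' : (2 : ℝ) ≤ n := by exact_mod_cast hn
  set κ := Real.exp (-η) with hκ
  have hκ0 : 0 < κ := Real.exp_pos _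
  have hκ1 : κ ≤ 1 := Real.exp_le_one_iff.mpr (by linarith)
  set c := (1 - κ) * (1 / (2 * n)) / (1 - 1 / (2 * n)) with hc
  have e2 : (1 : ℝ) / (2 * n) ≤ 1 / 4 := by
    apply one_div_le_one_div_of_le <;> linarith
  have e1 : 0 < (1 : ℝ) / (2 * n) := by positivity
  have hc0 : 0 ≤ c := div_nonneg (mul_nonneg (by linarith) e1.le) (by linarith)
  have hm : ∀ L : ℕ → ℝ, Measurable fun v : Fin n → I => leader (fun i => noise n v i + L i) n :=
    fun L => measurable_leader (fun i => (measurable_noise n i).add_const _) n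
  -- If `i` leads for `L` and its noise drops by `η`, then it leads for `L` and for `L'`: its own
  -- score rises by at most `η` from `L` to `L'`, and no other score falls.
  have hcoord : ∀ i : Fin n, ENNReal.ofReal κ *
      volume {v : Fin n → I | leader (fun i => noise n v i + L i) n = i} ≤
      volume {v : Fin n → I | leader (fun i => noise n v i + L i) n = i ∧
        leader (fun i => noise n v i + L' i) n = i} + ENNReal.ofReal c := by
    intro i
    obtain ⟨k, rfl⟩ : ∃ k, n = k + 1 := ⟨n - 1, by omega⟩
    refine volume_coordinate_affine_le i ?_ ?_ hκ0 hκ1 hc0 ?_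
    · exact hm L (measurableSet_singleton _)
    · exact (hm L (measurableSet_singleton _)).inter (hm L' (measurableSet_singleton _))
    · intro v hv w hw
      have hu := noise_update hn v i w hw
      simp only [Set.mem_ofPred_eq] at hv ⊢
      rw [leader_eq_iff _ i.2] at hv
      rw [leader_eq_iff _ i.2, leader_eq_iff _ i.2]
      simp only [hu]
      refine ⟨fun j hj => ?_, fun j hj => ?_⟩
      all_goals
        have := h1 j hj
        have := h2 i i.2
        obtain ⟨ha, hb⟩ := hv j hj
        simp only [if_true]
        split_ifs with hji
        · subst hji; exact ⟨le_rfl, fun h => absurd h (lt_irrefl _)⟩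
        · refine ⟨by linarith, fun h => ?_⟩
          have := hb h
          linarith
  have hU : (⋃ i : Fin n, {v : Fin n → I | leader (fun i => noise n v i + L i) n = i}) =
      Set.univ := by
    ext v
    simp only [Set.mem_iUnion, Set.mem_ofPred_eq, Set.mem_univ, iff_true]
    exact ⟨⟨_, leader_lt _ (by omega)⟩, rfl⟩
  have hU' : (⋃ i : Fin n, {v : Fin n → I | leader (fun i => noise n v i + L i) n = i ∧
        leader (fun i => noise n v i + L' i) n = i}) =
      {v : Fin n → I | leader (fun i => noise n v i + L i) n =
        leader (fun i => noise n v i + L' i) n} := by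
    ext v
    simp only [Set.mem_iUnion, Set.mem_ofPred_eq]
    constructor
    · rintro ⟨i, h, h'⟩; rw [h, h']
    · intro h; exact ⟨⟨_, leader_lt _ (by omega)⟩, rfl, h.symm⟩
  have hsum : ENNReal.ofReal κ ≤ volume {v : Fin n → I | leader (fun i => noise n v i + L i) n =
        leader (fun i => noise n v i + L' i) n} + ENNReal.ofReal (n * c) := by
    calc ENNReal.ofReal κ = ENNReal.ofReal κ * volume (⋃ i : Fin n,
          {v : Fin n → I | leader (fun i => noise n v i + L i) n = i}) := by
          rw [hU, measure_univ, mul_one]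
      _ ≤ ENNReal.ofReal κ * ∑ i : Fin n,
          volume {v : Fin n → I | leader (fun i => noise n v i + L i) n = i} := by
          gcongr
          exact measure_iUnion_fintype_le _ _
      _ ≤ ∑ i : Fin n, (volume {v : Fin n → I | leader (fun i => noise n v i + L i) n = i ∧
            leader (fun i => noise n v i + L' i) n = i} + ENNReal.ofReal c) := by
          rw [Finset.mul_sum]
          exact Finset.sum_le_sum fun i _ => hcoord i
      _ = _ := by
          rw [Finset.sum_add_distrib, ← hU', measure_iUnion, tsum_fintype]
          · congr 1
            rw [Finset.sum_const, Finset.card_univ, Fintype.card_fin, nsmul_eq_mul,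
              ENNReal.ofReal_mul (by linarith), ENNReal.ofReal_natCast]
          · intro i j hij
            rw [Function.onFun, Set.disjoint_left]
            rintro v ⟨h, -⟩ ⟨h', -⟩
            exact hij (Fin.ext (h.symm.trans h'))
          · exact fun i => (hm L (measurableSet_singleton _)).inter (hm L' (measurableSet_singleton _))
  have hcompl : {v : Fin n → I | leader (fun i => noise n v i + L i) n ≠
      leader (fun i => noise n v i + L' i) n} =
      {v : Fin n → I | leader (fun i => noise n v i + L i) n =
        leader (fun i => noise n v i + L' i) n}ᶜ := rfl
  rw [hcompl, prob_compl_eq_one_sub (measurableSet_eq_fun (hm L) (hm L')), tsub_le_iff_right]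
  -- The scaling loses `1 - κ ≤ η`. The `n` boundary terms lose `n * c ≤ 1 - κ`, because the
  -- truncation at `1 / (2 n)` leaves `1 - 1 / (2 n) ≥ 1 / 2`.
  have hfin : 1 ≤ κ + (2 * η - n * c) := by
    have h3 : 1 - η ≤ κ := by have := Real.add_one_le_exp (-η); linarith
    have h4 : n * c ≤ 1 - κ := by
      rw [hc]
      have : (n : ℝ) * ((1 - κ) * (1 / (2 * n)) / (1 - 1 / (2 * n))) =
          (1 - κ) * ((1 / 2) / (1 - 1 / (2 * n))) := by field_simp
      rw [this]
      have : (1 / 2 : ℝ) / (1 - 1 / (2 * n)) ≤ 1 := by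
        rw [div_le_one (by linarith)]; linarith
      nlinarith
    linarith
  have h2η : n * c ≤ 2 * η := by
    have : κ + (2 * η - n * c) ≤ 1 + (2 * η - n * c) := by linarith
    linarith
  calc (1 : ENNReal) = ENNReal.ofReal 1 := by simp
    _ ≤ ENNReal.ofReal (κ + (2 * η - n * c)) := ENNReal.ofReal_le_ofReal hfin
    _ ≤ ENNReal.ofReal κ + ENNReal.ofReal (2 * η - n * c) := ENNReal.ofReal_add_le
    _ ≤ volume {v : Fin n → I | leader (fun i => noise n v i + L i) n =
        leader (fun i => noise n v i + L' i) n} + ENNReal.ofReal (n * c) +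
          ENNReal.ofReal (2 * η - n * c) := by gcongr
    _ = _ := by
        rw [add_assoc, ← ENNReal.ofReal_add (by positivity) (by linarith), add_comm]
        congr 2
        ring

end FPL

/-! ### Probability of short attempts and of exhaustion -/

namespace FPL

variable {η : ℝ} {n S Q : ℕ} {x : ℕ → ℕ → ℝ}

theorem measurable_attemptLeader (τ t : ℕ) :
    Measurable fun v : Fin n → I => attemptLeader η n x τ (noise n v) t :=
  measurable_leader (fun i => (measurable_noise n i).add_const _) n

theorem changes_eq_sum (τ t : ℕ) (z : ℕ → ℝ) :
    changes η n x τ z t = ∑ r ∈ Finset.Ico τ t,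
      if attemptLeader η n x τ z r ≠ attemptLeader η n x τ z (r + 1) then 1 else 0 := by
  rw [changes, Finset.card_filter]

theorem measurableSet_attemptLeader_ne (τ r : ℕ) :
    MeasurableSet {v : Fin n → I | attemptLeader η n x τ (noise n v) r ≠
      attemptLeader η n x τ (noise n v) (r + 1)} :=
  (measurableSet_eq_fun (measurable_attemptLeader τ r) (measurable_attemptLeader τ (r + 1))).compl

theorem measurable_changes (τ t : ℕ) :
    Measurable fun v : Fin n → I => changes η n x τ (noise n v) t := by
  simp only [changes_eq_sum]
  exact Finset.measurable_fun_sum _ fun r _ =>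
    Measurable.ite (measurableSet_attemptLeader_ne τ r) measurable_const measurable_const

theorem measurable_attemptEnd (T τ : ℕ) :
    Measurable fun v : Fin n → I => attemptEnd η n S Q x T τ (noise n v) := by
  classical
  have hE : ∀ t, MeasurableSet {v : Fin n → I |
      t < T ∧ τ < t ∧ S < Q * (1 + changes η n x τ (noise n v) t)} := fun t =>
    (MeasurableSet.const _).inter ((MeasurableSet.const _).inter
      (measurableSet_lt measurable_const (((measurable_changes τ t).const_add 1).const_mul Q)))
  refine measurable_to_countable' fun m => ?_
  have : (fun v : Fin n → I => attemptEnd η n S Q x T τ (noise n v)) ⁻¹' {m} =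
      ({v : Fin n → I | m < T ∧ τ < m ∧ S < Q * (1 + changes η n x τ (noise n v) m)} ∩
        ⋂ r : ℕ, {v : Fin n → I | r < m →
          ¬ (r < T ∧ τ < r ∧ S < Q * (1 + changes η n x τ (noise n v) r))}) ∪
      ({v : Fin n → I | m = T} ∩
        ⋂ r : ℕ, {v : Fin n → I |
          r < T ∧ τ < r ∧ S < Q * (1 + changes η n x τ (noise n v) r)}ᶜ) := by
    ext v
    simp only [Set.mem_preimage, Set.mem_singleton_iff, Set.mem_union, Set.mem_inter_iff,
      Set.mem_ofPred_eq, Set.mem_iInter, Set.mem_compl_iff]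
    unfold attemptEnd
    split_ifs with h
    · rw [Nat.find_eq_iff]
      constructor
      · exact Or.inl
      · rintro (h1 | h1)
        · exact h1
        · exact absurd h (not_exists.mpr h1.2)
    · constructor
      · intro hT
        exact Or.inr ⟨hT.symm, not_exists.mp h⟩
      · rintro (h1 | h1)
        · exact absurd ⟨m, h1.1⟩ h
        · exact h1.1.symm
  rw [this]
  refine MeasurableSet.union ((hE m).inter (MeasurableSet.iInter fun r => ?_))
    ((MeasurableSet.const _).inter (MeasurableSet.iInter fun r => (hE r).compl))
  by_cases hr : r < m
  · have : {v : Fin n → I | r < m →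
        ¬ (r < T ∧ τ < r ∧ S < Q * (1 + changes η n x τ (noise n v) r))} =
        {v : Fin n → I | r < T ∧ τ < r ∧ S < Q * (1 + changes η n x τ (noise n v) r)}ᶜ := by
      ext v
      simp only [hr, true_imp_iff]
      rfl
    rw [this]
    exact (hE r).compl
  · simp [hr]

theorem lintegral_changes_le (hη : 0 ≤ η) (hn : 2 ≤ n) (hx : ∀ t i, 0 ≤ x t i ∧ x t i ≤ 1)
    (τ B : ℕ) : ∫⁻ v : Fin n → I, (changes η n x τ (noise n v) (τ + B) : ENNReal) ≤
      B * ENNReal.ofReal (2 * η) := by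
  have h1 : ∀ v : Fin n → I, (changes η n x τ (noise n v) (τ + B) : ENNReal) =
      ∑ r ∈ Finset.Ico τ (τ + B), Set.indicator {v : Fin n → I |
        attemptLeader η n x τ (noise n v) r ≠ attemptLeader η n x τ (noise n v) (r + 1)} 1 v := by
    intro v
    rw [changes_eq_sum]
    push_cast
    refine Finset.sum_congr rfl fun r _ => ?_
    simp [Set.indicator_apply]
  simp only [h1]
  rw [lintegral_finsetSum _ fun r _ => measurable_one.indicator (measurableSet_attemptLeader_ne τ r)]
  calc _ ≤ ∑ r ∈ Finset.Ico τ (τ + B), ENNReal.ofReal (2 * η) := by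
        refine Finset.sum_le_sum fun r hr => ?_
        rw [lintegral_indicator_one (measurableSet_attemptLeader_ne τ r)]
        have hr' := (Finset.mem_Ico.mp hr).1
        unfold attemptLeader
        rw [show attemptScore η x τ = fun z t i => attemptScore η x τ z t i from rfl]
        refine volume_leader_change_le hη hn (fun i _ => ?_) fun i _ => ?_
        all_goals
          rw [← Finset.insert_Ioc_right_eq_Ioc_add_one hr', Finset.sum_insert (by simp), mul_add]
          have e1 := mul_nonneg hη (hx (r + 1) i).1
          have e2 := mul_le_mul_of_nonneg_left (hx (r + 1) i).2 hη
          linarith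
    _ = _ := by simp

/-- Attempts are rarely short. -/
theorem volume_attemptEnd_lt_le (hη : 0 ≤ η) (hn : 2 ≤ n) (hQ : 0 < Q) (hQS : Q ≤ S)
    (hx : ∀ t i, 0 ≤ x t i ∧ x t i ≤ 1) (T τ B : ℕ) (hB : 32 * (B * Q) * η ≤ S) :
    volume {v : Fin n → I | attemptEnd η n S Q x T τ (noise n v) < T ∧
      attemptEnd η n S Q x T τ (noise n v) < τ + B} ≤ 1 / 8 := by
  classical
  have hsub : {v : Fin n → I | attemptEnd η n S Q x T τ (noise n v) < T ∧
      attemptEnd η n S Q x T τ (noise n v) < τ + B} ⊆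
      {v : Fin n → I | (S : ENNReal) ≤ 2 * Q * changes η n x τ (noise n v) (τ + B)} := by
    rintro v ⟨h1, h2⟩
    unfold attemptEnd at h1 h2
    split_ifs at h1 h2 with h
    · obtain ⟨-, -, h3⟩ := Nat.find_spec h
      have h4 := changes_mono (η := η) (n := n) (x := x) τ (noise n v) h2.le
      simp only [Set.mem_ofPred_eq]
      norm_cast
      generalize changes η n x τ (noise n v) (Nat.find h) = a at *
      generalize changes η n x τ (noise n v) (τ + B) = b at *
      -- Since `Q ≤ S`, an attempt cannot end without a leader change; the price of its start thus
      -- costs only a factor two.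
      have h5 : 1 ≤ a := by
        by_contra h6
        have : a = 0 := by omega
        subst this
        omega
      have h6 : Q * (1 + a) ≤ Q * (2 * b) := by gcongr; omega
      have h7 : Q * (2 * b) = 2 * Q * b := by ring
      omega
    · exact absurd h1 (lt_irrefl _)
  have hS : (S : ENNReal) ≠ 0 := by norm_cast; omega
  have hm : Measurable fun v : Fin n → I =>
      (changes η n x τ (noise n v) (τ + B) : ENNReal) :=
    (measurable_from_top (f := fun k : ℕ => (k : ENNReal))).comp (measurable_changes τ (τ + B))
  refine (measure_mono hsub).trans ((meas_ge_le_lintegral_div ?_ hS (by simp)).trans ?_)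
  · exact (hm.const_mul _).aemeasurable
  · rw [lintegral_const_mul _ hm]
    rw [ENNReal.div_le_iff hS (by simp)]
    calc _ ≤ 2 * (Q : ENNReal) * (B * ENNReal.ofReal (2 * η)) := by
          gcongr; exact lintegral_changes_le hη hn hx τ B
      _ = ENNReal.ofReal (4 * (B * Q) * η) := by
          rw [show 4 * (B * Q) * η = 2 * Q * (B * (2 * η)) by ring,
            ENNReal.ofReal_mul (by positivity), ENNReal.ofReal_mul (by positivity),
            ENNReal.ofReal_mul (by positivity)]
          simp
      _ ≤ ENNReal.ofReal (1 / 8 * S) := ENNReal.ofReal_le_ofReal (by linarith)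
      _ = _ := by
          rw [ENNReal.ofReal_mul (by norm_num), ENNReal.ofReal_div_of_pos (by norm_num)]
          simp

open Classical in
/-- The noise of the attempts. -/
noncomputable def noiseSeq (q n : ℕ) (V : Fin q → Fin n → I) (j : ℕ) : ℕ → ℝ :=
  if h : j < q then noise n (V ⟨j, h⟩) else 0

theorem exhausted_succ_iff {T q τ : ℕ} (v : Fin n → I) (W : Fin q → Fin n → I) :
    Exhausted η n S Q x T (q + 1) τ (noiseSeq (q + 1) n (Fin.cons v W)) ↔
      Exhausted η n S Q x T q (attemptEnd η n S Q x T τ (noise n v)) (noiseSeq q n W) := by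
  rw [Exhausted]
  have h0 : noiseSeq (q + 1) n (Fin.cons v W) 0 = noise n v := by simp [noiseSeq]
  have h1 : (fun j => noiseSeq (q + 1) n (Fin.cons v W) (j + 1)) = noiseSeq q n W := by
    funext j
    unfold noiseSeq
    by_cases h : j < q
    · rw [dif_pos (by omega), dif_pos h]
      rfl
    · rw [dif_neg (by omega), dif_neg h]
  rw [h0, h1]

theorem piFinSuccAbove_zero_symm {q : ℕ} :
    ⇑(MeasurableEquiv.piFinSuccAbove (fun _ : Fin (q + 1) => Fin n → I) 0).symm =
      fun p : (Fin n → I) × (Fin q → Fin n → I) => (Fin.cons p.1 p.2 : Fin (q + 1) → Fin n → I) := by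
  funext p
  simp [Fin.insertNthEquiv]

theorem measurePreserving_cons {q : ℕ} :
    MeasurePreserving fun p : (Fin n → I) × (Fin q → Fin n → I) =>
      (Fin.cons p.1 p.2 : Fin (q + 1) → Fin n → I) := by
  have hmp := (volume_preserving_piFinSuccAbove (fun _ : Fin (q + 1) => Fin n → I) 0).symm
  rwa [piFinSuccAbove_zero_symm] at hmp

/-- From `τ ≥ T` on, no round qualifies as an end, so `attemptEnd` keeps returning its default value
`T`. -/
theorem not_exhausted {T q τ : ℕ} (h : T ≤ τ) (z : ℕ → ℕ → ℝ) :
    ¬ Exhausted η n S Q x T q τ z := by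
  classical
  induction q generalizing τ z with
  | zero => exact not_lt.mpr h
  | succ q ih =>
    rw [Exhausted]
    refine ih ?_ _
    unfold attemptEnd
    split_ifs with h1
    · obtain ⟨t, ht⟩ := h1
      omega
    · exact le_rfl

theorem measurableSet_exhausted (T q τ : ℕ) :
    MeasurableSet {V : Fin q → Fin n → I | Exhausted η n S Q x T q τ (noiseSeq q n V)} := by
  induction q generalizing τ with
  | zero => exact MeasurableSet.const _
  | succ q ih =>
    have h1 : MeasurableSet {p : (Fin n → I) × (Fin q → Fin n → I) | Exhausted η n S Q x T q
        (attemptEnd η n S Q x T τ (noise n p.1)) (noiseSeq q n p.2)} := by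
      have : {p : (Fin n → I) × (Fin q → Fin n → I) | Exhausted η n S Q x T q
          (attemptEnd η n S Q x T τ (noise n p.1)) (noiseSeq q n p.2)} =
          ⋃ m : ℕ, ((fun v : Fin n → I => attemptEnd η n S Q x T τ (noise n v)) ⁻¹' {m}) ×ˢ
            {W | Exhausted η n S Q x T q m (noiseSeq q n W)} := by
        ext p
        simp
      rw [this]
      exact MeasurableSet.iUnion fun m =>
        (measurable_attemptEnd T τ (measurableSet_singleton m)).prod (ih m)
    have h2 : {V : Fin (q + 1) → Fin n → I |
        Exhausted η n S Q x T (q + 1) τ (noiseSeq (q + 1) n V)} =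
        (fun V => (V 0, Fin.tail V)) ⁻¹' {p : (Fin n → I) × (Fin q → Fin n → I) |
          Exhausted η n S Q x T q (attemptEnd η n S Q x T τ (noise n p.1)) (noiseSeq q n p.2)} := by
      ext V
      simp only [Set.mem_ofPred_eq, Set.mem_preimage]
      rw [← exhausted_succ_iff, Fin.cons_self_tail]
    rw [h2]
    refine measurableSet_preimage ?_ h1
    exact (measurable_pi_apply 0).prodMk (measurable_pi_lambda _ fun i => measurable_pi_apply _)

/-- Here `k` counts the stretches of length `B` left before `T`. A short first attempt has
probability at most `1 / 8` and leaves `k` as it is; a long one lowers `k` by one. Both cases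
contribute `1 / 8` of `8 ^ k / 4 ^ q`, together the factor `1 / 4` of one more attempt. As `x` is
fixed, the noise of the later attempts is independent of where the first one ends. -/
theorem volume_exhausted_le (hη : 0 ≤ η) (hn : 2 ≤ n) (hQ : 0 < Q) (hQS : Q ≤ S)
    (hx : ∀ t i, 0 ≤ x t i ∧ x t i ≤ 1) (T B : ℕ) (hB : 32 * (B * Q) * η ≤ S) (q k τ : ℕ)
    (hk : T ≤ τ + k * B) :
    volume {V : Fin q → Fin n → I | Exhausted η n S Q x T q τ (noiseSeq q n V)} ≤
      8 ^ k / 4 ^ q := by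
  induction q generalizing k τ with
  | zero =>
    rcases k with _ | k
    · have : {V : Fin 0 → Fin n → I | Exhausted η n S Q x T 0 τ (noiseSeq 0 n V)} = ∅ := by
        ext V
        simp only [Exhausted, Set.mem_ofPred_eq, Set.mem_empty_iff_false, iff_false]
        omega
      rw [this]; simp
    · refine prob_le_one.trans ?_
      simp only [pow_zero, div_one]
      exact one_le_pow₀ (by norm_num)
  | succ q ih =>
    rw [← measurePreserving_cons.measure_preimage
      (measurableSet_exhausted T (q + 1) τ).nullMeasurableSet]
    rw [Measure.volume_eq_prod,
      Measure.prod_apply (measurePreserving_cons.measurable (measurableSet_exhausted T (q + 1) τ))]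
    have hsec : ∀ v : Fin n → I, volume (Prod.mk v ⁻¹'
        ((fun p : (Fin n → I) × (Fin q → Fin n → I) =>
          (Fin.cons p.1 p.2 : Fin (q + 1) → Fin n → I)) ⁻¹'
        {V | Exhausted η n S Q x T (q + 1) τ (noiseSeq (q + 1) n V)})) =
        volume {W : Fin q → Fin n → I | Exhausted η n S Q x T q
          (attemptEnd η n S Q x T τ (noise n v)) (noiseSeq q n W)} := by
      intro v
      congr 1
      ext W
      simp only [Set.mem_preimage, Set.mem_ofPred_eq]
      exact exhausted_succ_iff v W
    simp only [hsec]
    set E := {v : Fin n → I | attemptEnd η n S Q x T τ (noise n v) < T ∧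
      attemptEnd η n S Q x T τ (noise n v) < τ + B} with hE
    have hEm : MeasurableSet E :=
      (measurableSet_lt (measurable_attemptEnd T τ) measurable_const).inter
        (measurableSet_lt (measurable_attemptEnd T τ) measurable_const)
    have hτ : ∀ v : Fin n → I, T ≤ attemptEnd η n S Q x T τ (noise n v) ∨
        τ < attemptEnd η n S Q x T τ (noise n v) := by
      classical
      intro v
      unfold attemptEnd
      split_ifs with h
      · exact Or.inr (Nat.find_spec h).2.1
      · exact Or.inl le_rfl
    have h8 : (8 : ENNReal) ≠ 0 := by norm_num
    have h8' : (8 : ENNReal) ≠ ⊤ := by norm_num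
    calc _ ≤ ∫⁻ v : Fin n → I, (E.indicator (fun _ => (8 ^ k / 4 ^ q : ENNReal)) v +
          8 ^ k / 4 ^ q / 8) := by
          apply lintegral_mono
          intro v
          by_cases hv : v ∈ E
          · simp only [Set.indicator_of_mem hv]
            refine le_trans (ih k _ ?_) le_self_add
            rcases hτ v with h | h
            · exact h.trans (Nat.le_add_right _ _)
            · omega
          · simp only [Set.indicator_of_notMem hv, zero_add]
            rw [hE, Set.mem_ofPred_eq, not_and_or, not_lt, not_lt] at hv
            by_cases hT : T ≤ attemptEnd η n S Q x T τ (noise n v)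
            · simp [not_exhausted hT]
            · have hv' := hv.resolve_left hT
              rcases k with _ | k
              · omega
              · refine (ih k _ (by rw [add_mul] at hk; omega)).trans_eq ?_
                rw [pow_succ]
                simp only [div_eq_mul_inv]
                rw [mul_right_comm (8 ^ k), mul_assoc _ (8 : ENNReal),
                  ENNReal.mul_inv_cancel h8 h8', mul_one]
      _ = 8 ^ k / 4 ^ q * volume E + 8 ^ k / 4 ^ q / 8 := by
          rw [lintegral_add_right _ measurable_const, lintegral_indicator_const hEm]
          simp
      _ ≤ 8 ^ k / 4 ^ q * (1 / 8) + 8 ^ k / 4 ^ q / 8 := by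
          gcongr
          exact volume_attemptEnd_lt_le hη hn hQ hQS hx T τ B hB
      _ = _ := by
          have h2 : (8 : ENNReal)⁻¹ + 8⁻¹ = 4⁻¹ := by
            rw [← two_mul, show (8 : ENNReal) = 2 * 4 by norm_num,
              ENNReal.mul_inv (by simp) (by simp), ← mul_assoc,
              ENNReal.mul_inv_cancel (by simp) (by simp), one_mul]
          rw [one_div, div_eq_mul_inv _ (8 : ENNReal), ← mul_add, h2, pow_succ, div_eq_mul_inv,
            div_eq_mul_inv, ENNReal.mul_inv (by simp) (by simp), mul_assoc]

end FPL

/-! ## General facts on players -/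

theorem regretOf_le_iff {T n : ℕ} [Nonempty (Fin n)] (a : Fin T → Fin n) (ℓ : LossSeq T n) (R : ℝ) :
    regretOf a ℓ ≤ R ↔ ∀ i, ∑ t, (ℓ t (a t) : ℝ) ≤ ∑ t, (ℓ t i : ℝ) + R := by
  have : regretOf a ℓ ≤ R ↔ ∑ t, (ℓ t (a t) : ℝ) - R ≤ ⨅ i, ∑ t, (ℓ t i : ℝ) := by
    unfold regretOf
    constructor <;> intro h <;> linarith
  rw [this, le_ciInf_iff (Set.finite_range _).bddBelow]
  exact forall_congr' fun i => by constructor <;> intro h <;> linarith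

theorem le_regretOf {T n : ℕ} (a : Fin T → Fin n) (ℓ : LossSeq T n) (i : Fin n) :
    ∑ t, (ℓ t (a t) : ℝ) - ∑ t, (ℓ t i : ℝ) ≤ regretOf a ℓ := by
  have : ⨅ i, ∑ t, (ℓ t i : ℝ) ≤ ∑ t, (ℓ t i : ℝ) :=
    ciInf_le (Set.finite_range fun i => ∑ t, (ℓ t i : ℝ)).bddBelow i
  unfold regretOf
  linarith

theorem regretOf_le {T n : ℕ} (hn : 0 < n) (a : Fin T → Fin n) (ℓ : LossSeq T n) :
    regretOf a ℓ ≤ T := by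
  have : Nonempty (Fin n) := ⟨⟨0, hn⟩⟩
  rw [regretOf_le_iff]
  intro i
  have h1 : ∑ t, (ℓ t (a t) : ℝ) ≤ ∑ _t : Fin T, (1 : ℝ) :=
    Finset.sum_le_sum fun t _ => (ℓ t (a t)).2.2
  have h2 : 0 ≤ ∑ t, (ℓ t i : ℝ) := Finset.sum_nonneg fun t _ => (ℓ t i).2.1
  simp at h1
  linarith

theorem neg_le_regretOf {T n : ℕ} (hn : 0 < n) (a : Fin T → Fin n) (ℓ : LossSeq T n) :
    -(T : ℝ) ≤ regretOf a ℓ := by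
  refine le_trans ?_ (le_regretOf a ℓ ⟨0, hn⟩)
  have h1 : ∑ t, (ℓ t ⟨0, hn⟩ : ℝ) ≤ ∑ _t : Fin T, (1 : ℝ) :=
    Finset.sum_le_sum fun t _ => (ℓ t _).2.2
  have h2 : 0 ≤ ∑ t, (ℓ t (a t) : ℝ) := Finset.sum_nonneg fun t _ => (ℓ t _).2.1
  simp at h1
  linarith

namespace PFEAlgorithm

variable {T n : ℕ}

instance (A : PFEAlgorithm T n) (D : Adversary T n) : IsProbabilityMeasure (A.law D) := by
  unfold law
  infer_instance

theorem measurable_regret (A : PFEAlgorithm T n) : Measurable A.regret := by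
  unfold regret regretOf
  refine Measurable.sub (Finset.measurable_fun_sum _ fun t _ => ?_)
    (Measurable.iInf fun i => Finset.measurable_fun_sum _ fun t _ => by fun_prop)
  have h : Measurable fun p : Fin n × (LossSeq T n × A.Ω) => (p.2.1 t p.1 : ℝ) :=
    measurable_from_prod_countable_right fun i => by dsimp only; fun_prop
  exact h.comp ((A.measurable_act t).prodMk measurable_id)

theorem integrable_regret (hn : 0 < n) (A : PFEAlgorithm T n) (D : Adversary T n) :
    Integrable A.regret (A.law D) :=
  Integrable.of_bound A.measurable_regret.aestronglyMeasurable T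
    (Filter.Eventually.of_forall fun _ => abs_le.mpr ⟨neg_le_regretOf hn _ _, regretOf_le hn _ _⟩)

/-- Fubini: lower bounds may be proved for every fixed value of the player's randomness. -/
theorem le_law_real_of_forall_noise (A : PFEAlgorithm T n) (D : Adversary T n) {δ : ℝ}
    {s : Set (LossSeq T n × A.Ω)} (hs : MeasurableSet s)
    (h : ∀ ω, ENNReal.ofReal δ ≤ (D : Measure (LossSeq T n)) {ℓ | (ℓ, ω) ∈ s}) :
    δ ≤ (A.law D).real s := by
  have h1 : ENNReal.ofReal δ ≤ A.law D s := by
    unfold law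
    rw [Measure.prod_apply_symm hs]
    calc ENNReal.ofReal δ = ∫⁻ _ω, ENNReal.ofReal δ ∂A.μ := by simp
      _ ≤ _ := lintegral_mono fun ω => h ω
  exact (ENNReal.ofReal_le_iff_le_toReal (measure_ne_top _ _)).mp h1

/-- Dually, upper bounds may be proved for every fixed loss sequence, as the adversary is oblivious.
-/
theorem le_law_real_of_forall_loss (A : PFEAlgorithm T n) (D : Adversary T n) {δ : ℝ}
    {s : Set (LossSeq T n × A.Ω)} (hs : MeasurableSet s)
    (hδ : 0 ≤ δ) (h : ∀ ℓ, A.μ {ω | (ℓ, ω) ∉ s} ≤ ENNReal.ofReal δ) :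
    1 - δ ≤ (A.law D).real s := by
  have h1 : A.law D sᶜ ≤ ENNReal.ofReal δ := by
    unfold law
    rw [Measure.prod_apply hs.compl]
    calc _ ≤ ∫⁻ _ℓ, ENNReal.ofReal δ ∂(D : Measure (LossSeq T n)) := lintegral_mono fun ℓ => h ℓ
      _ = _ := by simp
  have h3 : (A.law D).real sᶜ = 1 - (A.law D).real s := probReal_compl_eq_one_sub hs
  have : (A.law D).real sᶜ ≤ δ := ENNReal.toReal_le_of_le_ofReal hδ h1
  linarith

/-- On the bad event the regret is still at most `T`. -/
theorem expRegret_le_of_tail (hn : 0 < n) (A : PFEAlgorithm T n) (D : Adversary T n) {δ R : ℝ}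
    (hR : 0 ≤ R) (h : 1 - δ ≤ (A.law D).real {p | A.regret p ≤ R}) :
    A.expRegret D ≤ R + T * δ := by
  have hs : MeasurableSet {p | A.regret p ≤ R} := measurableSet_le A.measurable_regret measurable_const
  have h1 : ∀ p, A.regret p ≤ R + Set.indicator {p | A.regret p ≤ R}ᶜ (fun _ => (T : ℝ)) p := by
    intro p
    by_cases hp : p ∈ {p | A.regret p ≤ R}
    · rw [Set.indicator_of_notMem (by simpa using hp), add_zero]
      exact hp
    · rw [Set.indicator_of_mem (by simpa using hp)]
      have := regretOf_le hn (fun t => A.act t p.1 p.2) p.1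
      unfold regret
      linarith
  have hi : Integrable (Set.indicator {p | A.regret p ≤ R}ᶜ (fun _ => (T : ℝ))) (A.law D) :=
    (integrable_const _).indicator hs.compl
  calc A.expRegret D ≤ ∫ p, (R + Set.indicator {p | A.regret p ≤ R}ᶜ (fun _ => (T : ℝ)) p)
        ∂(A.law D) :=
        integral_mono (integrable_regret hn A D) ((integrable_const _).add hi) h1
    _ = R + (A.law D).real {p | A.regret p ≤ R}ᶜ * T := by
        rw [integral_add (integrable_const _) hi, integral_indicator_const _ hs.compl]
        simp
    _ ≤ R + δ * T := by
        have h3 := probReal_compl_eq_one_sub (μ := A.law D) hs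
        gcongr
        linarith
    _ = _ := by ring

end PFEAlgorithm

/-! ### The perturbed leader as a player that reads a random tape -/

namespace FPL

theorem measurable_state {α : Type*} [MeasurableSpace α] {η : ℝ} {n S Q cap : ℕ}
    {z : α → ℕ → ℕ → ℝ} {x : α → ℕ → ℕ → ℝ} (hz : ∀ j i, Measurable fun a => z a j i)
    (hx : ∀ t i, Measurable fun a => x a t i) (t : ℕ) :
    (∀ i, Measurable fun a => (state η n S Q cap (z a) (x a) t).score i) ∧
    (Measurable fun a => (state η n S Q cap (z a) (x a) t).act) ∧
    (Measurable fun a => (state η n S Q cap (z a) (x a) t).tok) ∧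
    Measurable fun a => (state η n S Q cap (z a) (x a) t).used := by
  classical
  induction t with
  | zero => exact ⟨fun i => measurable_const, measurable_const, measurable_const, measurable_const⟩
  | succ t ih =>
    obtain ⟨h1, h2, h3, h4⟩ := ih
    have hg : ∀ i, Measurable fun a =>
        (state η n S Q cap (z a) (x a) t).score i + η * x a t i := fun i =>
      (h1 i).add ((hx t i).const_mul η)
    have hl := measurable_leader hg n
    have hz' : ∀ i, Measurable fun a => z a (state η n S Q cap (z a) (x a) t).used i := fun i =>
      measurable_apply_nat (g := fun a j => z a j i) (fun j => hz j i) h4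
    have hzl := measurable_leader hz' n
    have c1 : MeasurableSet {a | leader (fun i =>
        (state η n S Q cap (z a) (x a) t).score i + η * x a t i) n =
        (state η n S Q cap (z a) (x a) t).act} := measurableSet_eq_fun hl h2
    have c2 : MeasurableSet {a | S < (state η n S Q cap (z a) (x a) t).tok + Q} :=
      measurableSet_lt measurable_const (h3.add_const Q)
    have c3 : MeasurableSet {a | (state η n S Q cap (z a) (x a) t).used < cap} :=
      measurableSet_lt h4 measurable_const
    simp only [state, step, apply_ite State.score, apply_ite State.act, apply_ite State.tok,
      apply_ite State.used, ite_apply]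
    exact ⟨fun i => .ite c1 (hg i) (.ite c2 (.ite c3 (hz' i) (hg i)) (hg i)),
      .ite c1 h2 (.ite c2 (.ite c3 hzl h2) hl),
      .ite c1 h3 (.ite c2 (.ite c3 measurable_const h3) (h3.add_const Q)),
      .ite c1 h4 (.ite c2 (.ite c3 (h4.add_const 1) h4) h4)⟩

theorem state_congr {η : ℝ} {n S Q cap : ℕ} {z : ℕ → ℕ → ℝ} {x x' : ℕ → ℕ → ℝ} {t : ℕ}
    (h : ∀ r < t, ∀ i, x r i = x' r i) :
    state η n S Q cap z x t = state η n S Q cap z x' t := by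
  induction t with
  | zero => rfl
  | succ t ih =>
    rw [state, state, ih fun r hr => h r (by omega)]
    exact step_congr _ (h t (by omega)) fun _ => rfl

/-- The noise that is read off the tape. -/
noncomputable def tapeNoise (n : ℕ) (u : RAM.Tape) (j : ℕ) : ℕ → ℝ :=
  noise n fun i => u (j * n + i)

theorem measurable_visible {T n : ℕ} (t i : ℕ) :
    Measurable fun ℓ : LossSeq T n => RAM.visible ℓ t i := by
  unfold RAM.visible
  split_ifs
  · fun_prop
  · exact measurable_const

theorem visible_succ {T n : ℕ} (ℓ : LossSeq T n) (t : Fin T) (i : Fin n) :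
    RAM.visible ℓ (t + 1) i = ℓ t i := by
  unfold RAM.visible
  rw [dif_pos ⟨by omega, by simp, i.2⟩]
  simp

theorem visible_zero {T n : ℕ} (ℓ : LossSeq T n) (i : ℕ) : RAM.visible ℓ 0 i = 0 := by
  unfold RAM.visible
  rw [dif_neg (by omega)]

theorem visible_bounds {T n : ℕ} (ℓ : LossSeq T n) (t i : ℕ) :
    0 ≤ RAM.visible ℓ t i ∧ RAM.visible ℓ t i ≤ 1 := by
  unfold RAM.visible
  split_ifs with h
  · exact (ℓ ⟨t - 1, h.2.1⟩ ⟨i, h.2.2⟩).2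
  · exact ⟨le_rfl, zero_le_one⟩

instance : IsProbabilityMeasure RAM.tapeLaw := by
  unfold RAM.tapeLaw
  infer_instance

/-- Follow the perturbed leader with restarts, as a player. -/
noncomputable def algorithm (T n S Q cap : ℕ) (η : ℝ) (hn : 2 ≤ n) : PFEAlgorithm T n where
  Ω := RAM.Tape
  μ := RAM.tapeLaw
  -- `visible ℓ t` is the loss of round `t - 1`, so the state after `t + 1` updates has seen only
  -- the rounds before `t`.
  act t ℓ u := ⟨(state η n S Q cap (tapeNoise n u) (RAM.visible ℓ) (t + 1)).act,
    state_act_lt (by omega) _⟩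
  measurable_act t := by
    have h := (measurable_state (α := LossSeq T n × RAM.Tape) (η := η) (n := n) (S := S) (Q := Q)
      (cap := cap) (z := fun p => tapeNoise n p.2) (x := fun p => RAM.visible p.1)
      (fun j i => (measurable_noise n i).comp
        (f := fun p : LossSeq T n × RAM.Tape => fun k : Fin n => p.2 (j * n + k)) (by fun_prop))
      (fun t i => (measurable_visible t i).comp measurable_fst) (t + 1)).2.1
    refine measurable_to_countable' fun i => ?_
    convert h (measurableSet_singleton (i : ℕ)) using 1
    ext p
    simp [Fin.ext_iff]
  nonanticipating t ℓ ℓ' u h := by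
    have : ∀ r < (t : ℕ) + 1, ∀ i, RAM.visible ℓ r i = RAM.visible ℓ' r i := by
      intro r hr i
      unfold RAM.visible
      split_ifs with hc
      · rw [h ⟨r - 1, hc.2.1⟩ (by rw [Fin.lt_def]; dsimp only; omega)]
      · rfl
    simp only [state_congr this]

variable {T n S Q cap : ℕ} {η : ℝ}

theorem algorithm_isBudget (hn : 2 ≤ n) (hQ : 0 < Q) (hQS : 0 < cap → Q ≤ S) (hcap : cap ≤ Q) :
    (algorithm T n S Q cap η hn).IsBudget S := by
  intro ℓ u
  refine le_trans ?_ (switches_le (η := η) (z := tapeNoise n u) (x := RAM.visible ℓ) hn hQ hQS hcap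
    (visible_zero ℓ) T)
  unfold switchesOf switches
  refine Finset.card_le_card_of_injOn (fun t : Fin T => (t : ℕ) - 1) ?_ ?_
  · intro t ht
    simp only [Finset.coe_filter, Finset.mem_univ, true_and, Set.mem_ofPred_eq] at ht
    obtain ⟨s, hs, hne⟩ := ht
    simp only [Finset.coe_filter, Finset.mem_range, Set.mem_ofPred_eq]
    refine ⟨by omega, ?_⟩
    have e : (t : ℕ) - 1 = s := by omega
    rw [e]
    intro h
    apply hne
    rw [Fin.ext_iff]
    change (state η n S Q cap (tapeNoise n u) (RAM.visible ℓ) (s + 1)).act =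
      (state η n S Q cap (tapeNoise n u) (RAM.visible ℓ) (t + 1)).act
    rw [h, ← hs]
  · intro t ht t' ht' h
    simp only [Finset.coe_filter, Finset.mem_univ, true_and, Set.mem_ofPred_eq] at ht ht'
    obtain ⟨s, hs, -⟩ := ht
    obtain ⟨s', hs', -⟩ := ht'
    rw [Fin.ext_iff]
    dsimp only at h
    omega

theorem exhausted_congr {x : ℕ → ℕ → ℝ} {q τ : ℕ} {z z' : ℕ → ℕ → ℝ}
    (h : ∀ j < q, z j = z' j) :
    Exhausted η n S Q x T q τ z ↔ Exhausted η n S Q x T q τ z' := by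
  induction q generalizing τ z z' with
  | zero => rfl
  | succ q ih =>
    rw [Exhausted, Exhausted, h 0 (by omega)]
    exact ih fun j hj => h (j + 1) (by omega)

/-- The attempts read disjoint blocks of the tape: `j * n + i` determines `j` and `i`, and an
injective choice of coordinates of a product measure is again a product measure. -/
theorem measurePreserving_tape_blocks (q : ℕ) (hn : 0 < n) :
    MeasurePreserving (fun (u : RAM.Tape) (j : Fin q) (i : Fin n) => u (j * n + i))
      RAM.tapeLaw volume := by
  refine ⟨by fun_prop, ?_⟩
  have hinj : Function.Injective fun p : Fin q × Fin n => (p.1 : ℕ) * n + p.2 := by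
    rintro ⟨a, b⟩ ⟨c, d⟩ h
    have hd : ∀ (a : ℕ) (b : Fin n), (a * n + b) / n = a := fun a b => by
      rw [mul_comm, Nat.mul_add_div hn, Nat.div_eq_of_lt b.2, add_zero]
    dsimp only at h
    have h1 : (a : ℕ) = c := by rw [← hd a b, ← hd c d, h]
    rw [h1] at h
    ext
    · exact h1
    · dsimp only; omega
  have h1 := Measure.map_infinitePi_infinitePi_of_inj (P := fun _ : ℕ => (volume : Measure I)) hinj
  have h2 := Measure.infinitePi_map_curry fun (_ : Fin q) (_ : Fin n) => (volume : Measure I)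
  rw [← h1, Measure.map_map (MeasurableEquiv.measurable _) (by fun_prop)] at h2
  unfold RAM.tapeLaw
  refine Eq.trans ?_ (h2.trans ?_)
  · rfl
  · simp only [Measure.infinitePi_eq_pi]
    rfl

theorem tapeLaw_exhausted_le {x : ℕ → ℕ → ℝ} (hη : 0 ≤ η) (hn : 2 ≤ n) (hQ : 0 < Q) (hQS : Q ≤ S)
    (hx : ∀ t i, 0 ≤ x t i ∧ x t i ≤ 1) (B k : ℕ) (hB : 32 * (B * Q) * η ≤ S) (hk : T ≤ k * B) :
    RAM.tapeLaw {u | Exhausted η n S Q x T Q 0 (tapeNoise n u)} ≤ 8 ^ k / 4 ^ Q := by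
  refine le_trans (le_of_eq ?_) (volume_exhausted_le hη hn hQ hQS hx T B hB Q k 0 (by omega))
  rw [← (measurePreserving_tape_blocks Q (by omega)).measure_preimage
    (measurableSet_exhausted T Q 0).nullMeasurableSet]
  congr 1
  ext u
  refine exhausted_congr fun j hj => ?_
  rw [noiseSeq, dif_pos hj]
  rfl

theorem algorithm_regret_le (hη : 0 < η) (hn : 2 ≤ n) (hQ : 0 < Q) (hQS : Q ≤ S) (hT : 0 < T)
    (ℓ : LossSeq T n) (u : RAM.Tape)
    (hexh : ¬ Exhausted η n S Q (RAM.visible ℓ) T Q 0 (tapeNoise n u)) :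
    (algorithm T n S Q Q η hn).regret (ℓ, u) ≤ Q * Real.log (2 * n) / η + S + 1 := by
  have : Nonempty (Fin n) := ⟨⟨0, by omega⟩⟩
  unfold PFEAlgorithm.regret
  rw [regretOf_le_iff]
  intro i
  have hn' : (2 : ℝ) ≤ n := by exact_mod_cast hn
  have h := regret_le (M := Real.log (2 * n)) hη hn hQ hQS hT (visible_zero ℓ) (visible_bounds ℓ)
    (fun j i => noise_bounds (by omega) _ _) (Real.log_nonneg (by linarith)) i.2 hexh
  rw [Finset.sum_range, Finset.sum_range] at h
  simp only [visible_succ] at h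
  refine le_trans (le_of_eq ?_) h
  exact Finset.sum_congr rfl fun t _ =>
    (visible_succ ℓ t ((algorithm T n S Q Q η hn).act t ℓ u)).symm

end FPL

/-! ## The program -/

namespace RAM

/-- The invariant rule for loops; the invariant may depend on the number of passes made. -/
theorem Cmd.run_rep_induction {u : Tape} {e : NExpr} {c : Cmd} {s : Config} (P : ℕ → Config → Prop)
    (h0 : P 0 (s.tick e.size))
    (hs : ∀ k < e.eval s, ∀ s', P k s' → P (k + 1) (c.run u (s'.tick 1))) :
    P (e.eval s) ((Cmd.rep e c).run u s) := by
  have h : ∀ k ≤ e.eval s, P k ((fun s' => c.run u (s'.tick 1))^[k] (s.tick e.size)) := by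
    intro k hk
    induction k with
    | zero => exact h0
    | succ k ih =>
      rw [Function.iterate_succ_apply']
      exact hs k (by omega) _ (ih (by omega))
  exact h _ le_rfl

theorem Cmd.run_ite_pos {u : Tape} {b : Test} {c d : Cmd} {s : Config} (h : b.holds s) :
    (Cmd.ite b c d).run u s = c.run u (s.tick b.size) := if_pos h

theorem Cmd.run_ite_neg {u : Tape} {b : Test} {c d : Cmd} {s : Config} (h : ¬ b.holds s) :
    (Cmd.ite b c d).run u s = d.run u (s.tick b.size) := if_neg h

theorem Cmd.run_seq (u : Tape) (c d : Cmd) (s : Config) :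
    (Cmd.seq c d).run u s = d.run u (c.run u s) := rfl

/-- The content of the integer cell `k`. -/
abbrev cell (k : ℕ) : NExpr := .load (.const k)

/-- The address of the score with the index in the integer cell `k`. -/
abbrev scoreAddr (k : ℕ) : NExpr := .add (.const 2) (cell k)

abbrev incr (k : ℕ) : Cmd := .setN (.const k) (.add (cell k) (.const 1))

/-- Add the visible losses, multiplied by the learning rate, to the scores. -/
def addLosses : Cmd :=
  .seq (.setN (.const 3) (.const 0)) (.rep (cell 1) (.seq
    (.setR (scoreAddr 3) (.add (.load (scoreAddr 3)) (.mul (.load (.const 0)) (.loss (cell 3)))))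
    (incr 3)))

/-- Write the leader to the integer cell `4`. -/
def findLeader : Cmd :=
  .seq (.seq (.setN (.const 3) (.const 0)) (.setN (.const 4) (.const 0))) (.rep (cell 1) (.seq
    (.ite (.ltR (.load (scoreAddr 3)) (.load (scoreAddr 4))) (.setN (.const 4) (cell 3)) .skip)
    (incr 3)))

/-- Replace the scores with fresh noise. -/
def drawNoise : Cmd :=
  .seq (.setN (.const 3) (.const 0)) (.rep (cell 1) (.seq (.seq (.draw (scoreAddr 3))
    (.setR (scoreAddr 3) (.log (.add (.load (.const 1))
      (.mul (.sub (.const 1) (.load (.const 1))) (.load (scoreAddr 3)))))))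
    (incr 3)))

/-- One round of the player. -/
def stepCmd : Cmd :=
  .seq addLosses (.seq findLeader
    -- Subtraction is truncated, so the sum of both differences is positive exactly when the cells
    -- differ.
    (.ite (.ltN (.const 0) (.add (.sub (cell 4) (cell 0)) (.sub (cell 0) (cell 4))))
      (.ite (.ltN (cell 2) (.add (cell 5) (cell 7)))
        (.ite (.ltN (cell 6) (cell 8))
          (.seq drawNoise (.seq findLeader (.seq (.setN (.const 0) (cell 4))
            (.seq (.setN (.const 5) (cell 7)) (incr 6)))))
          .skip)
        (.seq (.setN (.const 0) (cell 4)) (.setN (.const 5) (.add (cell 5) (cell 7)))))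
      .skip))

/-- Double the failure probability until it exceeds one. -/
def countDoublings : Cmd :=
  .rep (cell 0) (.ite (.ltR (.load (.const 0)) (.const 1))
    (.seq (.setR (.const 0) (.add (.load (.const 0)) (.load (.const 0))))
      (.setN (.const 7) (.add (cell 7) (.const 2)))) .skip)

/-- The inputs `T` in integer cell `0` and `δ` in real cell `0` share their cells with the action
and the learning rate, so they are overwritten only after their last use. Cell `8`, the number of
attempts allowed, stays `0` if the budget is below the price in cell `7`. -/
def initCmd : Cmd :=
  .seq countDoublings (.seq (.ite (.ltN (cell 2) (cell 7)) .skip (.setN (.const 8) (cell 7)))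
    (.seq (.setR (.const 0) (.div (.cast (cell 2)) (.mul (.const 128) (.cast (cell 0)))))
      (.seq (.setR (.const 1) (.div (.const 1) (.mul (.const 2) (.cast (cell 1)))))
        (.seq (.setR (.const 2) (.const 1))
          (.seq (.setN (.const 5) (cell 2)) (.setN (.const 0) (.const 0)))))))

theorem addLosses_run (u : Tape) (s : Config) :
    (addLosses.run u s).idx = Function.update s.idx 3 (s.idx 1) ∧
    (addLosses.run u s).mem = (fun a => if 2 ≤ a ∧ a < 2 + s.idx 1 then
      s.mem a + s.mem 0 * s.loss (a - 2) else s.mem a) ∧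
    (addLosses.run u s).drawn = s.drawn ∧
    (addLosses.run u s).steps ≤ s.steps + 100 * (s.idx 1 + 1) := by
  have h := Cmd.run_rep_induction (u := u) (e := cell 1) (c := .seq
    (.setR (scoreAddr 3) (.add (.load (scoreAddr 3)) (.mul (.load (.const 0)) (.loss (cell 3)))))
    (incr 3)) (s := (Cmd.setN (.const 3) (.const 0)).run u s)
    (fun k s' => s'.idx = Function.update s.idx 3 k ∧
      s'.mem = (fun a => if 2 ≤ a ∧ a < 2 + k then s.mem a + s.mem 0 * s.loss (a - 2)
        else s.mem a) ∧ s'.drawn = s.drawn ∧ s'.steps ≤ s.steps + 100 * (k + 1) ∧ s'.loss = s.loss)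
    (by
      refine ⟨rfl, ?_, rfl, ?_, rfl⟩
      · funext a
        rw [if_neg (by omega)]
        rfl
      · simp [Cmd.run, Config.tick, NExpr.size])
    (by
      rintro k - s' ⟨h1, h2, h3, h4, h5⟩
      refine ⟨?_, ?_, h3, ?_, h5⟩
      · simp [Cmd.run, Config.tick, NExpr.eval, h1]
      · funext a
        simp only [Cmd.run, Config.tick, NExpr.eval, RExpr.eval, h1, h2, h5, Function.update_self,
          Function.update_apply]
        by_cases ha : a = 2 + k
        · subst ha; simp
        · rw [if_neg ha]
          exact if_congr (by omega) rfl rfl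
      · simp only [Cmd.run, Config.tick, NExpr.size, RExpr.size]
        omega)
  have e : (cell 1).eval ((Cmd.setN (.const 3) (.const 0)).run u s) = s.idx 1 := by
    simp [Cmd.run, NExpr.eval]
  rw [e] at h
  exact ⟨h.1, h.2.1, h.2.2.1, h.2.2.2.1⟩

theorem findLeader_run (u : Tape) (s : Config) :
    (findLeader.run u s).idx = Function.update (Function.update s.idx 3 (s.idx 1)) 4
      (FPL.leader (fun i => s.mem (2 + i)) (s.idx 1)) ∧
    (findLeader.run u s).mem = s.mem ∧
    (findLeader.run u s).drawn = s.drawn ∧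
    (findLeader.run u s).steps ≤ s.steps + 100 * (s.idx 1 + 1) := by
  have h := Cmd.run_rep_induction (u := u) (e := cell 1) (c := .seq
    (.ite (.ltR (.load (scoreAddr 3)) (.load (scoreAddr 4))) (.setN (.const 4) (cell 3)) .skip)
    (incr 3))
    (s := (Cmd.seq (.setN (.const 3) (.const 0)) (.setN (.const 4) (.const 0))).run u s)
    (fun k s' => s'.idx = Function.update (Function.update s.idx 3 k) 4
        (FPL.leader (fun i => s.mem (2 + i)) k) ∧
      s'.mem = s.mem ∧ s'.drawn = s.drawn ∧ s'.steps ≤ s.steps + 100 * (k + 1))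
    (by
      refine ⟨rfl, rfl, rfl, ?_⟩
      simp [Cmd.run, Config.tick, NExpr.size])
    (by
      rintro k - s' ⟨h1, h2, h3, h4⟩
      have hc : Test.holds (s'.tick 1) (.ltR (.load (scoreAddr 3)) (.load (scoreAddr 4))) ↔
          s.mem (2 + k) < s.mem (2 + FPL.leader (fun i => s.mem (2 + i)) k) := by
        simp [Test.holds, RExpr.eval, NExpr.eval, Config.tick, h1, h2]
      simp only [Cmd.run, FPL.leader, hc]
      split_ifs
      · refine ⟨?_, h2, h3, ?_⟩
        · funext a
          simp only [Config.tick, NExpr.eval, h1, Function.update_apply]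
          split_ifs <;> simp_all
        · simp only [Config.tick, NExpr.size, Test.size, RExpr.size]
          omega
      · refine ⟨?_, h2, h3, ?_⟩
        · funext a
          simp only [Config.tick, NExpr.eval, h1, Function.update_apply]
          split_ifs <;> simp_all
        · simp only [Config.tick, NExpr.size, Test.size, RExpr.size]
          omega)
  have e : (cell 1).eval
      ((Cmd.seq (.setN (.const 3) (.const 0)) (.setN (.const 4) (.const 0))).run u s) =
      s.idx 1 := by
    simp [Cmd.run, NExpr.eval]
  rw [e] at h
  exact h

theorem drawNoise_run (u : Tape) (s : Config) :
    (drawNoise.run u s).idx = Function.update s.idx 3 (s.idx 1) ∧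
    (drawNoise.run u s).mem = (fun a => if 2 ≤ a ∧ a < 2 + s.idx 1 then
      Real.log (s.mem 1 + (1 - s.mem 1) * u (s.drawn + (a - 2))) else s.mem a) ∧
    (drawNoise.run u s).drawn = s.drawn + s.idx 1 ∧
    (drawNoise.run u s).steps ≤ s.steps + 100 * (s.idx 1 + 1) := by
  have h := Cmd.run_rep_induction (u := u) (e := cell 1) (c := .seq (.seq (.draw (scoreAddr 3))
    (.setR (scoreAddr 3) (.log (.add (.load (.const 1))
      (.mul (.sub (.const 1) (.load (.const 1))) (.load (scoreAddr 3)))))))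
    (incr 3)) (s := (Cmd.setN (.const 3) (.const 0)).run u s)
    (fun k s' => s'.idx = Function.update s.idx 3 k ∧
      s'.mem = (fun a => if 2 ≤ a ∧ a < 2 + k then
        Real.log (s.mem 1 + (1 - s.mem 1) * u (s.drawn + (a - 2))) else s.mem a) ∧
      s'.drawn = s.drawn + k ∧ s'.steps ≤ s.steps + 100 * (k + 1))
    (by
      refine ⟨rfl, ?_, rfl, ?_⟩
      · funext a
        rw [if_neg (by omega)]
        rfl
      · simp [Cmd.run, Config.tick, NExpr.size])
    (by
      rintro k - s' ⟨h1, h2, h3, h4⟩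
      refine ⟨?_, ?_, ?_, ?_⟩
      · simp [Cmd.run, Config.tick, NExpr.eval, h1]
      · funext a
        simp only [Cmd.run, Config.tick, NExpr.eval, RExpr.eval, h1, h2, h3, Function.update_self,
          Function.update_apply]
        by_cases ha : a = 2 + k
        · subst ha
          simp [show ¬ 1 = 2 + k by omega]
        · rw [if_neg ha, if_neg ha]
          exact if_congr (by omega) rfl rfl
      · simp [Cmd.run, Config.tick, h3, add_assoc]
      · simp only [Cmd.run, Config.tick, NExpr.size, RExpr.size]
        omega)
  have e : (cell 1).eval ((Cmd.setN (.const 3) (.const 0)).run u s) = s.idx 1 := by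
    simp [Cmd.run, NExpr.eval]
  rw [e] at h
  exact h

/-- The configuration represents the state of the player. -/
structure Represents (η : ℝ) (n S Q cap : ℕ) (s : Config) (st : FPL.State) : Prop where
  -- The integer cells `3` and `4`, loop counter and leader, are scratch and not constrained. The
  -- last field keeps the tape aligned with the blocks of `tapeNoise`.
  act : s.idx 0 = st.act
  actions : s.idx 1 = n
  budget : s.idx 2 = S
  tok : s.idx 5 = st.tok
  used : s.idx 6 = st.used
  price : s.idx 7 = Q
  cap : s.idx 8 = cap
  rate : s.mem 0 = η
  floor : s.mem 1 = 1 / (2 * n)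
  score : ∀ i < n, s.mem (2 + i) = st.score i
  drawn : s.drawn = st.used * n

/-- The command branches as `FPL.step` does, and runs at most four loops over the actions (one
update, one draw, two searches) of at most `100 * (n + 1)` steps each. -/
theorem stepCmd_run {η : ℝ} {n S Q cap : ℕ} {s : Config} {st : FPL.State} (u : Tape) {x : ℕ → ℝ}
    (h : Represents η n S Q cap s st) (hx : ∀ i < n, s.loss i = x i) :
    Represents η n S Q cap (stepCmd.run u s) (FPL.step η n S Q cap (FPL.tapeNoise n u) x st) ∧
    (stepCmd.run u s).steps ≤ s.steps + 1000 * (n + 1) := by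
  obtain ⟨a1, a2, a3, a4⟩ := addLosses_run u s
  obtain ⟨b1, b2, b3, b4⟩ := findLeader_run u (addLosses.run u s)
  have hstep : stepCmd.run u s = (Cmd.ite
      (.ltN (.const 0) (.add (.sub (cell 4) (cell 0)) (.sub (cell 0) (cell 4))))
      (.ite (.ltN (cell 2) (.add (cell 5) (cell 7)))
        (.ite (.ltN (cell 6) (cell 8))
          (.seq drawNoise (.seq findLeader (.seq (.setN (.const 0) (cell 4))
            (.seq (.setN (.const 5) (cell 7)) (incr 6)))))
          .skip)
        (.seq (.setN (.const 0) (cell 4)) (.setN (.const 5) (.add (cell 5) (cell 7)))))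
      .skip).run u (findLeader.run u (addLosses.run u s)) := rfl
  rw [hstep]
  have hg : ∀ i < n, (addLosses.run u s).mem (2 + i) = st.score i + η * x i := by
    intro i hi
    rw [a2]
    simp only [h.actions]
    rw [if_pos ⟨by omega, by omega⟩, h.score i hi, h.rate, show 2 + i - 2 = i by omega, hx i hi]
  have hidx1 : (addLosses.run u s).idx 1 = n := by rw [a1]; simpa using h.actions
  rw [hidx1, FPL.leader_congr hg] at b1
  rw [hidx1] at b4
  rw [h.actions] at a4
  rw [← b2] at hg
  have hm0 : (findLeader.run u (addLosses.run u s)).mem 0 = η := by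
    rw [b2, a2]; simpa using h.rate
  have hm1 : (findLeader.run u (addLosses.run u s)).mem 1 = 1 / (2 * n) := by
    rw [b2, a2]; simpa using h.floor
  have hd : (findLeader.run u (addLosses.run u s)).drawn = st.used * n := by
    rw [b3, a3, h.drawn]
  have hst : (findLeader.run u (addLosses.run u s)).steps ≤ s.steps + 200 * (n + 1) := by omega
  have hi : ∀ k, k ≠ 3 → k ≠ 4 → (findLeader.run u (addLosses.run u s)).idx k = s.idx k := by
    intro k h3 h4
    rw [b1, a1]
    simp [h3, h4]
  have hi4 : (findLeader.run u (addLosses.run u s)).idx 4 =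
      FPL.leader (fun i => st.score i + η * x i) n := by
    rw [b1]; simp
  generalize findLeader.run u (addLosses.run u s) = s₁ at *
  have i0 := (hi 0 (by norm_num) (by norm_num)).trans h.act
  have i1 := (hi 1 (by norm_num) (by norm_num)).trans h.actions
  have i2 := (hi 2 (by norm_num) (by norm_num)).trans h.budget
  have i5 := (hi 5 (by norm_num) (by norm_num)).trans h.tok
  have i6 := (hi 6 (by norm_num) (by norm_num)).trans h.used
  have i7 := (hi 7 (by norm_num) (by norm_num)).trans h.price
  have i8 := (hi 8 (by norm_num) (by norm_num)).trans h.cap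
  rw [FPL.step]
  by_cases c1 : FPL.leader (fun i => st.score i + η * x i) n = st.act
  · rw [Cmd.run_ite_neg (by simp [Test.holds, NExpr.eval, i0, hi4, c1]), if_pos c1]
    refine ⟨⟨i0, i1, i2, i5, i6, i7, i8, hm0, hm1, hg, hd⟩, ?_⟩
    simp only [Cmd.run, Config.tick, Test.size, NExpr.size]
    omega
  rw [Cmd.run_ite_pos (by simp only [Test.holds, NExpr.eval, i0, hi4]; omega), if_neg c1]
  by_cases c2 : S < st.tok + Q
  swap
  · rw [Cmd.run_ite_neg (by simpa [Test.holds, NExpr.eval, Config.tick, i2, i5, i7] using c2), if_neg c2]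
    refine ⟨?_, ?_⟩
    · constructor <;>
        simp [Cmd.run, Config.tick, NExpr.eval, i1, i2, i5, i6, i7, i8, hi4, hm0, hm1, hd]
      simpa using hg
    · simp only [Cmd.run, Config.tick, Test.size, NExpr.size]
      omega
  rw [Cmd.run_ite_pos (by simpa [Test.holds, NExpr.eval, Config.tick, i2, i5, i7] using c2), if_pos c2]
  by_cases c3 : st.used < cap
  swap
  · rw [Cmd.run_ite_neg (by simpa [Test.holds, NExpr.eval, Config.tick, i6, i8] using c3), if_neg c3]
    refine ⟨⟨i0, i1, i2, i5, i6, i7, i8, hm0, hm1, hg, hd⟩, ?_⟩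
    simp only [Cmd.run, Config.tick, Test.size, NExpr.size]
    omega
  rw [Cmd.run_ite_pos (by simpa [Test.holds, NExpr.eval, Config.tick, i6, i8] using c3), if_pos c3, Cmd.run_seq,
    Cmd.run_seq]
  set s₂ := ((s₁.tick (Test.size (.ltN (.const 0)
      (.add (.sub (cell 4) (cell 0)) (.sub (cell 0) (cell 4)))))).tick
      (Test.size (.ltN (cell 2) (.add (cell 5) (cell 7))))).tick
      (Test.size (.ltN (cell 6) (cell 8))) with hs₂
  have e1 : s₂.idx = s₁.idx := rfl
  have e2 : s₂.mem = s₁.mem := rfl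
  have e3 : s₂.drawn = s₁.drawn := rfl
  have e4 : s₂.steps ≤ s₁.steps + 100 := by
    simp only [hs₂, Config.tick, Test.size, NExpr.size]
    omega
  obtain ⟨d1, d2, d3, d4⟩ := drawNoise_run u s₂
  obtain ⟨f1, f2, f3, f4⟩ := findLeader_run u (drawNoise.run u s₂)
  rw [e1, i1] at d1 d2 d3 d4
  rw [e2, e3, hm1, hd] at d2
  rw [e3, hd] at d3
  have hidx1' : (drawNoise.run u s₂).idx 1 = n := by rw [d1]; simpa using i1
  have hg' : ∀ i < n, (drawNoise.run u s₂).mem (2 + i) = FPL.tapeNoise n u st.used i := by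
    intro i hi
    rw [d2]
    simp only
    rw [if_pos ⟨by omega, by omega⟩, FPL.tapeNoise, FPL.noise, dif_pos hi, FPL.logNoise,
      show 2 + i - 2 = i by omega]
  rw [hidx1'] at f1 f4
  rw [FPL.leader_congr hg'] at f1
  rw [← f2] at hg'
  have hm0' : (findLeader.run u (drawNoise.run u s₂)).mem 0 = η := by
    rw [f2, d2]; simpa using hm0
  have hm1' : (findLeader.run u (drawNoise.run u s₂)).mem 1 = 1 / (2 * n) := by
    rw [f2, d2]; simpa using hm1
  have hd' : (findLeader.run u (drawNoise.run u s₂)).drawn = (st.used + 1) * n := by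
    rw [f3, d3]; ring
  have hi' : ∀ k, k ≠ 3 → k ≠ 4 →
      (findLeader.run u (drawNoise.run u s₂)).idx k = s₁.idx k := by
    intro k h3 h4
    rw [f1, d1]
    simp [h3, h4]
  have hi4' : (findLeader.run u (drawNoise.run u s₂)).idx 4 =
      FPL.leader (FPL.tapeNoise n u st.used) n := by
    rw [f1]; simp
  generalize findLeader.run u (drawNoise.run u s₂) = s₃ at *
  have j1 := (hi' 1 (by norm_num) (by norm_num)).trans i1
  have j2 := (hi' 2 (by norm_num) (by norm_num)).trans i2
  have j6 := (hi' 6 (by norm_num) (by norm_num)).trans i6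
  have j7 := (hi' 7 (by norm_num) (by norm_num)).trans i7
  have j8 := (hi' 8 (by norm_num) (by norm_num)).trans i8
  refine ⟨?_, ?_⟩
  · constructor <;>
      simp [Cmd.run, NExpr.eval, j1, j2, j6, j7, j8, hi4', hm0', hm1', hd']
    simpa using hg'
  · simp only [Cmd.run, NExpr.size]
    omega

end RAM

/-! ### Initialization, the number of doublings, and the step count -/

namespace RAM

open Classical in
/-- The number of times that `δ` is doubled until it reaches one, in at most `k` trials. -/
noncomputable def doublings (δ : ℝ) : ℕ → ℕ
  | 0 => 0
  | k + 1 => if 2 ^ doublings δ k * δ < 1 then doublings δ k + 1 else doublings δ k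

/-- Once the threshold is reached the count stays put; before that every trial doubles. With `T`
trials the first case means a price `2 T > S`, for which the player does not move. -/
theorem doublings_eq_or (δ : ℝ) (k : ℕ) : doublings δ k = k ∨ 1 ≤ 2 ^ doublings δ k * δ := by
  induction k with
  | zero => exact Or.inl rfl
  | succ k ih =>
    rw [doublings]
    split_ifs with h
    · exact Or.inl (by rw [ih.resolve_right (by linarith)])
    · exact Or.inr (not_lt.mp h)

theorem two_pow_lt_of_doublings {δ : ℝ} {k j : ℕ} (h : doublings δ k = j + 1) :
    2 ^ j * δ < 1 := by
  induction k with
  | zero => simp [doublings] at h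
  | succ k ih =>
    rw [doublings] at h
    split_ifs at h with h1
    · rwa [show doublings δ k = j by omega] at h1
    · exact ih h

theorem doublings_pos {δ : ℝ} (hδ : δ < 1) {k : ℕ} (hk : 0 < k) : 0 < doublings δ k := by
  rcases doublings_eq_or δ k with h | h
  · omega
  · by_contra h0
    rw [show doublings δ k = 0 by omega] at h
    simp at h
    linarith

/-- All doublings but the last end at or below the threshold, so their number is at most `log (1 /
δ) / log 2`; the last one is absorbed because `δ < 1 / 2`. -/
theorem doublings_le_log {δ : ℝ} (hδ : 0 < δ) (hδ2 : δ < 1 / 2) (k : ℕ) :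
    (doublings δ k : ℝ) ≤ 4 * Real.log (1 / δ) := by
  have hlog2 : (1 : ℝ) / 2 < Real.log 2 := by have := Real.log_two_gt_d9; linarith
  have h1 : Real.log 2 ≤ Real.log (1 / δ) := by
    apply Real.log_le_log (by norm_num)
    rw [le_div_iff₀ hδ]
    linarith
  rcases hj : doublings δ k with _ | j
  · rw [Nat.cast_zero]; linarith
  · have h2 := two_pow_lt_of_doublings hj
    have h3 : Real.log (2 ^ j) ≤ Real.log (1 / δ) := by
      apply Real.log_le_log (by positivity)
      rw [le_div_iff₀ hδ]
      exact h2.le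
    rw [Real.log_pow] at h3
    push_cast
    have : (j : ℝ) * (1 / 2) ≤ j * Real.log 2 := by gcongr
    linarith

theorem countDoublings_run (u : Tape) (s : Config) (h7 : s.idx 7 = 0) :
    (countDoublings.run u s).idx =
      Function.update s.idx 7 (2 * doublings (s.mem 0) (s.idx 0)) ∧
    (∀ a ≠ 0, (countDoublings.run u s).mem a = s.mem a) ∧
    (countDoublings.run u s).drawn = s.drawn ∧
    (countDoublings.run u s).steps ≤ s.steps + 100 * (s.idx 0 + 1) := by
  have h := Cmd.run_rep_induction (u := u) (e := cell 0)
    (c := .ite (.ltR (.load (.const 0)) (.const 1))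
    (.seq (.setR (.const 0) (.add (.load (.const 0)) (.load (.const 0))))
      (.setN (.const 7) (.add (cell 7) (.const 2)))) .skip) (s := s)
    (fun k s' => s'.idx = Function.update s.idx 7 (2 * doublings (s.mem 0) k) ∧
      s'.mem = Function.update s.mem 0 (2 ^ doublings (s.mem 0) k * s.mem 0) ∧
      s'.drawn = s.drawn ∧ s'.steps ≤ s.steps + 100 * (k + 1))
    (by
      refine ⟨?_, ?_, rfl, ?_⟩
      · have h := Function.update_eq_self 7 s.idx
        rw [h7] at h
        simp [doublings, Config.tick, h]
      · simp [doublings, Config.tick]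
      · simp [Config.tick, NExpr.size])
    (by
      rintro k - s' ⟨h1, h2, h3, h4⟩
      have hc : Test.holds (s'.tick 1) (.ltR (.load (.const 0)) (.const 1)) ↔
          2 ^ doublings (s.mem 0) k * s.mem 0 < 1 := by
        simp [Test.holds, RExpr.eval, NExpr.eval, Config.tick, h2]
      rw [doublings]
      by_cases hlt : 2 ^ doublings (s.mem 0) k * s.mem 0 < 1
      · rw [Cmd.run_ite_pos (hc.mpr hlt), if_pos hlt]
        refine ⟨?_, ?_, h3, ?_⟩
        · simp [Cmd.run, Config.tick, NExpr.eval, h1]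
          ring_nf
        · simp [Cmd.run, Config.tick, NExpr.eval, RExpr.eval, h2]
          congr 1
          ring
        · simp only [Cmd.run, Config.tick, NExpr.size, RExpr.size, Test.size]
          omega
      · rw [Cmd.run_ite_neg (fun h => hlt (hc.mp h)), if_neg hlt]
        refine ⟨h1, h2, h3, ?_⟩
        simp only [Cmd.run, Config.tick, NExpr.size, RExpr.size, Test.size]
        omega)
  obtain ⟨h1, h2, h3, h4⟩ := h
  refine ⟨h1, fun a ha => ?_, h3, h4⟩
  change _ = _ at h2
  rw [countDoublings, h2, Function.update_of_ne ha]

theorem initCmd_run {T n S : ℕ} {δ : ℝ} (u : Tape) {s : Config} (z : ℕ → ℕ → ℝ) (x : ℕ → ℕ → ℝ)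
    (h0 : s.idx 0 = T) (h1 : s.idx 1 = n) (h2 : s.idx 2 = S) (hidx : ∀ k, 3 ≤ k → s.idx k = 0)
    (hδ : s.mem 0 = δ) (hmem : ∀ k, 1 ≤ k → s.mem k = 0) (hd : s.drawn = 0) :
    Represents (S / (128 * T)) n S (2 * doublings δ T)
      (if S < 2 * doublings δ T then 0 else 2 * doublings δ T) (initCmd.run u s)
      (FPL.state (S / (128 * T)) n S (2 * doublings δ T)
        (if S < 2 * doublings δ T then 0 else 2 * doublings δ T) z x 0) ∧
    (initCmd.run u s).steps ≤ s.steps + 100 * (T + 1) + 100 := by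
  obtain ⟨c1, c2, c3, c4⟩ := countDoublings_run u s (hidx 7 (by norm_num))
  rw [h0, hδ] at c1
  rw [h0] at c4
  rw [initCmd, Cmd.run_seq]
  generalize countDoublings.run u s = s₁ at *
  have m : ∀ k, 1 ≤ k → s₁.mem k = 0 := fun k hk => by rw [c2 k (by omega), hmem k hk]
  have i0 : s₁.idx 0 = T := by rw [c1]; simpa using h0
  have i1 : s₁.idx 1 = n := by rw [c1]; simpa using h1
  have i2 : s₁.idx 2 = S := by rw [c1]; simpa using h2
  have i6 : s₁.idx 6 = 0 := by rw [c1]; simpa using hidx 6 (by norm_num)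
  have i7 : s₁.idx 7 = 2 * doublings δ T := by rw [c1]; simp
  have i8 : s₁.idx 8 = 0 := by rw [c1]; simpa using hidx 8 (by norm_num)
  rw [Cmd.run_seq]
  obtain ⟨s₂, hs₂⟩ : ∃ s₂, s₂ = (Cmd.ite (.ltN (cell 2) (cell 7)) .skip
      (.setN (.const 8) (cell 7))).run u s₁ := ⟨_, rfl⟩
  rw [← hs₂]
  have key : (∀ k ≠ 8, s₂.idx k = s₁.idx k) ∧
      s₂.idx 8 = (if S < 2 * doublings δ T then 0 else 2 * doublings δ T) ∧
      s₂.mem = s₁.mem ∧ s₂.drawn = s₁.drawn ∧ s₂.steps ≤ s₁.steps + 20 := by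
    rw [hs₂]
    split_ifs with h
    · rw [Cmd.run_ite_pos (by simpa [Test.holds, NExpr.eval, i2, i7] using h)]
      refine ⟨fun k _ => rfl, i8, rfl, rfl, ?_⟩
      simp [Cmd.run, Config.tick, Test.size, NExpr.size]
    · rw [Cmd.run_ite_neg (by simpa [Test.holds, NExpr.eval, i2, i7] using h)]
      refine ⟨fun k hk => ?_, ?_, rfl, rfl, ?_⟩
      · simp [Cmd.run, Config.tick, NExpr.eval, hk]
      · simp [Cmd.run, Config.tick, NExpr.eval, i7]
      · simp [Cmd.run, Config.tick, Test.size, NExpr.size]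
  obtain ⟨k1, k2, k3, k4, k5⟩ := key
  clear hs₂
  rw [← k1 0 (by norm_num)] at i0
  rw [← k1 1 (by norm_num)] at i1
  rw [← k1 2 (by norm_num)] at i2
  rw [← k1 6 (by norm_num)] at i6
  rw [← k1 7 (by norm_num)] at i7
  rw [← k3] at m
  refine ⟨?_, ?_⟩
  · constructor <;> simp only [FPL.state, Cmd.run, NExpr.eval, RExpr.eval, Function.update_apply]
    all_goals try norm_num [i0, i1, i2, i6, i7, k2]
    · intro i _
      rcases i with _ | i
      · simp
      · rw [if_neg (by omega), if_neg (by omega), if_neg (by omega), m _ (by omega)]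
    · rw [k4, c3, hd]
  · simp only [Cmd.run, NExpr.size, RExpr.size]
    omega

/-- The player reads the same tape as the machine, so the map between their randomness is the
identity, and `Represents` is propagated round by round. -/
theorem Program.implements_of_init {P : Program} (hP : P.step = stepCmd) {T n S Q cap N : ℕ}
    {η : ℝ} (hn : 2 ≤ n) {ns : List ℕ} {xs : List ℝ}
    (h : ∀ (u : Tape) (z : ℕ → ℕ → ℝ) (x : ℕ → ℕ → ℝ), Represents η n S Q cap
      (P.init.run u (start ns xs)) (FPL.state η n S Q cap z x 0) ∧
      (P.init.run u (start ns xs)).steps ≤ N) :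
    P.Implements ns xs (FPL.algorithm T n S Q cap η hn) (N + T * (1000 * (n + 1))) := by
  refine ⟨id, MeasurePreserving.id _, fun ℓ u => ?_⟩
  have key : ∀ t, Represents η n S Q cap (P.after ns xs u ℓ t)
      (FPL.state η n S Q cap (FPL.tapeNoise n u) (visible ℓ) t) ∧
      (P.after ns xs u ℓ t).steps ≤ N + t * (1000 * (n + 1)) := by
    intro t
    induction t with
    | zero => rw [zero_mul]; exact h u _ _
    | succ t ih =>
      obtain ⟨ih1, ih2⟩ := ih
      have h1 : Represents η n S Q cap { P.after ns xs u ℓ t with loss := visible ℓ t }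
          (FPL.state η n S Q cap (FPL.tapeNoise n u) (visible ℓ) t) := by
        obtain ⟨a, b, c, d, e, f, g, h, i, j, k⟩ := ih1
        exact ⟨a, b, c, d, e, f, g, h, i, j, k⟩
      obtain ⟨h2, h3⟩ := stepCmd_run u h1 (x := visible ℓ t) fun _ _ => rfl
      have e : P.after ns xs u ℓ (t + 1) =
          stepCmd.run u { P.after ns xs u ℓ t with loss := visible ℓ t } := by
        rw [← hP]; rfl
      rw [e]
      refine ⟨h2, h3.trans ?_⟩
      dsimp only
      rw [add_mul]
      omega
  exact ⟨fun t => (key (t + 1)).1.act, (key T).2⟩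

/-- The program for a given failure probability. -/
def program : Program := ⟨initCmd, stepCmd⟩

/-- The program for the expected regret: the failure probability is `1 / (T + 1)`. -/
def programExp : Program :=
  ⟨.seq (.setR (.const 0) (.div (.const 1) (.add (.cast (cell 0)) (.const 1)))) initCmd, stepCmd⟩

theorem Program.Implements.mono {P : Program} {ns : List ℕ} {xs : List ℝ} {T n N N' : ℕ}
    {A : PFEAlgorithm T n} (h : P.Implements ns xs A N) (hN : N ≤ N') :
    P.Implements ns xs A N' := by
  obtain ⟨U, hU, h⟩ := h
  exact ⟨U, hU, fun ℓ ω => ⟨(h ℓ ω).1, (h ℓ ω).2.trans hN⟩⟩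

/-- The coefficient and the exponent of the polynomial that bounds the number of steps. -/
def stepExponent : ℕ := 5000

/-- The count is linear in `n * T`; a single number serves as coefficient and exponent, which is
harmless as `n * T ≥ 1`. -/
theorem steps_polynomial {T n : ℕ} (hn : 2 ≤ n) (hT : 0 < T) :
    (20 + 100 * (T + 1) + 100) + T * (1000 * (n + 1)) ≤ stepExponent * (n * T) ^ stepExponent := by
  have hk : 5000 = stepExponent := rfl
  have h1 : T ≤ n * T := Nat.le_mul_of_pos_left _ (by omega)
  have h2 : n * T ≤ (n * T) ^ stepExponent := Nat.le_self_pow (by omega) _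
  have h3 : T * (1000 * (n + 1)) = 1000 * (n * T) + 1000 * T := by ring
  have h4 : 5000 * (n * T) ≤ stepExponent * (n * T) ^ stepExponent := Nat.mul_le_mul hk.le h2
  omega

end RAM

/-! ### Choice of the parameters and the regret of the player -/

namespace FPL

/-- The player for the budget `S` and the failure probability `δ`. -/
noncomputable def player (T n S : ℕ) (δ : ℝ) (hn : 2 ≤ n) : PFEAlgorithm T n :=
  algorithm T n S (2 * RAM.doublings δ T)
    (if S < 2 * RAM.doublings δ T then 0 else 2 * RAM.doublings δ T) (S / (128 * T)) hn

variable {T n S : ℕ} {δ : ℝ}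

theorem program_implements (hn : 2 ≤ n) (hT : 0 < T) :
    RAM.program.Implements [T, n, S] [δ] (player T n S δ hn) (RAM.stepExponent * (n * T) ^ RAM.stepExponent) := by
  refine RAM.Program.Implements.mono (RAM.Program.implements_of_init rfl hn fun u z x => ?_)
    (RAM.steps_polynomial hn hT)
  obtain ⟨h1, h2⟩ := RAM.initCmd_run (T := T) (n := n) (S := S) (δ := δ) u
    (s := RAM.start [T, n, S] [δ]) z x rfl rfl rfl
    (fun k hk => by obtain ⟨k, rfl⟩ := Nat.exists_eq_add_of_le' hk; rfl) rfl
    (fun k hk => by obtain ⟨k, rfl⟩ := Nat.exists_eq_add_of_le' hk; rfl) rfl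
  refine ⟨h1, h2.trans ?_⟩
  simp [RAM.start]

theorem programExp_implements (hn : 2 ≤ n) (hT : 0 < T) :
    RAM.programExp.Implements [T, n, S] [] (player T n S (1 / (T + 1)) hn)
      (RAM.stepExponent * (n * T) ^ RAM.stepExponent) := by
  refine RAM.Program.Implements.mono (RAM.Program.implements_of_init rfl hn fun u z x => ?_)
    (RAM.steps_polynomial hn hT)
  obtain ⟨h1, h2⟩ := RAM.initCmd_run (T := T) (n := n) (S := S) (δ := 1 / (T + 1)) u
    (s := (RAM.Cmd.setR (.const 0) (.div (.const 1)
      (.add (.cast (RAM.cell 0)) (.const 1)))).run u (RAM.start [T, n, S] [])) z x rfl rfl rfl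
    (fun k hk => by obtain ⟨k, rfl⟩ := Nat.exists_eq_add_of_le' hk; rfl)
    (by simp [RAM.Cmd.run, RAM.RExpr.eval, RAM.NExpr.eval, RAM.start])
    (fun k hk => by
      simp only [RAM.Cmd.run, RAM.NExpr.eval, RAM.start]
      rw [Function.update_of_ne (by omega)]; rfl) rfl
  refine ⟨h1, h2.trans ?_⟩
  simp [RAM.Cmd.run, RAM.start, RAM.NExpr.size, RAM.RExpr.size]

theorem player_isBudget (hn : 2 ≤ n) (hT : 0 < T) (hδ : δ < 1) :
    (player T n S δ hn).IsBudget S := by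
  have := RAM.doublings_pos hδ hT
  refine algorithm_isBudget hn (by omega) (fun h => ?_) (by split_ifs <;> omega)
  split_ifs at h with h1
  · omega
  · omega

/-- With `J` doublings, `Q = 2 J` attempts and stretches of length `B = T / J + 1`, there are `J * B
≥ T` rounds in `J` stretches and `J * B ≤ 2 T` gives `32 B Q η ≤ S` for `η = S / (128 T)`. The bound
`S ≤ C √(T log n)` serves only to absorb `S + 1` into `T log n / S`. -/
theorem player_regret {C : ℝ} (hC : 0 < C) (h : LowSwitching C T n S) (hδ : 0 < δ)
    (hδ2 : δ < 1 / 2) (D : Adversary T n) :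
    1 - δ ≤ ((player T n S δ h.1).law D).real {p | (player T n S δ h.1).regret p ≤
      (2100 + 4 * C ^ 2) * (T * Real.log n * Real.log (1 / δ) / S)} := by
  obtain ⟨hn, hS, hST, hSC⟩ := id h
  have hT : 0 < T := by omega
  have hlog2 : (1 : ℝ) / 2 < Real.log 2 := by have := Real.log_two_gt_d9; linarith
  have hlogn : Real.log 2 ≤ Real.log n := Real.log_le_log (by norm_num) (by exact_mod_cast hn)
  have hlogδ : Real.log 2 ≤ Real.log (1 / δ) := by
    apply Real.log_le_log (by norm_num)
    rw [le_div_iff₀ hδ]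
    linarith
  have hS' : (1 : ℝ) ≤ S := by exact_mod_cast hS
  have hT' : (1 : ℝ) ≤ T := by exact_mod_cast hT
  have hJ := RAM.doublings_le_log hδ hδ2 T
  have hJpos := RAM.doublings_pos (by linarith : δ < 1) hT
  set lam := Real.log (1 / δ) with hlam
  have hlam0 : 0 < lam := by linarith
  have hlogn0 : 0 < Real.log n := by linarith
  refine PFEAlgorithm.le_law_real_of_forall_loss _ D
    (measurableSet_le (PFEAlgorithm.measurable_regret _) measurable_const) hδ.le fun ℓ => ?_
  -- For so small a budget `S` is at most `8 log (1 / δ)`, and the claimed bound exceeds the trivial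
  -- bound `T`.
  by_cases hcase : S < 2 * RAM.doublings δ T
  · have hR : (T : ℝ) ≤ (2100 + 4 * C ^ 2) * (T * Real.log n * lam / S) := by
      have h1 : (S : ℝ) ≤ 8 * lam := by
        have : (S : ℝ) ≤ 2 * RAM.doublings δ T := by exact_mod_cast hcase.le
        linarith
      have h2 : (S : ℝ) ≤ 16 * (Real.log n * lam) := by nlinarith
      have h3 : 1 ≤ 16 * (Real.log n * lam) / S := by
        rw [le_div_iff₀ (by linarith)]; linarith
      have h4 : 0 ≤ Real.log n * lam / S := by positivity
      have h5 : (2100 + 4 * C ^ 2) * (T * Real.log n * lam / S) =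
          T * (16 * (Real.log n * lam) / S) +
            (2084 + 4 * C ^ 2) * (T * (Real.log n * lam / S)) := by ring
      rw [h5]
      have h6 : 0 ≤ (2084 + 4 * C ^ 2) * (T * (Real.log n * lam / S)) := by positivity
      nlinarith
    have : {u | (ℓ, u) ∉ {p | (player T n S δ hn).regret p ≤
        (2100 + 4 * C ^ 2) * (T * Real.log n * lam / S)}} = ∅ := by
      ext u
      simp only [Set.mem_ofPred_eq, Set.mem_empty_iff_false, iff_false, not_not]
      exact (regretOf_le (by omega) _ _).trans hR
    rw [this]
    simp
  · set J := RAM.doublings δ T with hJdef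
    have hplayer : player T n S δ hn = algorithm T n S (2 * J) (2 * J) (S / (128 * T)) hn := by
      rw [player, if_neg hcase]
    rw [hplayer]
    have hη : (0 : ℝ) < S / (128 * T) := by positivity
    -- The trials did not run out: `J = T` would contradict `2 J ≤ S ≤ T`.
    have hδJ : 1 ≤ 2 ^ J * δ := (RAM.doublings_eq_or δ T).resolve_left (by omega)
    have hJT : J * (T / J + 1) ≤ 2 * T := by
      have := Nat.mul_div_le T J
      rw [mul_add]; omega
    have hJT2 : T ≤ J * (T / J + 1) := by
      have := Nat.lt_mul_div_succ T hJpos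
      omega
    have hB : 32 * (((T / J + 1 : ℕ) : ℝ) * ((2 * J : ℕ) : ℝ)) * (S / (128 * T)) ≤ S := by
      have h1 : ((J * (T / J + 1) : ℕ) : ℝ) ≤ 2 * T := by exact_mod_cast hJT
      have h2 : 32 * (((T / J + 1 : ℕ) : ℝ) * ((2 * J : ℕ) : ℝ)) * (S / (128 * T)) =
          ((J * (T / J + 1) : ℕ) : ℝ) * (S / (2 * T)) := by
        push_cast; field_simp; ring
      rw [h2]
      calc _ ≤ (2 * T : ℝ) * (S / (2 * T)) := by gcongr
        _ = S := by field_simp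
    have hR : ((2 * J : ℕ) : ℝ) * Real.log (2 * n) / (S / (128 * T)) + S + 1 ≤
        (2100 + 4 * C ^ 2) * (T * Real.log n * lam / S) := by
      have h1 : Real.log (2 * n) ≤ 2 * Real.log n := by
        rw [Real.log_mul (by norm_num) (by positivity)]; linarith
      have h2 : ((2 * J : ℕ) : ℝ) * Real.log (2 * n) / (S / (128 * T)) ≤
          2048 * (T * Real.log n * lam / S) := by
        have h0 : 0 ≤ Real.log (2 * n) := Real.log_nonneg (by
          have : (2 : ℝ) ≤ n := by exact_mod_cast hn
          linarith)
        have h3 : ((2 * J : ℕ) : ℝ) ≤ 8 * lam := by push_cast; linarith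
        calc _ ≤ (8 * lam) * (2 * Real.log n) / (S / (128 * T)) := by
              gcongr
          _ = _ := by field_simp; ring
      have h4 : (S : ℝ) ^ 2 ≤ C ^ 2 * (T * Real.log n) := by
        calc (S : ℝ) ^ 2 ≤ (C * √(T * Real.log n)) ^ 2 := by gcongr
          _ = _ := by rw [mul_pow, Real.sq_sqrt (by positivity)]
      have h5 : (S : ℝ) + 1 ≤ 4 * C ^ 2 * (T * Real.log n * lam / S) := by
        rw [mul_div_assoc', le_div_iff₀ (by linarith)]
        have h6 : 0 ≤ C ^ 2 * (T * Real.log n) := by positivity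
        nlinarith
      have h6 : 0 ≤ T * Real.log n * lam / S := by positivity
      nlinarith
    have hsub : {u | (ℓ, u) ∉ {p | (algorithm T n S (2 * J) (2 * J) (S / (128 * T)) hn).regret p ≤
        (2100 + 4 * C ^ 2) * (T * Real.log n * lam / S)}} ⊆
        {u | Exhausted (S / (128 * T)) n S (2 * J) (RAM.visible ℓ) T (2 * J) 0 (tapeNoise n u)} := by
      intro u hu
      by_contra hexh
      exact hu ((algorithm_regret_le hη hn (by omega) (by omega) hT ℓ u hexh).trans hR)
    refine (measure_mono hsub).trans ((tapeLaw_exhausted_le hη.le hn (by omega) (by omega)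
      (visible_bounds ℓ) (T / J + 1) J hB hJT2).trans ?_)
    have h8 : (8 : ENNReal) ^ J / 4 ^ (2 * J) = ENNReal.ofReal ((1 / 2) ^ J) := by
      rw [ENNReal.ofReal_pow (by norm_num), ENNReal.ofReal_div_of_pos (by norm_num), pow_mul,
        div_eq_mul_inv, ENNReal.inv_pow, ← mul_pow, ← div_eq_mul_inv]
      congr 1
      rw [ENNReal.div_eq_div_iff] <;> norm_num
    rw [h8]
    apply ENNReal.ofReal_le_ofReal
    rw [one_div, inv_pow]
    exact (inv_le_iff_one_le_mul₀' (by positivity)).mpr hδJ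

/-- Failing with probability `1 / (T + 1)` costs at most one, and `log (T + 1) ≤ 2 log T`. -/
theorem player_expRegret {C : ℝ} (hC : 0 < C) (h : LowSwitching C T n S) (hT : 2 ≤ T)
    (D : Adversary T n) : (player T n S (1 / (T + 1)) h.1).expRegret D ≤
      (4204 + 8 * C ^ 2) * (T * Real.log n * Real.log T / S) := by
  obtain ⟨hn, hS, hST, hSC⟩ := id h
  have hlog2 : (1 : ℝ) / 2 < Real.log 2 := by have := Real.log_two_gt_d9; linarith
  have hlogn : Real.log 2 ≤ Real.log n := Real.log_le_log (by norm_num) (by exact_mod_cast hn)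
  have hT' : (2 : ℝ) ≤ T := by exact_mod_cast hT
  have hlogT : Real.log 2 ≤ Real.log T := Real.log_le_log (by norm_num) hT'
  have hS' : (1 : ℝ) ≤ S := by exact_mod_cast hS
  have hST' : (S : ℝ) ≤ T := by exact_mod_cast hST
  have hlogn0 : 0 < Real.log n := by linarith
  have hδ : (1 : ℝ) / (T + 1) < 1 / 2 := by
    apply one_div_lt_one_div_of_lt <;> linarith
  have hlog : Real.log (1 / (1 / ((T : ℝ) + 1))) ≤ 2 * Real.log T := by
    rw [one_div_one_div, ← Real.log_rpow (by linarith)]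
    apply Real.log_le_log (by linarith)
    norm_num
    nlinarith
  have h0 : 0 ≤ Real.log (1 / (1 / ((T : ℝ) + 1))) := by
    rw [one_div_one_div]; exact Real.log_nonneg (by linarith)
  have h1 := PFEAlgorithm.expRegret_le_of_tail (by omega) _ D
    (by positivity) (player_regret hC h (by positivity) hδ D)
  refine h1.trans ?_
  have h2 : (T : ℝ) * (1 / (T + 1)) ≤ 1 := by
    rw [mul_one_div, div_le_one (by linarith)]; linarith
  have h3 : 1 ≤ 4 * (T * Real.log n * Real.log T / S) := by
    rw [mul_div_assoc', le_div_iff₀ (by linarith)]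
    have : 1 / 4 ≤ Real.log n * Real.log T := by nlinarith
    nlinarith
  have h4 : T * Real.log n * Real.log (1 / (1 / ((T : ℝ) + 1))) / S ≤
      2 * (T * Real.log n * Real.log T / S) := by
    calc _ ≤ T * Real.log n * (2 * Real.log T) / S := by gcongr
      _ = _ := by ring
  have h5 : 0 ≤ 2100 + 4 * C ^ 2 := by positivity
  nlinarith [mul_le_mul_of_nonneg_left h4 h5]

end FPL

/-! ## Probabilities on finite spaces and sums of fair coins -/

namespace Coins

open scoped BigOperators

section Prob

variable {α β ι : Type*} [Fintype α] [Fintype β] [Fintype ι]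

open Classical in
/-- The probability of `p` under the uniform distribution. -/
noncomputable def prob (p : α → Prop) : ℝ := 𝔼 x, if p x then (1 : ℝ) else 0

theorem prob_nonneg (p : α → Prop) : 0 ≤ prob p :=
  Finset.expect_nonneg fun _ _ => by split_ifs <;> norm_num

theorem prob_mono {p q : α → Prop} (h : ∀ x, p x → q x) : prob p ≤ prob q := by
  refine Finset.expect_le_expect fun x _ => ?_
  split_ifs with h1 h2
  · exact le_rfl
  · exact absurd (h x h1) h2
  · norm_num
  · exact le_rfl

theorem prob_congr {p q : α → Prop} (h : ∀ x, p x ↔ q x) : prob p = prob q :=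
  le_antisymm (prob_mono fun x => (h x).mp) (prob_mono fun x => (h x).mpr)

theorem prob_add_prob_not [Nonempty α] (p : α → Prop) : prob p + prob (fun x => ¬ p x) = 1 := by
  unfold prob
  rw [← Finset.expect_add_distrib]
  calc _ = 𝔼 _x : α, (1 : ℝ) := by
        refine Finset.expect_congr rfl fun x _ => ?_
        by_cases h : p x <;> simp [h]
    _ = 1 := Fintype.expect_one

theorem prob_or_le (p q : α → Prop) : prob (fun x => p x ∨ q x) ≤ prob p + prob q := by
  unfold prob
  rw [← Finset.expect_add_distrib]
  refine Finset.expect_le_expect fun x _ => ?_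
  by_cases h1 : p x <;> by_cases h2 : q x <;> simp [h1, h2]

theorem le_prob_and [Nonempty α] (p q : α → Prop) :
    prob p + prob q - 1 ≤ prob fun x => p x ∧ q x := by
  have h1 := prob_add_prob_not fun x => p x ∧ q x
  have h2 : prob (fun x => ¬ (p x ∧ q x)) ≤ prob (fun x => ¬ p x) + prob fun x => ¬ q x :=
    (prob_mono fun x h => not_and_or.mp h).trans (prob_or_le _ _)
  have h3 := prob_add_prob_not p
  have h4 := prob_add_prob_not q
  linarith

theorem prob_bijective {e : α → β} (he : Function.Bijective e) (p : β → Prop) :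
    prob (fun x => p (e x)) = prob p :=
  Fintype.expect_bijective e he _ _ fun _ => rfl

theorem expect_prod (f : α × β → ℝ) : 𝔼 x, f x = 𝔼 b, 𝔼 a, f (a, b) := by
  rw [Finset.expect_comm, ← Finset.univ_product_univ, Finset.expect_product]

theorem prob_prod (p : α → Prop) (q : β → Prop) :
    prob (fun x : α × β => p x.1 ∧ q x.2) = prob p * prob q := by
  unfold prob
  rw [expect_prod, Finset.expect_mul_expect, Finset.expect_comm]
  refine Finset.expect_congr rfl fun a _ => Finset.expect_congr rfl fun b _ => ?_
  by_cases h1 : p a <;> by_cases h2 : q b <;> simp [h1, h2]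

theorem prob_prod_le [Nonempty β] {p : α × β → Prop} {c : ℝ}
    (h : ∀ b, prob (fun a => p (a, b)) ≤ c) : prob p ≤ c := by
  have : prob p = 𝔼 b, prob fun a => p (a, b) := expect_prod _
  rw [this]
  exact Finset.expect_le Finset.univ_nonempty fun b _ => h b

theorem prob_pi {γ : Type*} [Fintype γ] [DecidableEq ι] [DecidableEq γ] (p : ι → γ → Prop) :
    prob (fun f : ι → γ => ∀ i, p i (f i)) = ∏ i, prob (p i) := by
  classical
  unfold prob
  simp only [Fintype.expect_eq_sum_div_card]
  rw [Finset.prod_div_distrib, Finset.prod_univ_sum]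
  congr 1
  · simp only [Fintype.piFinset_univ]
    refine Finset.sum_congr rfl fun f _ => ?_
    by_cases h : ∀ i, p i (f i)
    · simp [h]
    · rw [if_neg h]
      obtain ⟨i, hi⟩ := not_forall.mp h
      exact (Finset.prod_eq_zero (Finset.mem_univ i) (if_neg hi)).symm
  · simp

/-- Markov's inequality. -/
theorem prob_ge_mul_le (f : α → ℝ) (hf : ∀ x, 0 ≤ f x) (y : ℝ) :
    y * prob (fun x => y ≤ f x) ≤ 𝔼 x, f x := by
  unfold prob
  rw [Finset.mul_expect]
  refine Finset.expect_le_expect fun x _ => ?_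
  split_ifs with h
  · simpa using h
  · simpa using hf x

end Prob

/-- An adaptive transformation of a sequence: the term with the number `k` is permuted by a
permutation that depends on the earlier terms. -/
def adapt {T : ℕ} {R : Type*} (e : Fin T → (Fin T → R) → Equiv.Perm R) (X : Fin T → R) :
    Fin T → R := fun k => e k X (X k)

/-- The terms can be recovered in order: the earlier ones determine the permutation applied to the
next, which is then inverted. -/
theorem adapt_bijective {T : ℕ} {R : Type*} [Finite R] {e : Fin T → (Fin T → R) → Equiv.Perm R}
    (he : ∀ k X X', (∀ j < k, X j = X' j) → e k X = e k X') : Function.Bijective (adapt e) := by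
  refine (Finite.injective_iff_bijective).mp fun X X' h => ?_
  have key : ∀ k, X k = X' k := by
    intro k
    induction k using WellFoundedLT.induction with
    | ind k ih =>
      have h1 := congrFun h k
      unfold adapt at h1
      rw [he k X X' ih] at h1
      exact (e k X').injective h1
  exact funext key

/-! ### Anti-concentration of the binomial distribution -/

/-- The numerical value of a coin. -/
def bit (b : Bool) : ℝ := if b then 1 else 0

theorem bit_not (b : Bool) : bit (!b) = 1 - bit b := by cases b <;> simp [bit]

/-- For even `N`, induction with the ratio of consecutive central binomial coefficients and `(2 k +
3) (2 k + 1) ≤ 4 (k + 1) ^ 2`. For odd `N` the middle coefficient is half of the next central one.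
-/
theorem mul_sq_choose_half_le (N : ℕ) : N * (N.choose (N / 2)) ^ 2 ≤ 4 ^ N := by
  have key : ∀ k, (2 * k + 1) * k.centralBinom ^ 2 ≤ 16 ^ k := by
    intro k
    induction k with
    | zero => simp
    | succ k ih =>
      have h1 := Nat.succ_mul_centralBinom_succ k
      have h2 : (k + 1) ^ 2 * ((2 * (k + 1) + 1) * (k + 1).centralBinom ^ 2) ≤
          (k + 1) ^ 2 * 16 ^ (k + 1) := by
        calc (k + 1) ^ 2 * ((2 * (k + 1) + 1) * (k + 1).centralBinom ^ 2)
            = (2 * k + 3) * ((k + 1) * (k + 1).centralBinom) ^ 2 := by ring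
          _ = 4 * ((2 * k + 3) * (2 * k + 1)) * ((2 * k + 1) * k.centralBinom ^ 2) := by
              rw [h1]; ring
          _ ≤ 4 * (4 * (k + 1) ^ 2) * 16 ^ k :=
              Nat.mul_le_mul (Nat.mul_le_mul_left 4 (by nlinarith)) ih
          _ = _ := by ring
      exact Nat.le_of_mul_le_mul_left h2 (by positivity)
  rcases Nat.even_or_odd' N with ⟨k, rfl | rfl⟩
  · have h1 := key k
    rw [Nat.mul_div_cancel_left _ (by norm_num), ← Nat.centralBinom_eq_two_mul_choose, pow_mul]
    norm_num
    nlinarith [sq_nonneg k.centralBinom]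
  · have h1 := key (k + 1)
    have h2 : (k + 1).centralBinom = 2 * (2 * k + 1).choose k := by
      rw [Nat.centralBinom_eq_two_mul_choose, show 2 * (k + 1) = (2 * k + 1) + 1 by ring,
        Nat.choose_succ_succ, Nat.choose_symm_half]
      ring
    rw [show (2 * k + 1) / 2 = k by omega]
    rw [h2] at h1
    have h3 : 4 * ((2 * k + 1) * ((2 * k + 1).choose k) ^ 2) ≤ 4 * 4 ^ (2 * k + 1) := by
      calc 4 * ((2 * k + 1) * ((2 * k + 1).choose k) ^ 2)
          ≤ (2 * (k + 1) + 1) * (2 * (2 * k + 1).choose k) ^ 2 := by nlinarith [sq_nonneg ((2 * k + 1).choose k)]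
        _ ≤ 16 ^ (k + 1) := h1
        _ = _ := by
            rw [show (16 : ℕ) = 4 ^ 2 by norm_num, ← pow_mul]; ring
    omega

theorem choose_le_two_pow_div_sqrt {N : ℕ} (hN : 0 < N) (j : ℕ) :
    (N.choose j : ℝ) / 2 ^ N ≤ 1 / √N := by
  have hN' : (0 : ℝ) < N := by exact_mod_cast hN
  have h1 : (N.choose j : ℝ) ≤ N.choose (N / 2) := by exact_mod_cast Nat.choose_le_middle j N
  have h2 : (N : ℝ) * (N.choose (N / 2) : ℝ) ^ 2 ≤ (2 ^ N) ^ 2 := by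
    rw [← pow_mul, mul_comm N 2, pow_mul]
    norm_num
    exact_mod_cast mul_sq_choose_half_le N
  have h3 : √N * N.choose (N / 2) ≤ 2 ^ N := by
    refine le_of_sq_le_sq ?_ (by positivity)
    rw [mul_pow, Real.sq_sqrt hN'.le]
    exact h2
  rw [div_le_div_iff₀ (by positivity) (by positivity), one_mul]
  calc _ ≤ (N.choose (N / 2) : ℝ) * √N := by gcongr
    _ ≤ _ := by linarith

/-- For `N < 4` the bound `1 / √N` is too weak, and a finite check replaces it. -/
theorem choose_le_half_two_pow {N : ℕ} (hN : 0 < N) (j : ℕ) :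
    (N.choose j : ℝ) / 2 ^ N ≤ 1 / 2 := by
  rcases lt_or_ge N 4 with h | h
  · have h1 : N.choose j ≤ N.choose (N / 2) := Nat.choose_le_middle j N
    have h2 : 2 * N.choose (N / 2) ≤ 2 ^ N := by
      interval_cases N <;> decide
    have h3 : (2 * N.choose j : ℝ) ≤ 2 ^ N := by exact_mod_cast (by omega : 2 * N.choose j ≤ 2 ^ N)
    rw [div_le_iff₀ (by positivity)]
    linarith
  · refine (choose_le_two_pow_div_sqrt hN j).trans ?_
    apply one_div_le_one_div_of_le (by norm_num)
    rw [Real.le_sqrt' (by norm_num)]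
    norm_num
    exact_mod_cast h

theorem prob_count_eq_le (N j : ℕ) :
    prob (fun x : Fin N → Bool => ∑ k, (x k).toNat = j) ≤ (N.choose j : ℝ) / 2 ^ N := by
  classical
  unfold prob
  simp only [Fintype.expect_eq_sum_div_card]
  have h1 : (Finset.univ.filter fun x : Fin N → Bool => ∑ k, (x k).toNat = j).card ≤ N.choose j := by
    have h2 : (Finset.powersetCard j (Finset.univ : Finset (Fin N))).card = N.choose j := by simp
    rw [← h2]
    refine Finset.card_le_card_of_injOn (fun x => Finset.univ.filter fun k => x k = true) ?_ ?_
    · intro x hx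
      simp only [Finset.coe_filter, Finset.mem_univ, true_and, Set.mem_ofPred_eq] at hx
      rw [Finset.mem_coe, Finset.mem_powersetCard]
      refine ⟨Finset.subset_univ _, ?_⟩
      rw [← hx, Finset.card_filter]
      exact Finset.sum_congr rfl fun k _ => by cases x k <;> rfl
    · intro x _ y _ hxy
      funext k
      have := congrArg (k ∈ ·) hxy
      simp only [Finset.mem_filter, Finset.mem_univ, true_and, eq_iff_iff] at this
      cases h : x k <;> cases h' : y k <;> simp_all
  have h3 : (Fintype.card (Fin N → Bool) : ℝ) = 2 ^ N := by simp
  rw [h3]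
  gcongr
  refine le_trans (le_of_eq ?_) (Nat.cast_le.mpr h1)
  rw [Finset.card_filter]
  push_cast
  refine Finset.sum_congr rfl fun x _ => ?_
  split_ifs <;> rfl

theorem card_lt_of_forall_sub_lt {s : Finset ℕ} {y : ℝ} (hy : 0 < y)
    (h : ∀ i ∈ s, ∀ j ∈ s, (i : ℝ) - j < 2 * y) : (s.card : ℝ) < 2 * y + 1 := by
  rcases s.eq_empty_or_nonempty with rfl | hs
  · simp; linarith
  · have h1 := h _ (s.max'_mem hs) _ (s.min'_mem hs)
    have h2 : s ⊆ Finset.Icc (s.min' hs) (s.max' hs) := fun i hi =>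
      Finset.mem_Icc.mpr ⟨s.min'_le i hi, s.le_max' i hi⟩
    have h3 := Finset.card_le_card h2
    rw [Nat.card_Icc] at h3
    have h4 := s.min'_le _ (s.max'_mem hs)
    have h5 : ((s.card : ℕ) : ℝ) ≤ s.max' hs + 1 - s.min' hs := by
      have : s.card + s.min' hs ≤ s.max' hs + 1 := by omega
      have : ((s.card + s.min' hs : ℕ) : ℝ) ≤ ((s.max' hs + 1 : ℕ) : ℝ) := by exact_mod_cast this
      push_cast at this
      linarith
    linarith

/-- At most `M` integers lie within `y` of `a`, each hit with probability at most `p`. Both stay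
parameters because small and large `N` need different ones. -/
theorem prob_abs_count_sub_lt_le {N : ℕ} {a y p : ℝ}
    (hp : ∀ j, (N.choose j : ℝ) / 2 ^ N ≤ p) {M : ℕ} (hM : ∀ s : Finset ℕ,
      (∀ i ∈ s, ∀ j ∈ s, (i : ℝ) - j < 2 * y) → s.card ≤ M) :
    prob (fun x : Fin N → Bool => |∑ k, bit (x k) - a| < y) ≤ M * p := by
  classical
  have hp0 : 0 ≤ p := le_trans (by positivity) (hp 0)
  set s := (Finset.range (N + 1)).filter fun j : ℕ => |(j : ℝ) - a| < y with hs
  have hcard : s.card ≤ M := hM s fun i hi j hj => by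
    rw [hs, Finset.mem_filter, abs_lt] at hi hj
    linarith [hi.2.2, hj.2.1]
  have hsum : ∀ x : Fin N → Bool, ((∑ k, (x k).toNat : ℕ) : ℝ) = ∑ k, bit (x k) := by
    intro x
    push_cast
    exact Finset.sum_congr rfl fun k _ => by cases x k <;> simp [bit]
  have hunion : ∀ t : Finset ℕ, prob (fun x : Fin N → Bool => ∑ k, (x k).toNat ∈ t) ≤
      t.card * p := by
    intro t
    induction t using Finset.induction_on with
    | empty => simp [prob]
    | insert j t hj ih =>
      rw [Finset.card_insert_of_notMem hj]
      push_cast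
      refine (prob_mono (q := fun x : Fin N → Bool =>
        ∑ k, (x k).toNat = j ∨ ∑ k, (x k).toNat ∈ t) fun x hx => Finset.mem_insert.mp hx).trans ?_
      refine (prob_or_le _ _).trans ?_
      have := (prob_count_eq_le N j).trans (hp j)
      linarith
  have hsub : ∀ x : Fin N → Bool, |∑ k, bit (x k) - a| < y → ∑ k, (x k).toNat ∈ s := by
    intro x hx
    rw [hs, Finset.mem_filter, Finset.mem_range]
    refine ⟨?_, by rw [hsum]; exact hx⟩
    have : ∑ k, (x k).toNat ≤ ∑ _k : Fin N, 1 := Finset.sum_le_sum fun k _ => Bool.toNat_le _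
    simp at this
    omega
  calc _ ≤ prob (fun x : Fin N → Bool => ∑ k, (x k).toNat ∈ s) := prob_mono hsub
    _ ≤ s.card * p := hunion s
    _ ≤ M * p := by gcongr

/-- Anti-concentration. -/
theorem prob_abs_count_sub_lt_le_div {N : ℕ} (hN : 0 < N) (a : ℝ) {y : ℝ} (hy : 0 < y) :
    prob (fun x : Fin N → Bool => |∑ k, bit (x k) - a| < y) ≤ (2 * y + 1) / √N := by
  have hN' : (0 : ℝ) < N := by exact_mod_cast hN
  refine (prob_abs_count_sub_lt_le (M := ⌊2 * y + 1⌋₊) (choose_le_two_pow_div_sqrt hN)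
    fun s hs => Nat.le_floor (card_lt_of_forall_sub_lt hy hs).le).trans ?_
  rw [mul_one_div]
  gcongr
  exact Nat.floor_le (by linarith)

/-- For `√N ≤ 4` the open window has length at most one and holds at most one integer; for larger
`N` the general bound is `1 / 4 + 1 / √N`. -/
theorem prob_abs_count_sub_lt_le_half {N : ℕ} (hN : 0 < N) (a : ℝ) :
    prob (fun x : Fin N → Bool => |∑ k, bit (x k) - a| < √N / 8) ≤ 1 / 2 := by
  have hN' : (0 : ℝ) < √N := Real.sqrt_pos.mpr (by exact_mod_cast hN)
  rcases le_or_gt (√N) 4 with h | h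
  · refine (prob_abs_count_sub_lt_le (M := 1) (choose_le_half_two_pow hN)
      fun s hs => ?_).trans (by norm_num)
    have h1 := card_lt_of_forall_sub_lt (by positivity) hs
    have h2 : (s.card : ℝ) < 2 := by linarith
    have : s.card < 2 := by exact_mod_cast h2
    omega
  · refine (prob_abs_count_sub_lt_le_div hN a (by positivity)).trans ?_
    rw [div_le_iff₀ hN']
    linarith

end Coins

namespace Coins

open scoped BigOperators

/-! ### Weighted sums of centered coins -/

section Dev

variable {ι : Type*} [Fintype ι]

/-- A weighted sum of centered coins. -/
noncomputable def wsum (w : ι → ℝ) (x : ι → Bool) : ℝ := ∑ i, w i * (1 / 2 - bit (x i))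

theorem wsum_not (w : ι → ℝ) (x : ι → Bool) : wsum w (fun i => !(x i)) = -wsum w x := by
  unfold wsum
  rw [← Finset.sum_neg_distrib]
  refine Finset.sum_congr rfl fun i _ => ?_
  rw [bit_not]
  ring

theorem not_bijective {ι : Type*} : Function.Bijective fun (x : ι → Bool) i => !(x i) :=
  Function.Involutive.bijective fun x => by simp

theorem prob_le_neg_wsum [DecidableEq ι] (w : ι → ℝ) (y : ℝ) :
    prob (fun x => y ≤ -wsum w x) = prob fun x => y ≤ wsum w x := by
  rw [← prob_bijective (not_bijective (ι := ι)) fun x => y ≤ wsum w x]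
  exact prob_congr fun x => by rw [wsum_not]

theorem half_le_prob_wsum_nonneg [DecidableEq ι] (w : ι → ℝ) :
    1 / 2 ≤ prob fun x => 0 ≤ wsum w x := by
  have h1 := prob_le_neg_wsum w 0
  have h2 := prob_add_prob_not fun x => 0 ≤ wsum w x
  have h3 : prob (fun x => ¬ 0 ≤ wsum w x) ≤ prob fun x => 0 ≤ -wsum w x :=
    prob_mono fun x h => by linarith
  linarith

/-- By symmetry each tail has at least half of what the window leaves. -/
theorem le_prob_le_wsum [DecidableEq ι] (w : ι → ℝ) {y p : ℝ}
    (h : prob (fun x => |wsum w x| < y) ≤ p) : (1 - p) / 2 ≤ prob fun x => y ≤ wsum w x := by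
  have h1 := prob_le_neg_wsum w y
  have h2 := prob_add_prob_not fun x => |wsum w x| < y
  have h3 : prob (fun x => ¬ |wsum w x| < y) ≤
      prob (fun x => y ≤ wsum w x) + prob fun x => y ≤ -wsum w x :=
    (prob_mono fun x h => le_abs.mp (not_lt.mp h)).trans (prob_or_le _ _)
  linarith

theorem wsum_split (p : ι → Prop) [DecidablePred p] (w : ι → ℝ) (x : ι → Bool) :
    wsum w x = wsum (fun i : {i // p i} => w i) (fun i => x i) +
      wsum (fun i : {i // ¬ p i} => w i) (fun i => x i) :=
  (Fintype.sum_subtype_add_sum_subtype p _).symm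

theorem prob_split [DecidableEq ι] (p : ι → Prop) [DecidablePred p]
    (q : ({i // p i} → Bool) × ({i // ¬ p i} → Bool) → Prop) :
    prob (fun x : ι → Bool => q (fun i => x i, fun i => x i)) = prob q :=
  prob_bijective (Equiv.piEquivPiSubtypeProd p fun _ => Bool).bijective q

theorem prob_arrow_congr {κ : Type*} [Fintype κ] [DecidableEq ι] [DecidableEq κ] (e : κ ≃ ι)
    (p : (κ → Bool) → Prop) : prob (fun x : ι → Bool => p (x ∘ e)) = prob p :=
  prob_bijective (e.arrowCongr (Equiv.refl Bool)).symm.bijective p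

theorem prob_mul_le_prob_wsum [DecidableEq ι] (p : ι → Prop) [DecidablePred p] (w : ι → ℝ)
    (y z : ℝ) :
    prob (fun x : {i // p i} → Bool => y ≤ wsum (fun i : {i // p i} => w i) x) *
      prob (fun x : {i // ¬ p i} → Bool => z ≤ wsum (fun i : {i // ¬ p i} => w i) x) ≤
    prob fun x => y + z ≤ wsum w x := by
  rw [← prob_prod, ← prob_split p]
  refine prob_mono fun x h => ?_
  rw [wsum_split p]
  exact add_le_add h.1 h.2

/-- Adding an independent sum cannot increase concentration: given its value, the window is merely
shifted. -/
theorem prob_abs_wsum_sub_lt_le [DecidableEq ι] (p : ι → Prop) [DecidablePred p] (w : ι → ℝ)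
    {y c : ℝ} (h : ∀ a, prob (fun x : {i // p i} → Bool => |wsum (fun i : {i // p i} => w i) x - a| < y) ≤ c)
    (a : ℝ) : prob (fun x => |wsum w x - a| < y) ≤ c := by
  refine le_trans (le_of_eq ?_) (prob_prod_le (p := fun z : ({i // p i} → Bool) × ({i // ¬ p i} → Bool) =>
    |wsum (fun i : {i // p i} => w i) z.1 + wsum (fun i : {i // ¬ p i} => w i) z.2 - a| < y)
    fun v => ?_)
  · rw [← prob_split p]
    exact prob_congr fun x => by rw [wsum_split p]
  · refine le_trans (le_of_eq (prob_congr fun u => ?_)) (h (a - wsum (fun i : {i // ¬ p i} => w i) v))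
    rw [show wsum (fun i : {i // p i} => w i) u + wsum (fun i : {i // ¬ p i} => w i) v - a =
      wsum (fun i : {i // p i} => w i) u - (a - wsum (fun i : {i // ¬ p i} => w i) v) by ring]

theorem prob_abs_wsum_const_sub_lt {N : ℕ} (e : Fin N ≃ ι) [DecidableEq ι] {w : ι → ℝ}
    {m : ℝ} (hm : 0 < m) (hw : ∀ i, w i = m) (a y : ℝ) :
    prob (fun x => |wsum w x - a| < m * y) =
      prob fun x : Fin N → Bool => |∑ k, bit (x k) - (N / 2 - a / m)| < y := by
  rw [← prob_arrow_congr e]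
  refine prob_congr fun x => ?_
  have h1 : wsum w x = m * (N / 2 - ∑ k, bit ((x ∘ e) k)) := by
    unfold wsum
    simp only [hw, Function.comp]
    rw [← Finset.mul_sum, Finset.sum_sub_distrib, Equiv.sum_comp e fun i => bit (x i)]
    have : Fintype.card ι = N := by rw [← Fintype.card_congr e]; simp
    simp [this]
    left
    ring
  rw [h1, show m * (N / 2 - ∑ k, bit ((x ∘ e) k)) - a =
    m * -(∑ k, bit ((x ∘ e) k) - (N / 2 - a / m)) by field_simp; ring, abs_mul, abs_neg,
    abs_of_pos hm]
  exact mul_lt_mul_iff_right₀ hm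

/-- Flipping the coin `i` alone changes the sign of the product with another coin. -/
theorem expect_centered_mul [DecidableEq ι] (i j : ι) :
    𝔼 x : ι → Bool, (1 / 2 - bit (x i)) * (1 / 2 - bit (x j)) = if i = j then 1 / 4 else 0 := by
  split_ifs with h
  · subst h
    calc _ = 𝔼 _x : ι → Bool, (1 / 4 : ℝ) :=
          Finset.expect_congr rfl fun x _ => by cases x i <;> norm_num [bit]
      _ = _ := Fintype.expect_const _
  · have hb : Function.Bijective fun x : ι → Bool => Function.update x i (!(x i)) :=
      Function.Involutive.bijective fun x => by simp
    have h1 : 𝔼 x : ι → Bool, (1 / 2 - bit (x i)) * (1 / 2 - bit (x j)) =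
        𝔼 x : ι → Bool, -((1 / 2 - bit (x i)) * (1 / 2 - bit (x j))) :=
      Fintype.expect_bijective _ hb _ _ fun x => by
        rw [Function.update_self, Function.update_of_ne (Ne.symm h), bit_not]
        ring
    rw [Finset.expect_neg_distrib] at h1
    linarith

theorem expect_sq_wsum [DecidableEq ι] (w : ι → ℝ) : 𝔼 x, wsum w x ^ 2 = (∑ i, w i ^ 2) / 4 := by
  have h : ∀ x : ι → Bool, wsum w x ^ 2 =
      ∑ i, ∑ j, w i * w j * ((1 / 2 - bit (x i)) * (1 / 2 - bit (x j))) := by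
    intro x
    unfold wsum
    rw [sq, Finset.sum_mul_sum]
    exact Finset.sum_congr rfl fun i _ => Finset.sum_congr rfl fun j _ => by ring
  simp only [h]
  rw [Finset.expect_sum_comm, Finset.sum_div]
  refine Finset.sum_congr rfl fun i _ => ?_
  rw [Finset.expect_sum_comm, Finset.sum_eq_single i]
  · rw [← Finset.mul_expect, expect_centered_mul, if_pos rfl]
    ring
  · intro j _ hj
    rw [← Finset.mul_expect, expect_centered_mul, if_neg (Ne.symm hj), mul_zero]
  · simp

/-- Chebyshev's inequality. -/
theorem prob_le_wsum_le [DecidableEq ι] (w : ι → ℝ) {y : ℝ} (hy : 0 < y) :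
    prob (fun x => y ≤ wsum w x) ≤ (∑ i, w i ^ 2) / 4 / y ^ 2 := by
  rw [le_div_iff₀ (by positivity), mul_comm, ← expect_sq_wsum]
  refine le_trans ?_ (prob_ge_mul_le (fun x => wsum w x ^ 2) (fun x => sq_nonneg _) (y ^ 2))
  gcongr
  exact prob_mono fun x h => by gcongr

end Dev

section Tail

variable {T : ℕ} {w : Fin T → ℝ} {m : ℝ}

theorem prob_abs_wsum_sub_lt {N : ℕ} (hm : 0 < m) (hNT : N ≤ T)
    (hw : ∀ k : Fin T, k.val < N → w k = m) {y c : ℝ}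
    (h : ∀ a, prob (fun x : Fin N → Bool => |∑ k, bit (x k) - a| < y) ≤ c) (a : ℝ) :
    prob (fun x => |wsum w x - a| < m * y) ≤ c :=
  prob_abs_wsum_sub_lt_le (fun k : Fin T => k.val < N) w (fun a' => by
    rw [prob_abs_wsum_const_sub_lt (Fin.castLEOrderIso hNT).toEquiv hm fun i => hw i.1 i.2]
    exact h _) a

/-- A lower bound for the tail of a sum of coins, of which the first `b * r` have weight `m`. -/
theorem le_prob_wsum {b r : ℕ} (hm : 0 < m) (hr : 0 < r) (hbr : b * r ≤ T)
    (hw : ∀ k : Fin T, k.val < b * r → w k = m) :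
    (1 / 4) ^ b / 2 ≤ prob fun x => b * (m * (√r / 8)) ≤ wsum w x := by
  -- Each of the `b` blocks reaches this height with probability at least `1 / 4`. Asking it of all
  -- blocks makes the heights add up at the price `(1 / 4) ^ b`; the remaining coins need only
  -- contribute a nonnegative sum, at the price `1 / 2`.
  have hq : (1 / 4 : ℝ) ≤ prob fun x : Fin r → Bool => m * (√r / 8) ≤ wsum (fun _ => m) x := by
    have h1 := le_prob_le_wsum (fun _ : Fin r => m) (y := m * (√r / 8)) (p := 1 / 2)
      (by
        have := prob_abs_wsum_const_sub_lt (Equiv.refl (Fin r)) (w := fun _ => m) hm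
          (fun _ => rfl) 0 (√r / 8)
        simp only [sub_zero] at this
        rw [this]
        exact prob_abs_count_sub_lt_le_half hr _)
    linarith
  have h1 := prob_mul_le_prob_wsum (fun k : Fin T => k.val < b * r) w (b * (m * (√r / 8))) 0
  rw [add_zero] at h1
  refine le_trans ?_ h1
  rw [div_eq_mul_one_div]
  refine mul_le_mul ?_ (half_le_prob_wsum_nonneg _) (by norm_num) (prob_nonneg _)
  let e : Fin b × Fin r ≃ {k : Fin T // k.val < b * r} :=
    finProdFinEquiv.trans (Fin.castLEOrderIso hbr).toEquiv
  calc (1 / 4 : ℝ) ^ b = ∏ _i : Fin b, (1 / 4 : ℝ) := by simp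
    _ ≤ ∏ _i : Fin b, prob fun x : Fin r → Bool => m * (√r / 8) ≤ wsum (fun _ => m) x :=
        Finset.prod_le_prod (fun _ _ => by norm_num) fun _ _ => hq
    _ = prob fun x : Fin b → Fin r → Bool => ∀ i, m * (√r / 8) ≤ wsum (fun _ => m) (x i) :=
        (prob_pi fun (_ : Fin b) (x : Fin r → Bool) => m * (√r / 8) ≤ wsum (fun _ => m) x).symm
    _ = prob fun x : Fin b × Fin r → Bool =>
          ∀ i, m * (√r / 8) ≤ wsum (fun _ => m) fun j => x (i, j) :=
        (prob_bijective (Equiv.curry (Fin b) (Fin r) Bool).bijective _).symm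
    _ = prob fun x : {k : Fin T // k.val < b * r} → Bool =>
          ∀ i, m * (√r / 8) ≤ wsum (fun _ => m) fun j => (x ∘ e) (i, j) :=
        (prob_arrow_congr e _).symm
    _ ≤ _ := by
        refine prob_mono fun x h => ?_
        have h2 : wsum (fun k : {k : Fin T // k.val < b * r} => w k) x =
            ∑ i, wsum (fun _ => m) fun j => (x ∘ e) (i, j) := by
          unfold wsum
          rw [← Equiv.sum_comp e, Fintype.sum_prod_type]
          refine Finset.sum_congr rfl fun i _ => Finset.sum_congr rfl fun j _ => ?_
          change w (e (i, j)) * _ = m * _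
          rw [hw _ (e (i, j)).2]
          rfl
        rw [h2]
        calc (b : ℝ) * (m * (√r / 8)) = ∑ _i : Fin b, m * (√r / 8) := by simp
          _ ≤ _ := Finset.sum_le_sum fun i _ => h i

end Tail

end Coins

namespace Coins

open scoped BigOperators

/-! ### Epochs -/

section Epoch

variable {T m : ℕ}

/-- The number of the epoch of a round, as a number less than `T`. -/
def epoch (m : ℕ) (t : Fin T) : Fin T := ⟨t.val / m, (Nat.div_le_self t.val m).trans_lt t.isLt⟩

/-- The number of rounds of an epoch. -/
noncomputable def epochLength (m : ℕ) (k : Fin T) : ℝ :=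
  (Finset.univ.filter fun t : Fin T => epoch m t = k).card

theorem sum_epoch (m : ℕ) (f : Fin T → ℝ) :
    ∑ t, f (epoch m t) = ∑ k, epochLength m k * f k := by
  rw [← Finset.sum_fiberwise Finset.univ (epoch m)]
  refine Finset.sum_congr rfl fun k _ => ?_
  rw [Finset.sum_congr rfl fun t ht => by rw [(Finset.mem_filter.mp ht).2], Finset.sum_const,
    nsmul_eq_mul, epochLength]

theorem card_filter_epoch_le (hm : 0 < m) (k : Fin T) :
    (Finset.univ.filter fun t : Fin T => epoch m t = k).card ≤ m := by
  calc _ ≤ (Finset.Ico (m * k.val) (m * k.val + m)).card := by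
        refine Finset.card_le_card_of_injOn Fin.val (fun t ht => ?_) Fin.val_injective.injOn
        simp only [epoch, Finset.coe_filter, Finset.mem_univ, true_and, Set.mem_ofPred_eq,
          Fin.ext_iff] at ht
        rw [Finset.coe_Ico, Set.mem_Ico, ← ht]
        have := Nat.div_add_mod t.val m
        have := Nat.mod_lt t.val hm
        omega
    _ = m := by simp

theorem epochLength_eq (hm : 0 < m) {k : Fin T} (hk : k.val < T / m) : epochLength m k = m := by
  unfold epochLength
  rw [Nat.cast_inj]
  refine le_antisymm (card_filter_epoch_le hm k) ?_
  have h1 : m * k.val + m ≤ T := by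
    calc m * k.val + m = m * (k.val + 1) := by ring
      _ ≤ m * (T / m) := Nat.mul_le_mul_left m hk
      _ ≤ T := Nat.mul_div_le T m
  calc m = (Finset.univ : Finset (Fin m)).card := by simp
    _ ≤ _ := Finset.card_le_card_of_injOn
        (fun i : Fin m => (⟨m * k.val + i.val, by omega⟩ : Fin T)) (fun i _ => by
          simp only [epoch, Finset.coe_filter, Finset.mem_univ, true_and, Set.mem_ofPred_eq,
            Fin.ext_iff]
          rw [Nat.mul_add_div hm, Nat.div_eq_of_lt i.isLt, add_zero])
        fun i _ j _ h => by
          simp only [Fin.mk.injEq] at h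
          exact Fin.ext (by omega)

theorem sum_sq_epochLength_le (hm : 0 < m) : ∑ k : Fin T, epochLength m k ^ 2 ≤ m * T := by
  have h1 := sum_epoch (T := T) m fun _ => 1
  simp only [mul_one, Finset.sum_const, Finset.card_univ, Fintype.card_fin, nsmul_eq_mul] at h1
  rw [h1, Finset.mul_sum]
  refine Finset.sum_le_sum fun k _ => ?_
  have h2 : epochLength m k ≤ m := by
    unfold epochLength
    exact_mod_cast card_filter_epoch_le hm k
  rw [sq]
  exact mul_le_mul_of_nonneg_right h2 (Nat.cast_nonneg _)

/-- The amount by which the total loss of an action, with one coin for every epoch, falls short of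
`T / 2`. -/
noncomputable def dev (m : ℕ) (x : Fin T → Bool) : ℝ := wsum (epochLength m) x

theorem sum_bit_epoch (x : Fin T → Bool) : ∑ t, bit (x (epoch m t)) = T / 2 - dev m x := by
  have h := sum_epoch m fun k => 1 / 2 - bit (x k)
  rw [Finset.sum_sub_distrib] at h
  simp only [Finset.sum_const, Finset.card_univ, Fintype.card_fin, nsmul_eq_mul] at h
  unfold dev wsum
  linarith

theorem half_le_prob_dev_nonneg (m : ℕ) : 1 / 2 ≤ prob fun x : Fin T → Bool => 0 ≤ dev m x :=
  half_le_prob_wsum_nonneg _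

theorem prob_le_neg_dev (m : ℕ) (y : ℝ) :
    prob (fun x : Fin T → Bool => y ≤ -dev m x) = prob fun x : Fin T → Bool => y ≤ dev m x :=
  prob_le_neg_wsum _ _

theorem prob_le_dev_le (hm : 0 < m) {y : ℝ} (hy : 0 < y) :
    prob (fun x : Fin T → Bool => y ≤ dev m x) ≤ m * T / 4 / y ^ 2 := by
  refine (prob_le_wsum_le _ hy).trans ?_
  gcongr
  exact sum_sq_epochLength_le hm

theorem prob_abs_dev_sub_lt_le_half (hm : 0 < m) (hmT : m ≤ T) (a : ℝ) :
    prob (fun x : Fin T → Bool => |dev m x - a| < m * (√(T / m : ℕ) / 8)) ≤ 1 / 2 :=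
  prob_abs_wsum_sub_lt (by exact_mod_cast hm) (Nat.div_le_self T m)
    (fun _ hk => epochLength_eq hm hk)
    (fun a' => prob_abs_count_sub_lt_le_half (Nat.div_pos hmT hm) a') a

theorem prob_abs_dev_lt_le (hm : 0 < m) (hmT : m ≤ T) {y : ℝ} (hy : 0 < y) :
    prob (fun x : Fin T → Bool => |dev m x| < m * y) ≤ (2 * y + 1) / √(T / m : ℕ) := by
  have := prob_abs_wsum_sub_lt (w := epochLength m) (by exact_mod_cast hm) (Nat.div_le_self T m)
    (fun _ hk => epochLength_eq hm hk)
    (fun a' => prob_abs_count_sub_lt_le_div (Nat.div_pos hmT hm) a' hy) 0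
  simpa only [sub_zero, dev] using this

/-- The blocks have `N / b` coins; rounding gives `√(N b) ≤ (3 / 2) b √(N / b)`, which turns the
constant `1 / 8` into `1 / 12`. The height is `√b` standard deviations up to a constant, so the
exponent `b` has the right order. -/
theorem le_prob_le_dev (hm : 0 < m) {b : ℕ} (hb : 0 < b) (hbm : b ≤ T / m) :
    (1 / 4) ^ b / 2 ≤ prob fun x : Fin T → Bool => m * √((T / m : ℕ) * b) / 12 ≤ dev m x := by
  set N := T / m with hN
  have hr : 0 < N / b := Nat.div_pos hbm hb
  have h1 : b * (N / b) ≤ N := Nat.mul_div_le N b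
  refine (le_prob_wsum (m := m) (w := epochLength m) (by exact_mod_cast hm) hr
    (h1.trans (Nat.div_le_self T m)) fun k hk => epochLength_eq hm (hk.trans_le h1)).trans
    (prob_mono fun x h => le_trans ?_ h)
  have h2 : N < b * (N / b) + b := by
    have := Nat.div_add_mod N b
    have := Nat.mod_lt N hb
    omega
  have h3 : N * b ≤ 2 * (b ^ 2 * (N / b)) := by nlinarith
  have h4 : √(N * b) ≤ 3 / 2 * (b * √(N / b : ℕ)) := by
    rw [Real.sqrt_le_left (by positivity)]
    have : ((N : ℝ) * b) ≤ 2 * (b ^ 2 * (N / b : ℕ)) := by exact_mod_cast h3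
    rw [mul_pow, mul_pow, Real.sq_sqrt (by positivity)]
    nlinarith [show (0 : ℝ) ≤ b ^ 2 * (N / b : ℕ) by positivity]
  calc (m : ℝ) * √(N * b) / 12 ≤ m * (3 / 2 * (b * √(N / b : ℕ))) / 12 := by gcongr
    _ = _ := by ring

end Epoch

/-! ### The cost of ignoring the switches inside the epochs -/

section Freeze

variable {T n m : ℕ}

/-- The first round of the epoch of a round. -/
def epochStart (m : ℕ) (t : Fin T) : Fin T :=
  ⟨m * (t.val / m), (Nat.mul_div_le t.val m).trans_lt t.isLt⟩

theorem exists_switch {a : Fin T → Fin n} {t : Fin T} {d : ℕ} (s : Fin T) (hs : s.val + d = t.val)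
    (h : a t ≠ a s) : ∃ u : Fin T, (∃ v : Fin T, v.val + 1 = u.val ∧ a v ≠ a u) ∧ s < u ∧ u ≤ t := by
  induction d generalizing s with
  | zero => exact absurd (congrArg a (Fin.ext (by omega))) h
  | succ d ih =>
    let s' : Fin T := ⟨s.val + 1, by omega⟩
    by_cases h' : a t = a s'
    · exact ⟨s', ⟨s, rfl, fun e => h (h'.trans e.symm)⟩, by simp [s', Fin.lt_def],
        by simp only [s', Fin.le_def]; omega⟩
    · obtain ⟨u, hu, h1, h2⟩ := ih s' (by simp only [s']; omega) h'
      exact ⟨u, hu, lt_trans (by simp [s', Fin.lt_def]) h1, h2⟩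

/-- Such a round is preceded by, or is, a switch after the first round of its epoch; assign it to
that switch. An epoch has `m - 1` rounds besides its first. -/
theorem card_ne_epochStart_le (hm : 0 < m) (a : Fin T → Fin n) :
    (Finset.univ.filter fun t => a t ≠ a (epochStart m t)).card ≤ (m - 1) * switchesOf a := by
  classical
  unfold switchesOf
  set W := Finset.univ.filter fun t : Fin T => ∃ s : Fin T, s.val + 1 = t.val ∧ a s ≠ a t with hW
  have hsub : (Finset.univ.filter fun t => a t ≠ a (epochStart m t)) ⊆
      W.biUnion fun u => Finset.univ.filter fun t : Fin T => t.val / m = u.val / m ∧ t.val % m ≠ 0 := by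
    intro t ht
    rw [Finset.mem_filter] at ht
    have h1 := Nat.div_add_mod t.val m
    obtain ⟨u, hu, h2, h3⟩ := exists_switch (epochStart m t) (d := t.val % m)
      (by simp only [epochStart]; omega) ht.2
    simp only [epochStart, Fin.lt_def, Fin.le_def] at h2 h3
    rw [Finset.mem_biUnion]
    refine ⟨u, by rw [hW, Finset.mem_filter]; exact ⟨Finset.mem_univ _, hu⟩, ?_⟩
    rw [Finset.mem_filter]
    refine ⟨Finset.mem_univ _, ?_, by omega⟩
    refine le_antisymm ?_ (Nat.div_le_div_right h3)
    rw [Nat.le_div_iff_mul_le hm]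
    rw [mul_comm]
    exact h2.le
  refine (Finset.card_le_card hsub).trans ((Finset.card_biUnion_le_card_mul _ _ (m - 1) fun u _ => ?_).trans
    (mul_comm _ _).le)
  calc _ ≤ (Finset.Ioo (m * (u.val / m)) (m * (u.val / m) + m)).card := by
        refine Finset.card_le_card_of_injOn Fin.val (fun t ht => ?_) Fin.val_injective.injOn
        simp only [Finset.coe_filter, Finset.mem_univ, true_and, Set.mem_ofPred_eq] at ht
        rw [Finset.coe_Ioo, Set.mem_Ioo, ← ht.1]
        have := Nat.div_add_mod t.val m
        have := Nat.mod_lt t.val hm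
        omega
    _ = m - 1 := by simp

theorem sum_epochStart_sub_le (hm : 0 < m) {a : Fin T → Fin n} {S : ℕ} (hS : switchesOf a ≤ S)
    (ℓ : LossSeq T n) :
    ∑ t, (ℓ t (a (epochStart m t)) : ℝ) - (m - 1) * S ≤ ∑ t, (ℓ t (a t) : ℝ) := by
  have h1 : ∀ t, (ℓ t (a (epochStart m t)) : ℝ) - (if a t ≠ a (epochStart m t) then 1 else 0) ≤
      (ℓ t (a t) : ℝ) := by
    intro t
    split_ifs with h
    · have h1 := (ℓ t (a (epochStart m t))).2.2
      have h2 := (ℓ t (a t)).2.1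
      linarith
    · rw [not_not] at h
      rw [h, sub_zero]
  have h2 := Finset.sum_le_sum fun t (_ : t ∈ Finset.univ) => h1 t
  rw [Finset.sum_sub_distrib, Finset.sum_boole] at h2
  have h3 : ((Finset.univ.filter fun t => a t ≠ a (epochStart m t)).card : ℝ) ≤ (m - 1) * S := by
    have h4 := (card_ne_epochStart_le hm a).trans (Nat.mul_le_mul_left (m - 1) hS)
    have h5 : (((m - 1) * S : ℕ) : ℝ) = (m - 1) * S := by
      rw [Nat.cast_mul, Nat.cast_sub hm, Nat.cast_one]
    rw [← h5]
    exact_mod_cast h4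
  linarith

end Freeze

end Coins

namespace Coins

open scoped BigOperators

/-! ### Players against epochs of random losses -/

section Play

variable {T n m : ℕ}

/-- The losses that are constant on the epochs, and given by `g` there. -/
def epochLoss {R : Type*} (m : ℕ) (g : R → Fin n → I) (X : Fin T → R) : LossSeq T n :=
  fun t => g (X (epoch m t))

/-- For every value of its randomness, a player with few switches is not much better than one that
chooses an action at the beginning of every epoch. -/
theorem exists_epoch_choice {R : Type*} (hm : 0 < m) (g : R → Fin n → I) {A : PFEAlgorithm T n}
    {S : ℕ} (hA : A.IsBudget S) (ω : A.Ω) :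
    ∃ c : Fin T → (Fin T → R) → Fin n, (∀ k X X', (∀ j < k, X j = X' j) → c k X = c k X') ∧
      ∀ (X : Fin T → R) (i : Fin n),
        ∑ t, (g (X (epoch m t)) (c (epoch m t) X) : ℝ) - ∑ t, (g (X (epoch m t)) i : ℝ) -
          (m - 1) * S ≤ A.regret (epochLoss m g X, ω) := by
  -- Epochs carry numbers below `T`; the minimum matters only for numbers beyond the last epoch,
  -- where `m * k` is not a round.
  refine ⟨fun k X => A.act ⟨min (m * k.val) (T - 1), by have := k.isLt; omega⟩ (epochLoss m g X) ω,
    fun k X X' h => A.nonanticipating _ _ _ _ fun s hs => ?_, fun X i => ?_⟩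
  · unfold epochLoss
    rw [h]
    simp only [Fin.lt_def] at hs
    simp only [epoch, Fin.lt_def]
    rw [Nat.div_lt_iff_lt_mul hm, mul_comm]
    omega
  · have h1 := sum_epochStart_sub_le hm (hA (epochLoss m g X) ω) (epochLoss m g X)
    have h2 := le_regretOf (fun t => A.act t (epochLoss m g X) ω) (epochLoss m g X) i
    have h3 : ∀ t : Fin T, (⟨min (m * (epoch m t).val) (T - 1), by have := t.isLt; omega⟩ : Fin T) =
        epochStart m t := by
      intro t
      have h4 := Nat.mul_div_le t.val m
      have h5 := t.isLt
      apply Fin.ext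
      simp only [epoch, epochStart]
      omega
    simp only [h3]
    unfold PFEAlgorithm.regret
    unfold epochLoss at h1 h2 ⊢
    linarith

/-- A coin as a loss. -/
def coinLoss (b : Bool) : I := if b then 1 else 0

theorem coe_coinLoss (b : Bool) : (coinLoss b : ℝ) = bit b := by
  cases b <;> simp [coinLoss, bit]

theorem exists_choice_of_coins (hm : 0 < m) {A : PFEAlgorithm T n} {S : ℕ} (hA : A.IsBudget S)
    (ω : A.Ω) :
    ∃ c : Fin T → (Fin T → Fin n → Bool) → Fin n,
      (∀ k X X', (∀ j < k, X j = X' j) → c k X = c k X') ∧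
      ∀ (X : Fin T → Fin n → Bool) (i : Fin n),
        dev m (fun k => X k i) - dev m (fun k => X k (c k X)) - (m - 1) * S ≤
          A.regret (epochLoss m (fun x i => coinLoss (x i)) X, ω) := by
  obtain ⟨c, hc, h⟩ := exists_epoch_choice hm (fun (x : Fin n → Bool) i => coinLoss (x i)) hA ω
  refine ⟨c, hc, fun X i => le_trans (le_of_eq ?_) (h X i)⟩
  simp only [coe_coinLoss]
  rw [sum_bit_epoch (fun k => X k i), sum_bit_epoch (fun k => X k (c k X))]
  ring

end Play

/-! ### Columns of a matrix of coins -/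

section Columns

variable {T n m : ℕ}

theorem prob_forall_column (p : Fin n → (Fin T → Bool) → Prop) :
    prob (fun X : Fin T → Fin n → Bool => ∀ i, p i fun k => X k i) = ∏ i, prob (p i) := by
  rw [← prob_pi]
  exact prob_bijective (Equiv.piComm fun (_ : Fin T) (_ : Fin n) => Bool).bijective
    fun Y : Fin n → Fin T → Bool => ∀ i, p i (Y i)

theorem prob_true {α : Type*} [Fintype α] [Nonempty α] : prob (fun _ : α => True) = 1 := by
  have h := prob_add_prob_not fun _ : α => True
  have h2 : prob (fun _ : α => ¬ True) = 0 := by simp [prob]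
  linarith

theorem prob_column (i : Fin n) (p : (Fin T → Bool) → Prop) :
    prob (fun X : Fin T → Fin n → Bool => p fun k => X k i) = prob p := by
  have h := prob_forall_column fun (j : Fin n) (x : Fin T → Bool) => j = i → p x
  rw [Finset.prod_eq_single i] at h
  · refine (prob_congr fun X => ?_).trans (h.trans (prob_congr fun x => ?_))
    · simp
    · simp
  · intro j _ hj
    simp only [hj, false_imp_iff]
    exact prob_true
  · simp

theorem one_sub_pow_le_prob_exists_column {p : (Fin T → Bool) → Prop} {q : ℝ} (hq : q ≤ prob p) :
    1 - (1 - q) ^ n ≤ prob fun X : Fin T → Fin n → Bool => ∃ i, p fun k => X k i := by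
  have h1 := prob_forall_column fun (_ : Fin n) (x : Fin T → Bool) => ¬ p x
  rw [Finset.prod_const, Finset.card_univ, Fintype.card_fin] at h1
  have h2 := prob_add_prob_not fun X : Fin T → Fin n → Bool => ∃ i, p fun k => X k i
  have h3 := prob_add_prob_not p
  simp only [not_exists] at h2
  have h4 : prob (fun x => ¬ p x) ^ n ≤ (1 - q) ^ n :=
    pow_le_pow_left₀ (prob_nonneg _) (by linarith) n
  linarith

/-- Given `p₀` in the column `i₀`, failure requires that the `n - 1` other columns all violate `p`,
and they are independent of it. -/
theorem le_prob_and_exists_column (i₀ : Fin n) {p₀ p : (Fin T → Bool) → Prop} {q : ℝ}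
    (hq : q ≤ prob p) :
    prob p₀ * (1 - (1 - q) ^ (n - 1)) ≤ prob fun X : Fin T → Fin n → Bool =>
      (p₀ fun k => X k i₀) ∧ ∃ i, p fun k => X k i := by
  classical
  have h1 := prob_forall_column fun (i : Fin n) (x : Fin T → Bool) => if i = i₀ then p₀ x else ¬ p x
  rw [← Finset.mul_prod_erase _ _ (Finset.mem_univ i₀)] at h1
  rw [Finset.prod_congr rfl (g := fun _ => prob fun x => ¬ p x) fun i hi => by
    simp only [Finset.ne_of_mem_erase hi, if_false]] at h1
  simp only [if_true] at h1
  rw [Finset.prod_const, Finset.card_erase_of_mem (Finset.mem_univ _), Finset.card_univ,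
    Fintype.card_fin] at h1
  have h3 := prob_add_prob_not p
  have h4 : prob (fun x => ¬ p x) ^ (n - 1) ≤ (1 - q) ^ (n - 1) :=
    pow_le_pow_left₀ (prob_nonneg _) (by linarith) _
  have h5 := prob_column i₀ p₀
  have h6 : prob (fun X : Fin T → Fin n → Bool => p₀ fun k => X k i₀) ≤
      prob (fun X : Fin T → Fin n → Bool => (p₀ fun k => X k i₀) ∧ ∃ i, p fun k => X k i) +
      prob (fun X : Fin T → Fin n → Bool =>
        ∀ i, if i = i₀ then p₀ fun k => X k i else ¬ p fun k => X k i) := by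
    refine (prob_mono fun X hX => ?_).trans (prob_or_le _ _)
    by_cases h : ∃ i, p fun k => X k i
    · exact Or.inl ⟨hX, h⟩
    · right
      intro i
      split_ifs with hi
      · rw [hi]; exact hX
      · exact fun h' => h ⟨i, h'⟩
  have h7 := mul_le_mul_of_nonneg_left h4 (prob_nonneg p₀)
  rw [mul_sub, mul_one]
  linarith

theorem expect_dev_column (i : Fin n) :
    𝔼 X : Fin T → Fin n → Bool, dev m (fun k => X k i) = 0 := by
  have hb : Function.Bijective fun (X : Fin T → Fin n → Bool) k i => !(X k i) :=
    Function.Involutive.bijective fun X => by simp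
  have h : 𝔼 X : Fin T → Fin n → Bool, dev m (fun k => X k i) =
      𝔼 X : Fin T → Fin n → Bool, -dev m (fun k => X k i) :=
    Fintype.expect_bijective _ hb _ _ fun X => by
      unfold dev
      rw [wsum_not _ fun k => X k i, neg_neg]
  rw [Finset.expect_neg_distrib] at h
  linarith

/-- The transformation that moves the chosen actions to the column `i₀`. -/
def moveChosen (i₀ : Fin n) (c : Fin T → (Fin T → Fin n → Bool) → Fin n) :
    (Fin T → Fin n → Bool) → Fin T → Fin n → Bool :=
  adapt fun k X => (Equiv.swap i₀ (c k X)).arrowCongr (Equiv.refl Bool)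

theorem moveChosen_apply (i₀ : Fin n) (c : Fin T → (Fin T → Fin n → Bool) → Fin n)
    (X : Fin T → Fin n → Bool) (k : Fin T) (i : Fin n) :
    moveChosen i₀ c X k i = X k (Equiv.swap i₀ (c k X) i) := by
  simp [moveChosen, adapt, Equiv.arrowCongr]

theorem moveChosen_bijective (i₀ : Fin n) {c : Fin T → (Fin T → Fin n → Bool) → Fin n}
    (hc : ∀ k X X', (∀ j < k, X j = X' j) → c k X = c k X') :
    Function.Bijective (moveChosen i₀ c) :=
  adapt_bijective fun k X X' h => by rw [hc k X X' h]

variable {c : Fin T → (Fin T → Fin n → Bool) → Fin n}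

/-- The choice in row `k` depends on earlier rows only, so `moveChosen` preserves the uniform law
while it puts the chosen coins into the column `i₀`. -/
theorem prob_chosen (i₀ : Fin n) (hc : ∀ k X X', (∀ j < k, X j = X' j) → c k X = c k X')
    (p : (Fin T → Bool) → Prop) :
    prob (fun X : Fin T → Fin n → Bool => p fun k => X k (c k X)) = prob p := by
  rw [← prob_column i₀ p]
  refine Eq.trans (prob_congr fun X => ?_) (prob_bijective (moveChosen_bijective i₀ hc) _)
  simp only [moveChosen_apply, Equiv.swap_apply_left]

theorem expect_dev_chosen (i₀ : Fin n) (hc : ∀ k X X', (∀ j < k, X j = X' j) → c k X = c k X') :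
    𝔼 X : Fin T → Fin n → Bool, dev m (fun k => X k (c k X)) = 0 := by
  rw [← expect_dev_column (m := m) i₀]
  exact Fintype.expect_bijective _ (moveChosen_bijective i₀ hc) _ _ fun X => by
    simp only [moveChosen_apply, Equiv.swap_apply_left]

/-- The advantage of the average action over the action `i₀`. -/
noncomputable def gap (m : ℕ) (i₀ : Fin n) (X : Fin T → Fin n → Bool) : ℝ :=
  (∑ i, dev m fun k => X k i) / n - dev m fun k => X k i₀

/-- The same swaps; they permute each row, so the average over the actions is unchanged. -/
theorem prob_gap_chosen (i₀ : Fin n) (hc : ∀ k X X', (∀ j < k, X j = X' j) → c k X = c k X')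
    (y : ℝ) :
    prob (fun X : Fin T → Fin n → Bool =>
      y ≤ (∑ i, dev m fun k => X k i) / n - dev m fun k => X k (c k X)) =
    prob fun X : Fin T → Fin n → Bool => y ≤ gap m i₀ X := by
  refine Eq.trans (prob_congr fun X => ?_) (prob_bijective (moveChosen_bijective i₀ hc) _)
  unfold gap
  simp only [moveChosen_apply, Equiv.swap_apply_left]
  have : ∑ i, dev m (fun k => X k (Equiv.swap i₀ (c k X) i)) = ∑ i, dev m fun k => X k i := by
    unfold dev wsum
    refine Finset.sum_comm.trans (Eq.trans (Finset.sum_congr rfl fun k _ => ?_) Finset.sum_comm)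
    exact Equiv.sum_comp (Equiv.swap i₀ (c k X)) fun i => epochLength m k * (1 / 2 - bit (X k i))
  rw [this]

/-- The weights of the coins in `gap`. -/
noncomputable def gapWeight (m : ℕ) (i₀ : Fin n) (z : Fin T × Fin n) : ℝ :=
  epochLength m z.1 * (1 / n - if z.2 = i₀ then 1 else 0)

theorem gap_eq_wsum (i₀ : Fin n) (x : Fin T × Fin n → Bool) :
    gap m i₀ (fun k i => x (k, i)) = wsum (gapWeight m i₀) x := by
  unfold gap dev wsum
  rw [Fintype.sum_prod_type, Finset.sum_comm, Finset.sum_div, ← Finset.sum_sub_distrib]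
  refine Finset.sum_congr rfl fun k _ => ?_
  have h : ∀ i, gapWeight m i₀ (k, i) * (1 / 2 - bit (x (k, i))) =
      epochLength m k * (1 / 2 - bit (x (k, i))) / n -
        if i = i₀ then epochLength m k * (1 / 2 - bit (x (k, i))) else 0 := by
    intro i
    unfold gapWeight
    split_ifs <;> ring
  rw [Finset.sum_congr rfl fun i _ => h i, Finset.sum_sub_distrib, Finset.sum_div,
    Finset.sum_ite_eq', if_pos (Finset.mem_univ _)]

/-- The coins of the column `i₀`. -/
def columnEquiv (T : ℕ) (i₀ : Fin n) : Fin T ≃ {z : Fin T × Fin n // z.2 = i₀} where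
  toFun k := ⟨(k, i₀), rfl⟩
  invFun z := z.1.1
  left_inv _ := rfl
  right_inv z := Subtype.ext (Prod.ext rfl z.2.symm)

theorem wsum_gapWeight_column (i₀ : Fin n) (x : {z : Fin T × Fin n // z.2 = i₀} → Bool) :
    wsum (fun z : {z : Fin T × Fin n // z.2 = i₀} => gapWeight m i₀ z.1) x =
      -(1 - 1 / n) * dev m (x ∘ columnEquiv T i₀) := by
  unfold wsum dev wsum
  rw [← Equiv.sum_comp (columnEquiv T i₀), Finset.mul_sum]
  refine Finset.sum_congr rfl fun k _ => ?_
  simp only [columnEquiv, gapWeight, Equiv.coe_fn_mk, if_true, Function.comp]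
  ring

theorem prob_gap (i₀ : Fin n) (p : ℝ → Prop) :
    prob (fun X : Fin T → Fin n → Bool => p (gap m i₀ X)) =
      prob fun x : Fin T × Fin n → Bool => p (wsum (gapWeight m i₀) x) := by
  rw [← prob_bijective (Equiv.curry (Fin T) (Fin n) Bool).bijective]
  exact prob_congr fun x => by rw [← gap_eq_wsum]; rfl

theorem half_le_one_sub_inv (hn : 2 ≤ n) : (1 : ℝ) / 2 ≤ 1 - 1 / n := by
  have : (2 : ℝ) ≤ n := by exact_mod_cast hn
  have : 1 / (n : ℝ) ≤ 1 / 2 := one_div_le_one_div_of_le (by norm_num) this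
  linarith

/-- The column `i₀` enters `gap` with the factor `-(1 - 1 / n)`, of size at least `1 / 2`, and the
other coins form an independent symmetric sum. -/
theorem le_prob_half_le_gap (hn : 2 ≤ n) (i₀ : Fin n) {x q : ℝ} (hx : 0 ≤ x)
    (hq : q ≤ prob fun u : Fin T → Bool => x ≤ dev m u) :
    q / 2 ≤ prob fun X : Fin T → Fin n → Bool => x / 2 ≤ gap m i₀ X := by
  have hn' := half_le_one_sub_inv hn
  rw [prob_gap]
  have h1 := prob_mul_le_prob_wsum (fun z : Fin T × Fin n => z.2 = i₀) (gapWeight m i₀) (x / 2) 0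
  rw [add_zero] at h1
  refine le_trans ?_ h1
  rw [div_eq_mul_one_div]
  refine mul_le_mul ?_ (half_le_prob_wsum_nonneg _) (by norm_num) (prob_nonneg _)
  refine hq.trans ?_
  rw [← prob_le_neg_dev, ← prob_arrow_congr (columnEquiv T i₀)]
  refine prob_mono fun u hu => ?_
  rw [wsum_gapWeight_column]
  nlinarith

/-- The column `i₀` alone is anti-concentrated, the other coins preserve this, and symmetry halves
the remaining probability `1 / 2`. -/
theorem quarter_le_prob_le_gap (hn : 2 ≤ n) (hm : 0 < m) (hmT : m ≤ T) (i₀ : Fin n) :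
    1 / 4 ≤ prob fun X : Fin T → Fin n → Bool => m * √(T / m : ℕ) / 16 ≤ gap m i₀ X := by
  have hn' := half_le_one_sub_inv hn
  have hn0 : (0 : ℝ) < 1 - 1 / n := by linarith
  have key : ∀ r d a : ℝ, 0 < r → -r * d - a = -(r * (d - -(a / r))) := by
    intro r d a hr
    field_simp
    ring
  rw [prob_gap]
  have h2 := prob_abs_wsum_sub_lt_le (fun z : Fin T × Fin n => z.2 = i₀) (gapWeight m i₀)
    (y := m * √(T / m : ℕ) / 16) (c := 1 / 2) (fun a => by
      refine le_trans ?_ (prob_abs_dev_sub_lt_le_half hm hmT (-(a / (1 - 1 / n))))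
      rw [← prob_arrow_congr (columnEquiv T i₀)]
      refine prob_mono fun u hu => ?_
      rw [wsum_gapWeight_column, key _ _ _ hn0, abs_neg, abs_mul, abs_of_pos hn0] at hu
      nlinarith [abs_nonneg (dev m (u ∘ columnEquiv T i₀) - -(a / (1 - 1 / n)))]) 0
  simp only [sub_zero] at h2
  have := le_prob_le_wsum _ h2
  linarith

end Columns

end Coins

namespace Coins

open scoped BigOperators

/-! ### Adversaries that are uniform on a finite family -/

section Uniform

variable {α : Type*} [Fintype α] [MeasurableSpace α] [MeasurableSingletonClass α] {T n : ℕ}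

instance [Nonempty α] : IsProbabilityMeasure (uniformOn (Set.univ : Set α)) :=
  isProbabilityMeasure_uniformOn Set.finite_univ Set.univ_nonempty

theorem integral_uniformOn_univ (f : α → ℝ) : ∫ x, f x ∂uniformOn Set.univ = 𝔼 x, f x := by
  rw [integral_fintype .of_finite, Fintype.expect_eq_sum_div_card, Finset.sum_div]
  refine Finset.sum_congr rfl fun x _ => ?_
  rw [measureReal_def, uniformOn_univ, Measure.count_singleton]
  simp
  ring

theorem uniformOn_univ_real (p : α → Prop) : (uniformOn Set.univ).real {x | p x} = prob p := by
  classical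
  rw [← integral_indicator_one (Set.toFinite _).measurableSet, integral_uniformOn_univ]
  unfold prob
  exact Finset.expect_congr rfl fun x _ => by simp [Set.indicator_apply]

variable [Nonempty α]

/-- The adversary that draws a loss sequence of the family `L` uniformly. -/
noncomputable def uniformAdversary (L : α → LossSeq T n) : Adversary T n :=
  ⟨(uniformOn Set.univ).map L, Measure.isProbabilityMeasure_map (Measurable.of_discrete).aemeasurable⟩

theorem coe_uniformAdversary (L : α → LossSeq T n) :
    (uniformAdversary L : Measure (LossSeq T n)) = (uniformOn Set.univ).map L := rfl

theorem le_law_uniformAdversary (L : α → LossSeq T n) (A : PFEAlgorithm T n) {y δ : ℝ}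
    (h : ∀ ω, δ ≤ prob fun x => y ≤ A.regret (L x, ω)) :
    δ ≤ (A.law (uniformAdversary L)).real {p | y ≤ A.regret p} := by
  refine A.le_law_real_of_forall_noise _ (measurableSet_le measurable_const A.measurable_regret)
    fun ω => ?_
  have hs : MeasurableSet {ℓ : LossSeq T n | y ≤ A.regret (ℓ, ω)} :=
    measurableSet_le measurable_const (A.measurable_regret.comp measurable_prodMk_right)
  refine ENNReal.ofReal_le_of_le_toReal ((h ω).trans ?_)
  rw [coe_uniformAdversary]
  simp only [Set.mem_ofPred_eq]
  rw [Measure.map_apply .of_discrete hs, ← uniformOn_univ_real]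
  rfl

theorem le_expRegret_uniformAdversary (hn : 0 < n) (L : α → LossSeq T n) (A : PFEAlgorithm T n)
    {y : ℝ} (h : ∀ ω, y ≤ 𝔼 x, A.regret (L x, ω)) : y ≤ A.expRegret (uniformAdversary L) := by
  have hi := A.integrable_regret hn (uniformAdversary L)
  unfold PFEAlgorithm.expRegret
  unfold PFEAlgorithm.law at hi ⊢
  rw [integral_prod_symm _ hi]
  calc y = ∫ _ω, y ∂A.μ := by simp
    _ ≤ _ := integral_mono (integrable_const _) hi.integral_prod_right fun ω => ?_
  dsimp only
  have hm : Measurable fun ℓ : LossSeq T n => A.regret (ℓ, ω) :=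
    A.measurable_regret.comp measurable_prodMk_right
  rw [coe_uniformAdversary, integral_map (Measurable.of_discrete).aemeasurable
    hm.aestronglyMeasurable, integral_uniformOn_univ]
  exact h ω

end Uniform

theorem map_coinLoss_uniformOn : (uniformOn (Set.univ : Set Bool)).map coinLoss = fairCoin := by
  refine Measure.ext fun s hs => ?_
  classical
  have h1 : ((unitInterval.toNNReal ⟨1 / 2, by norm_num, by norm_num⟩ : NNReal) : ENNReal) = 1 / 2 := by
    rw [← ENNReal.toReal_eq_toReal_iff' (by simp) (by simp)]
    simp
  have h2 : ((unitInterval.toNNReal (σ ⟨1 / 2, by norm_num, by norm_num⟩) : NNReal) : ENNReal) =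
      1 / 2 := by
    rw [← ENNReal.toReal_eq_toReal_iff' (by simp) (by simp)]
    norm_num
  rw [Measure.map_apply .of_discrete hs, fairCoin, bernoulliMeasure_apply _ hs, uniformOn_univ,
    Measure.count_apply_finite _ (Set.toFinite _), h1, h2]
  have h3 : (Set.toFinite (coinLoss ⁻¹' s)).toFinset = Finset.univ.filter fun b => coinLoss b ∈ s := by
    ext b
    simp
  rw [h3, Finset.card_filter]
  simp only [Fintype.univ_bool, coinLoss]
  by_cases h4 : (1 : I) ∈ s <;> by_cases h5 : (0 : I) ∈ s <;> simp [h4, h5]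
  exact ENNReal.div_self (by simp) (by simp)

/-- Reduces the adversary to the uniform law on coin matrices, where probabilities are counts. -/
theorem batchedBernoulli_eq (T n m : ℕ) : batchedBernoulli T n m =
    uniformAdversary (epochLoss m fun (x : Fin n → Bool) i => coinLoss (x i)) := by
  apply Subtype.ext
  change Measure.map _ _ = Measure.map _ _
  have h1 : (Measure.pi fun _ : Fin T => Measure.pi fun _ : Fin n => fairCoin) =
      (uniformOn (Set.univ : Set (Fin T → Fin n → Bool))).map fun X t i => coinLoss (X t i) := by
    have h2 : (uniformOn (Set.univ : Set (Fin n → Bool))).map (fun x i => coinLoss (x i)) =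
        Measure.pi fun _ : Fin n => fairCoin := by
      have := uniformOn_pi (f := fun _ : Fin n => (Set.univ : Set Bool))
      rw [Set.pi_univ] at this
      rw [this, Measure.pi_map_pi fun _ => (Measurable.of_discrete).aemeasurable]
      simp only [map_coinLoss_uniformOn]
    have := uniformOn_pi (f := fun _ : Fin T => (Set.univ : Set (Fin n → Bool)))
    rw [Set.pi_univ] at this
    rw [this, ← h2]
    exact (Measure.pi_map_pi fun _ => (Measurable.of_discrete).aemeasurable).symm
  rw [h1, Measure.map_map _ .of_discrete]
  · rfl
  · exact measurable_pi_lambda _ fun _ => measurable_pi_apply _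

end Coins

namespace Coins

open scoped BigOperators

/-! ### The regret against the batched Bernoulli adversary -/

section Regret

variable {T n m S : ℕ}

theorem avg_dev_sub_le {d : Fin n → ℝ} (hn : 0 < n) {e R : ℝ} (h : ∀ i, d i - e ≤ R) :
    (∑ i, d i) / n - e ≤ R := by
  have h1 : ∑ i, d i ≤ ∑ _i : Fin n, (R + e) := Finset.sum_le_sum fun i _ => by linarith [h i]
  have hn' : (0 : ℝ) < n := by exact_mod_cast hn
  rw [Finset.sum_const, Finset.card_univ, Fintype.card_fin, nsmul_eq_mul] at h1
  have : (∑ i, d i) / n ≤ R + e := by rw [div_le_iff₀ hn']; linarith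
  linarith

/-- The best action is at least as good as the average one, and the comparison with the average has
the law of `gap`. -/
theorem le_law_of_le_prob_gap (hn : 0 < n) (hm : 0 < m) {A : PFEAlgorithm T n} (hA : A.IsBudget S)
    {y δ : ℝ} (h : δ ≤ prob fun X : Fin T → Fin n → Bool => y ≤ gap m ⟨0, hn⟩ X) :
    δ ≤ (A.law (batchedBernoulli T n m)).real {p | y - (m - 1) * S ≤ A.regret p} := by
  rw [batchedBernoulli_eq]
  refine le_law_uniformAdversary _ A fun ω => h.trans ?_
  obtain ⟨c, hc, hr⟩ := exists_choice_of_coins hm hA ω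
  rw [← prob_gap_chosen _ hc]
  refine prob_mono fun X hX => ?_
  have := avg_dev_sub_le (R := A.regret (epochLoss m (fun x i => coinLoss (x i)) X, ω) + (m - 1) * S) hn
    fun i => (by linarith [hr X i] :
      dev m (fun k => X k i) - dev m (fun k => X k (c k X)) ≤ _)
  linarith

/-- With probability at least `4⁻ᵇ / 4` the player does badly, and the actions are good on
average. -/
theorem le_law_batchedBernoulli_of_player (hn : 2 ≤ n) (hm : 0 < m) {b : ℕ} (hb : 0 < b)
    (hbm : b ≤ T / m) {A : PFEAlgorithm T n} (hA : A.IsBudget S) :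
    (1 / 4) ^ b / 4 ≤ (A.law (batchedBernoulli T n m)).real
      {p | m * √((T / m : ℕ) * b) / 24 - (m - 1) * S ≤ A.regret p} := by
  refine le_law_of_le_prob_gap (by omega) hm hA ?_
  have := le_prob_half_le_gap hn ⟨0, by omega⟩ (x := m * √((T / m : ℕ) * b) / 12) (by positivity)
    (le_prob_le_dev (T := T) hm hb hbm)
  rw [show (m * √((T / m : ℕ) * b) / 24 : ℝ) = m * √((T / m : ℕ) * b) / 12 / 2 by ring]
  linarith

theorem quarter_le_law_batchedBernoulli (hn : 2 ≤ n) (hm : 0 < m) (hmT : m ≤ T)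
    {A : PFEAlgorithm T n} (hA : A.IsBudget S) :
    1 / 4 ≤ (A.law (batchedBernoulli T n m)).real
      {p | m * √(T / m : ℕ) / 16 - (m - 1) * S ≤ A.regret p} :=
  le_law_of_le_prob_gap (by omega) hm hA (quarter_le_prob_le_gap hn hm hmT _)

/-- The best action does well with high probability, and the player does not. -/
theorem le_law_batchedBernoulli_of_best (hn : 0 < n) (hm : 0 < m) {b : ℕ} (hb : 0 < b)
    (hbm : b ≤ T / m) {A : PFEAlgorithm T n} (hA : A.IsBudget S) :
    1 - (1 - (1 / 4) ^ b / 2) ^ n - 288 / b ≤ (A.law (batchedBernoulli T n m)).real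
      {p | m * √((T / m : ℕ) * b) / 24 - (m - 1) * S ≤ A.regret p} := by
  rw [batchedBernoulli_eq]
  refine le_law_uniformAdversary _ A fun ω => ?_
  obtain ⟨c, hc, hr⟩ := exists_choice_of_coins hm hA ω
  set x : ℝ := m * √((T / m : ℕ) * b) / 24 with hx
  have hN : 0 < T / m := by omega
  have hT : 0 < T := Nat.pos_of_ne_zero fun h => by simp [h] at hN
  have hx0 : 0 < x := by positivity
  have h1 := one_sub_pow_le_prob_exists_column (n := n) (le_prob_le_dev (T := T) hm hb hbm)
  -- Chebyshev at half the height that the best action reaches; the coins met by the player have the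
  -- law of one column.
  have h2 := prob_le_dev_le (T := T) hm hx0
  rw [← prob_chosen ⟨0, hn⟩ hc] at h2
  have h3 := prob_add_prob_not fun X : Fin T → Fin n → Bool => x ≤ dev m fun k => X k (c k X)
  have h4 := le_prob_and (fun X : Fin T → Fin n → Bool =>
      ∃ i, m * √((T / m : ℕ) * b) / 12 ≤ dev m fun k => X k i)
    (fun X : Fin T → Fin n → Bool => ¬ x ≤ dev m fun k => X k (c k X))
  have h5 : (m : ℝ) * T / 4 / x ^ 2 ≤ 288 / b := by
    have h6 : T < m * (T / m) + m := by
      have := Nat.div_add_mod T m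
      have := Nat.mod_lt T hm
      omega
    have h7 : T ≤ 2 * (m * (T / m)) := by nlinarith
    have h8 : (T : ℝ) ≤ 2 * (m * (T / m : ℕ)) := by exact_mod_cast h7
    rw [div_le_div_iff₀ (by positivity) (by positivity), hx, div_pow, mul_pow,
      Real.sq_sqrt (by positivity)]
    have : (0 : ℝ) ≤ m * b := by positivity
    nlinarith
  have h9 : prob (fun X : Fin T → Fin n → Bool =>
        (∃ i, m * √((T / m : ℕ) * b) / 12 ≤ dev m fun k => X k i) ∧
          ¬ x ≤ dev m fun k => X k (c k X)) ≤
      prob fun X : Fin T → Fin n → Bool =>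
        x - (m - 1) * S ≤ A.regret (epochLoss m (fun x i => coinLoss (x i)) X, ω) := by
    refine prob_mono fun X hX => ?_
    obtain ⟨⟨i, hi⟩, h'⟩ := hX
    have := hr X i
    linarith
  linarith

/-- The comparator is the action `0`, except on the event `E`, where it is an action better by at
least `x`. The action `0` and the player both have mean deviation zero, so `x` times the probability
of `E` remains. -/
theorem le_expRegret_batchedBernoulli (hn : 0 < n) (hm : 0 < m) {b : ℕ} (hb : 0 < b)
    (hbm : b ≤ T / m) {A : PFEAlgorithm T n} (hA : A.IsBudget S) :
    m * √((T / m : ℕ) * b) / 12 * (1 / 2 * (1 - (1 - (1 / 4) ^ b / 2) ^ (n - 1))) - (m - 1) * S ≤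
      A.expRegret (batchedBernoulli T n m) := by
  classical
  rw [batchedBernoulli_eq]
  refine le_expRegret_uniformAdversary hn _ A fun ω => ?_
  obtain ⟨c, hc, hr⟩ := exists_choice_of_coins hm hA ω
  set x : ℝ := m * √((T / m : ℕ) * b) / 12 with hx
  have hx0 : 0 ≤ x := by positivity
  set E : (Fin T → Fin n → Bool) → Prop := fun X =>
    (0 ≤ -dev m fun k => X k ⟨0, hn⟩) ∧ ∃ i, x ≤ dev m fun k => X k i with hE
  have h1 : 1 / 2 * (1 - (1 - (1 / 4) ^ b / 2) ^ (n - 1)) ≤ prob E := by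
    refine le_trans ?_ (le_prob_and_exists_column ⟨0, hn⟩ (p₀ := fun u => 0 ≤ -dev m u)
      (le_prob_le_dev hm hb hbm))
    rw [prob_le_neg_dev]
    refine mul_le_mul_of_nonneg_right (half_le_prob_dev_nonneg m) ?_
    have h2 : (1 / 4 : ℝ) ^ b ≤ 1 := pow_le_one₀ (by norm_num) (by norm_num)
    have h3 : (0 : ℝ) < (1 / 4) ^ b := by positivity
    have : (1 - (1 / 4 : ℝ) ^ b / 2) ^ (n - 1) ≤ 1 := pow_le_one₀ (by linarith) (by linarith)
    linarith
  have h2 : ∀ X : Fin T → Fin n → Bool,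
      dev m (fun k => X k ⟨0, hn⟩) + x * (if E X then 1 else 0) -
        dev m (fun k => X k (c k X)) - (m - 1) * S ≤
      A.regret (epochLoss m (fun x i => coinLoss (x i)) X, ω) := by
    intro X
    split_ifs with h
    · obtain ⟨h3, i, hi⟩ := h
      have := hr X i
      linarith
    · have := hr X ⟨0, hn⟩
      linarith
  have h3 := Finset.expect_le_expect (s := Finset.univ) fun X _ => h2 X
  rw [Finset.expect_sub_distrib, Finset.expect_sub_distrib, Finset.expect_add_distrib,
    expect_dev_column, expect_dev_chosen ⟨0, hn⟩ hc, ← Finset.mul_expect,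
    Fintype.expect_const] at h3
  have h4 : prob E = 𝔼 X, if E X then (1 : ℝ) else 0 := by
    unfold prob
    exact Finset.expect_congr rfl fun X _ => by congr
  rw [← h4] at h3
  have := mul_le_mul_of_nonneg_left h1 hx0
  linarith

end Regret

/-! ### The length of the epochs -/

/-- With about `N` epochs the gain is `c₀ m √(N b)` and the price at most `m S`. The choice `N b ≥ B
S ^ 2` makes the price at most half of the gain, which for `m` about `T / N` is of order `T b / √(N
b)`. -/
theorem exists_epoch_length {c₀ : ℝ} (hc₀ : 0 < c₀) : ∃ c : ℝ, 0 < c ∧ ∀ T S b : ℕ, 0 < b → b ≤ T →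
    0 < S → ∃ m : ℕ, 0 < m ∧ m ≤ T ∧ b ≤ T / m ∧
      c * min (T : ℝ) (T * b / S) ≤ c₀ * (m * √((T / m : ℕ) * b)) - (m - 1) * S := by
  set B : ℕ := ⌈4 / c₀ ^ 2⌉₊ with hB
  have hB1 : 4 / c₀ ^ 2 ≤ B := Nat.le_ceil _
  have hB0 : 0 < B := Nat.ceil_pos.mpr (by positivity)
  have hB2 : 2 ≤ c₀ * √B := by
    have : √(4 / c₀ ^ 2) ≤ √B := Real.sqrt_le_sqrt hB1
    rw [Real.sqrt_div (by norm_num), Real.sqrt_sq hc₀.le, show (4 : ℝ) = 2 ^ 2 by norm_num,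
      Real.sqrt_sq (by norm_num), div_le_iff₀ hc₀] at this
    linarith
  have hBR : (1 : ℝ) ≤ B := by exact_mod_cast hB0
  have hs2 : 1 ≤ √(2 * B : ℝ) := by rw [Real.one_le_sqrt]; linarith
  refine ⟨c₀ / (4 * √(2 * B)), by positivity, fun T S b hb hbT hS => ?_⟩
  have hbR : (0 : ℝ) < b := by exact_mod_cast hb
  have hSR : (0 : ℝ) < S := by exact_mod_cast hS
  have hTR : (0 : ℝ) < T := by exact_mod_cast hb.trans_le hbT
  obtain ⟨N, h1, h2, h3⟩ : ∃ N : ℕ, b ≤ N ∧ B * S ^ 2 ≤ N * b ∧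
      (N = b ∨ N * b ≤ 2 * B * S ^ 2) := by
    have h4 := Nat.div_add_mod (B * S ^ 2) b
    have h5 := Nat.mod_lt (B * S ^ 2) hb
    -- At least `b` epochs are needed for `b` blocks. If this is what fixes `N`, then `√(N b) = b`
    -- and the gain is of order `T`.
    refine ⟨max b (B * S ^ 2 / b + 1), le_max_left _ _, ?_, ?_⟩
    · refine le_trans ?_ (Nat.mul_le_mul_right b (le_max_right _ _))
      rw [add_mul, mul_comm (B * S ^ 2 / b) b]
      omega
    · rcases le_or_gt (B * S ^ 2 / b + 1) b with h | h
      · exact Or.inl (max_eq_left h)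
      · right
        rw [max_eq_right h.le]
        calc (B * S ^ 2 / b + 1) * b ≤ (2 * (B * S ^ 2 / b)) * b :=
              Nat.mul_le_mul_right b (by omega)
          _ = 2 * (b * (B * S ^ 2 / b)) := by ring
          _ ≤ 2 * (B * S ^ 2) := Nat.mul_le_mul_left 2 (Nat.mul_div_le _ _)
          _ = _ := by ring
  have hNR : (0 : ℝ) < N := by exact_mod_cast hb.trans_le h1
  set D := √((N : ℝ) * b) with hD
  have hD0 : 0 < D := Real.sqrt_pos.mpr (by positivity)
  have hDD : D * D = N * b := Real.mul_self_sqrt (by positivity)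
  have h4 : 1 / √(2 * B) * min (T : ℝ) (T * b / S) ≤ T * b / D := by
    rcases h3 with h3 | h3
    · have : D = b := by rw [hD, h3, Real.sqrt_mul_self hbR.le]
      rw [this, mul_div_cancel_right₀ _ hbR.ne']
      calc _ ≤ 1 * (T : ℝ) := by
            gcongr
            · rw [div_le_one (by positivity)]; exact hs2
            · exact min_le_left _ _
        _ = T := one_mul _
    · have h5 : D ≤ √(2 * B) * S := by
        rw [hD, Real.sqrt_le_left (by positivity), mul_pow, Real.sq_sqrt (by positivity)]
        exact_mod_cast h3
      calc _ ≤ 1 / √(2 * B) * (T * b / S) := by gcongr; exact min_le_right _ _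
        _ = T * b / (√(2 * B) * S) := by field_simp
        _ ≤ _ := by gcongr
  have h5 : c₀ / (4 * √(2 * B)) * min (T : ℝ) (T * b / S) ≤ c₀ / 4 * (T * b / D) := by
    calc _ = c₀ / 4 * (1 / √(2 * B) * min (T : ℝ) (T * b / S)) := by field_simp
      _ ≤ _ := by gcongr
  have h6 : 2 * S ≤ c₀ * D := by
    have : √B * S ≤ D := by
      rw [hD]
      refine Real.le_sqrt_of_sq_le ?_
      rw [mul_pow, Real.sq_sqrt (by positivity)]
      exact_mod_cast h2
    nlinarith
  rcases le_or_gt T N with hTN | hTN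
  -- The horizon is too short for more than `N` epochs; epochs of length one carry no price at all.
  · refine ⟨1, one_pos, by omega, by simpa using hbT, h5.trans ?_⟩
    have hTN' : (T : ℝ) ≤ N := by exact_mod_cast hTN
    have h7 : T * b / D ≤ √(T * b) := by
      rw [div_le_iff₀ hD0]
      calc (T : ℝ) * b = √(T * b) * √(T * b) := (Real.mul_self_sqrt (by positivity)).symm
        _ ≤ √(T * b) * D := by rw [hD]; gcongr
    have h8 : 0 ≤ T * b / D := by positivity
    simp only [Nat.cast_one, Nat.div_one, one_mul, sub_self, zero_mul, sub_zero]
    nlinarith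
  · have hm : 0 < T / N := Nat.div_pos hTN.le (hb.trans_le h1)
    set m := T / N with hmdef
    have h7 : N ≤ T / m := by
      rw [Nat.le_div_iff_mul_le hm, mul_comm]
      exact Nat.div_mul_le_self T N
    refine ⟨m, hm, Nat.div_le_self _ _, h1.trans h7, h5.trans ?_⟩
    have hmR : (0 : ℝ) < m := by exact_mod_cast hm
    have h8 : D ≤ √((T / m : ℕ) * b) := by
      rw [hD]
      gcongr
    have h9 : (T : ℝ) ≤ 2 * m * N := by
      have : T < N * m + N := by
        have := Nat.div_add_mod T N
        have := Nat.mod_lt T (hb.trans_le h1)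
        rw [← hmdef] at *
        omega
      have : T ≤ 2 * m * N := by nlinarith
      exact_mod_cast this
    have h10 : T * b / D ≤ 2 * m * D := by
      rw [div_le_iff₀ hD0, mul_assoc, hDD]
      nlinarith
    have h11 : c₀ * (m * D) ≤ c₀ * (m * √((T / m : ℕ) * b)) := by gcongr
    have h12 : (m : ℝ) * (2 * S) ≤ m * (c₀ * D) := by gcongr
    have h13 : c₀ / 4 * (T * b / D) ≤ c₀ / 4 * (2 * m * D) := by gcongr
    linarith

end Coins

namespace Coins

open scoped BigOperators

/-! ### Two further adversaries -/

section Adversaries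

variable {T n m S : ℕ}

/-- The losses of two classes of actions: the action `i₀`, whose loss is a coin, and all others, whose
loss is the opposite of that coin. -/
def twoClassLoss (i₀ : Fin n) (x : Bool) (i : Fin n) : I := coinLoss (if i = i₀ then x else !x)

/-- Either choice meets a fair coin, negated or not, so the player does no better than `T / 2` with
probability at least `1 / 2`. The better class beats `T / 2` by `|dev|`, which is rarely below `m *
y`. Only this rare event is lost from `1 / 2`. -/
theorem le_law_twoClass (hn : 2 ≤ n) (hm : 0 < m) (hmT : m ≤ T) {y : ℝ} (hy : 0 < y)
    {A : PFEAlgorithm T n} (hA : A.IsBudget S) :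
    1 / 2 - (2 * y + 1) / √(T / m : ℕ) ≤
      (A.law (uniformAdversary (epochLoss m (twoClassLoss (⟨0, by omega⟩ : Fin n))))).real
        {p | m * y - (m - 1) * S ≤ A.regret p} := by
  set i₀ : Fin n := ⟨0, by omega⟩ with hi₀
  refine le_law_uniformAdversary _ A fun ω => ?_
  obtain ⟨c, hc, hr⟩ := exists_epoch_choice hm (twoClassLoss i₀) hA ω
  set e : Fin T → (Fin T → Bool) → Equiv.Perm Bool := fun k X =>
    if c k X = i₀ then Equiv.refl Bool else Equiv.boolNot with he
  have hb : Function.Bijective (adapt e) := adapt_bijective fun k X X' h => by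
    simp only [he, hc k X X' h]
  have hY : ∀ X : Fin T → Bool, ∑ t, (twoClassLoss i₀ (X (epoch m t)) (c (epoch m t) X) : ℝ) =
      T / 2 - dev m (adapt e X) := by
    intro X
    rw [← sum_bit_epoch]
    refine Finset.sum_congr rfl fun t _ => ?_
    unfold twoClassLoss adapt
    rw [coe_coinLoss]
    simp only [he]
    split_ifs <;> simp
  have h0 : ∀ X : Fin T → Bool, ∑ t, (twoClassLoss i₀ (X (epoch m t)) i₀ : ℝ) = T / 2 - dev m X := by
    intro X
    rw [← sum_bit_epoch]
    exact Finset.sum_congr rfl fun t _ => by rw [twoClassLoss, if_pos rfl, coe_coinLoss]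
  have h1 : ∀ X : Fin T → Bool,
      ∑ t, (twoClassLoss i₀ (X (epoch m t)) (⟨1, by omega⟩ : Fin n) : ℝ) = T / 2 + dev m X := by
    intro X
    have h2 := sum_bit_epoch (m := m) fun k => !(X k)
    have h3 : dev m (fun k => !(X k)) = -dev m X := wsum_not _ _
    rw [h3, sub_neg_eq_add] at h2
    rw [← h2]
    refine Finset.sum_congr rfl fun t _ => ?_
    rw [twoClassLoss, if_neg (by simp [hi₀]), coe_coinLoss]
  have h4 := prob_abs_dev_lt_le hm hmT hy
  have h5 := prob_add_prob_not fun X : Fin T → Bool => |dev m X| < m * y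
  have h6 := half_le_prob_dev_nonneg (T := T) m
  rw [← prob_le_neg_dev, ← prob_bijective hb] at h6
  have h7 := le_prob_and (fun X : Fin T → Bool => 0 ≤ -dev m (adapt e X))
    (fun X : Fin T → Bool => ¬ |dev m X| < m * y)
  have h8 : prob (fun X : Fin T → Bool => 0 ≤ -dev m (adapt e X) ∧ ¬ |dev m X| < m * y) ≤
      prob fun X => m * y - (m - 1) * S ≤ A.regret (epochLoss m (twoClassLoss i₀) X, ω) := by
    refine prob_mono fun X hX => ?_
    have h9 := hr X i₀
    have h10 := hr X ⟨1, by omega⟩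
    rw [hY, h0] at h9
    rw [hY, h1] at h10
    rcases le_abs.mp (not_lt.mp hX.2) with h | h <;> linarith [hX.1]
  linarith

/-- One action has no loss, and the others always have loss one. -/
def hiddenLoss (T : ℕ) (i : Fin n) : LossSeq T n := fun _ j => if j = i then 0 else 1

/-- The first action is chosen without information, so it misses the uniformly hidden action with
probability at least `1 / 2`. -/
theorem half_le_law_hidden (hn : 2 ≤ n) [Nonempty (Fin n)] (hT : 0 < T) (A : PFEAlgorithm T n) :
    1 / 2 ≤ (A.law (uniformAdversary (hiddenLoss (n := n) T))).real {p | 1 ≤ A.regret p} := by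
  refine le_law_uniformAdversary _ A fun ω => ?_
  have hn' : (2 : ℝ) ≤ n := by exact_mod_cast hn
  set a := A.act ⟨0, hT⟩ (fun _ _ => 0) ω with ha
  have h1 : ∀ i : Fin n, A.act ⟨0, hT⟩ (hiddenLoss T i) ω = a := fun i =>
    A.nonanticipating _ _ _ _ fun s hs => absurd hs (by simp [Fin.lt_def])
  have h2 : prob (fun i : Fin n => i = a) ≤ 1 / 2 := by
    unfold prob
    rw [Fintype.expect_eq_sum_div_card, Finset.sum_eq_single a, if_pos rfl, Fintype.card_fin]
    · exact one_div_le_one_div_of_le (by norm_num) hn'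
    · exact fun _ _ h => if_neg h
    · exact fun h => absurd (Finset.mem_univ a) h
  have h3 := prob_add_prob_not fun i : Fin n => i = a
  have h4 : prob (fun i : Fin n => ¬ i = a) ≤ prob fun i => 1 ≤ A.regret (hiddenLoss T i, ω) := by
    refine prob_mono fun i hi => ?_
    refine le_trans ?_ (le_regretOf _ _ i)
    have h5 : ∑ t, (hiddenLoss T i t i : ℝ) = 0 := by simp [hiddenLoss]
    rw [h5, sub_zero]
    refine le_trans ?_ (Finset.single_le_sum (f := fun t =>
      (hiddenLoss T i t (A.act t (hiddenLoss T i) ω) : ℝ)) (fun t _ => unitInterval.nonneg _)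
      (Finset.mem_univ (⟨0, hT⟩ : Fin T)))
    simp only [h1]
    simp [hiddenLoss, Ne.symm hi]
  linarith

end Adversaries

/-! ### Lower bounds for all budgets -/

section Bounds

theorem le_law_mono {T n : ℕ} {A : PFEAlgorithm T n} {D : Adversary T n} {δ δ' y y' : ℝ}
    (h : δ ≤ (A.law D).real {p | y ≤ A.regret p}) (hδ : δ' ≤ δ) (hy : y' ≤ y) :
    δ' ≤ (A.law D).real {p | y' ≤ A.regret p} :=
  hδ.trans (h.trans (measureReal_mono fun _ hp => hy.trans hp))

theorem exists_batched_of_player : ∃ c : ℝ, 0 < c ∧ ∀ T n S b : ℕ, 2 ≤ n → 0 < b → b ≤ T → 0 < S →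
    ∃ m : ℕ, 1 ≤ m ∧ m ≤ T ∧ ∀ A : PFEAlgorithm T n, A.IsBudget S →
      (1 / 4) ^ b / 4 ≤ (A.law (batchedBernoulli T n m)).real
        {p | c * min (T : ℝ) (T * b / S) ≤ A.regret p} := by
  obtain ⟨c, hc, h⟩ := exists_epoch_length (c₀ := 1 / 24) (by norm_num)
  refine ⟨c, hc, fun T n S b hn hb hbT hS => ?_⟩
  obtain ⟨m, hm, hmT, hbm, hle⟩ := h T S b hb hbT hS
  exact ⟨m, hm, hmT, fun A hA => le_law_mono (le_law_batchedBernoulli_of_player hn hm hb hbm hA)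
    le_rfl (by linarith)⟩

theorem exists_batched_quarter : ∃ c : ℝ, 0 < c ∧ ∀ T n S : ℕ, 2 ≤ n → 0 < S → S ≤ T →
    ∃ m : ℕ, 1 ≤ m ∧ m ≤ T ∧ ∀ A : PFEAlgorithm T n, A.IsBudget S →
      1 / 4 ≤ (A.law (batchedBernoulli T n m)).real
        {p | c * min (T : ℝ) (T / S) ≤ A.regret p} := by
  obtain ⟨c, hc, h⟩ := exists_epoch_length (c₀ := 1 / 16) (by norm_num)
  refine ⟨c, hc, fun T n S hn hS hST => ?_⟩
  obtain ⟨m, hm, hmT, hbm, hle⟩ := h T S 1 one_pos (by omega) hS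
  rw [Nat.cast_one, mul_one, mul_one] at hle
  exact ⟨m, hm, hmT, fun A hA => le_law_mono (quarter_le_law_batchedBernoulli hn hm hmT hA)
    le_rfl (by linarith)⟩

theorem one_sub_pow_le_exp {q : ℝ} (hq : q ≤ 1) (n : ℕ) : (1 - q) ^ n ≤ Real.exp (-(q * n)) := by
  calc (1 - q) ^ n ≤ Real.exp (-q) ^ n :=
        pow_le_pow_left₀ (by linarith) (by linarith [Real.add_one_le_exp (-q)]) n
    _ = _ := by rw [← Real.exp_nat_mul]; ring_nf

theorem quarter_pow_le_one (b : ℕ) : (1 / 4 : ℝ) ^ b / 2 ≤ 1 := by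
  have : (1 / 4 : ℝ) ^ b ≤ 1 := pow_le_one₀ (by norm_num) (by norm_num)
  linarith

/-- From `b ≥ 1152` the Chebyshev term `288 / b` is at most `1 / 4`. From `√n ≥ 16` and the
condition on `b`, all columns fail with probability at most `exp (-2) ≤ 1 / 4`. -/
theorem exists_batched_best : ∃ c : ℝ, 0 < c ∧ ∀ T n S b : ℕ, 256 ≤ n → 1152 ≤ b → b ≤ T → 0 < S →
    1 / √n ≤ 4 * (1 / 4) ^ b →
    ∃ m : ℕ, 1 ≤ m ∧ m ≤ T ∧ ∀ A : PFEAlgorithm T n, A.IsBudget S →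
      1 / 2 ≤ (A.law (batchedBernoulli T n m)).real
        {p | c * min (T : ℝ) (T * b / S) ≤ A.regret p} := by
  obtain ⟨c, hc, h⟩ := exists_epoch_length (c₀ := 1 / 24) (by norm_num)
  refine ⟨c, hc, fun T n S b hn hb hbT hS hq => ?_⟩
  obtain ⟨m, hm, hmT, hbm, hle⟩ := h T S b (by omega) hbT hS
  refine ⟨m, hm, hmT, fun A hA => le_law_mono
    (le_law_batchedBernoulli_of_best (by omega) hm (by omega) hbm hA) ?_ (by linarith)⟩
  have hn' : (256 : ℝ) ≤ n := by exact_mod_cast hn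
  have hb' : (1152 : ℝ) ≤ b := by exact_mod_cast hb
  have h1 : (16 : ℝ) ≤ √n := Real.le_sqrt_of_sq_le (by linarith)
  have h2 : 288 / (b : ℝ) ≤ 1 / 4 := by
    rw [div_le_div_iff₀ (by linarith) (by norm_num)]
    linarith
  have h3 : 2 ≤ (1 / 4) ^ b / 2 * (n : ℝ) := by
    have h4 : √n * √n = n := Real.mul_self_sqrt (by linarith)
    rw [div_le_iff₀ (by linarith)] at hq
    have : (0 : ℝ) ≤ (1 / 4) ^ b := by positivity
    nlinarith
  have h4 : (1 - (1 / 4 : ℝ) ^ b / 2) ^ n ≤ 1 / 4 := by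
    refine (one_sub_pow_le_exp (quarter_pow_le_one b) n).trans ?_
    calc Real.exp (-((1 / 4) ^ b / 2 * n)) ≤ Real.exp (-2) := Real.exp_le_exp.mpr (by linarith)
      _ = (Real.exp 1 ^ 2)⁻¹ := by rw [Real.exp_neg, ← Real.exp_nat_mul]; norm_num
      _ ≤ ((2 : ℝ) ^ 2)⁻¹ := by
          have := Real.add_one_le_exp (1 : ℝ)
          gcongr
          linarith
      _ = _ := by norm_num
  linarith

theorem exists_batched_expRegret : ∃ c : ℝ, 0 < c ∧ ∀ T n S b : ℕ, 2 ≤ n → 0 < b → b ≤ T → 0 < S →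
    1 / n ≤ 4 * (1 / 4 : ℝ) ^ b →
    ∃ m : ℕ, 1 ≤ m ∧ m ≤ T ∧ ∀ A : PFEAlgorithm T n, A.IsBudget S →
      c * min (T : ℝ) (T * b / S) ≤ A.expRegret (batchedBernoulli T n m) := by
  have hγ : 0 < 1 - Real.exp (-(1 / 16)) := by
    have := Real.exp_lt_exp.mpr (show -(1 / 16 : ℝ) < 0 by norm_num)
    rw [Real.exp_zero] at this
    linarith
  obtain ⟨c, hc, h⟩ := exists_epoch_length (c₀ := 1 / 12 * (1 / 2 * (1 - Real.exp (-(1 / 16)))))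
    (by positivity)
  refine ⟨c, hc, fun T n S b hn hb hbT hS hq => ?_⟩
  obtain ⟨m, hm, hmT, hbm, hle⟩ := h T S b hb hbT hS
  refine ⟨m, hm, hmT, fun A hA => hle.trans (le_trans ?_
    (le_expRegret_batchedBernoulli (by omega) hm hb hbm hA))⟩
  have hn' : (2 : ℝ) ≤ n := by exact_mod_cast hn
  -- A column succeeds with probability at least `1 / (8 n)`, and `n - 1 ≥ n / 2`.
  have h1 : (1 - (1 / 4 : ℝ) ^ b / 2) ^ (n - 1) ≤ Real.exp (-(1 / 16)) := by
    refine (one_sub_pow_le_exp (quarter_pow_le_one b) _).trans (Real.exp_le_exp.mpr ?_)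
    rw [Nat.cast_sub (by omega), Nat.cast_one]
    rw [div_le_iff₀ (by linarith)] at hq
    have : (0 : ℝ) ≤ (1 / 4) ^ b := by positivity
    nlinarith
  have h2 : (m : ℝ) * √((T / m : ℕ) * b) / 12 * (1 / 2 * (1 - Real.exp (-(1 / 16)))) ≤
      m * √((T / m : ℕ) * b) / 12 * (1 / 2 * (1 - (1 - (1 / 4) ^ b / 2) ^ (n - 1))) := by
    gcongr
  linarith

/-- At least `N` epochs make `1 / √(T / m)` at most `η / 2`, and `y = (η / 4) √(T / m)` accounts for
the other half of the loss `η`. -/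
theorem exists_twoClass {η : ℝ} (hη : 0 < η) : ∃ (c : ℝ) (N : ℕ), 0 < c ∧ ∀ T n S : ℕ, 2 ≤ n →
    N ≤ T → 0 < S → ∃ D : Adversary T n, ∀ A : PFEAlgorithm T n, A.IsBudget S →
      1 / 2 - η ≤ (A.law D).real {p | c * min (T : ℝ) (T / S) ≤ A.regret p} := by
  set N : ℕ := ⌈4 / η ^ 2⌉₊ with hN
  have hN0 : 0 < N := Nat.ceil_pos.mpr (by positivity)
  have hN1 : (1 : ℝ) ≤ N := by exact_mod_cast hN0
  have hNη : 2 / η ≤ √N := by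
    refine Real.le_sqrt_of_sq_le ?_
    rw [div_pow]
    norm_num
    exact Nat.le_ceil _
  obtain ⟨c, hc, h⟩ := exists_epoch_length (c₀ := η / 4 / √N) (by positivity)
  refine ⟨c, N, hc, fun T n S hn hT hS => ?_⟩
  obtain ⟨m, hm, hmT, hbm, hle⟩ := h T S N hN0 hT hS
  have hNm : (N : ℝ) ≤ (T / m : ℕ) := by exact_mod_cast hbm
  have h0 : √(N : ℝ) ≤ √(T / m : ℕ) := Real.sqrt_le_sqrt hNm
  have h1 : 0 < √(N : ℝ) := by positivity
  have h2 : 0 < √((T / m : ℕ) : ℝ) := h1.trans_le h0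
  refine ⟨_, fun A hA => le_law_mono
    (le_law_twoClass hn hm hmT (y := η / 4 * √(T / m : ℕ)) (by positivity) hA) ?_ ?_⟩
  · have h3 : (2 * (η / 4 * √(T / m : ℕ)) + 1) / √(T / m : ℕ) ≤ η := by
      rw [div_le_iff₀ h2]
      rw [div_le_iff₀ hη] at hNη
      nlinarith
    linarith
  · have h3 : η / 4 / √N * (m * √((T / m : ℕ) * N)) = m * (η / 4 * √(T / m : ℕ)) := by
      rw [Real.sqrt_mul (Nat.cast_nonneg _)]
      field_simp
    rw [h3] at hle
    refine le_trans ?_ hle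
    gcongr
    exact le_mul_of_one_le_right (Nat.cast_nonneg _) hN1

end Bounds

end Coins

namespace Coins

/-! ### The lower bounds -/

/-- Cutting the number of blocks at `T` is harmless: `T * T / S ≥ T`. -/
theorem min_mul_div_le {T S b' : ℕ} (hS : 0 < S) (hST : S ≤ T) {M Λ : ℝ} (hM : 1 ≤ M)
    (hΛ : Λ ≤ M * b') :
    min (T : ℝ) (T * Λ / S) ≤ M * min (T : ℝ) (T * (min T b' : ℕ) / S) := by
  have hSR : (0 : ℝ) < S := by exact_mod_cast hS
  have hSTR : (S : ℝ) ≤ T := by exact_mod_cast hST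
  have hT : (0 : ℝ) < T := hSR.trans_le hSTR
  have h0 : (T : ℝ) ≤ M * T := le_mul_of_one_le_left hT.le hM
  rw [mul_min_of_nonneg _ _ (by linarith : (0 : ℝ) ≤ M)]
  refine le_min ((min_le_left _ _).trans h0) ?_
  rcases le_total T b' with h | h
  · rw [min_eq_left h]
    refine (min_le_left _ _).trans (h0.trans ?_)
    gcongr
    rw [le_div_iff₀ hSR]
    gcongr
  · rw [min_eq_right h]
    refine (min_le_right _ _).trans ?_
    calc T * Λ / S ≤ T * (M * b') / S := by gcongr
      _ = M * (T * b' / S) := by ring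

theorem min_mul_div_le_of_bounded {T S : ℕ} (hS : 0 < S) (hST : S ≤ T) {M Λ : ℝ} (hM : 1 ≤ M)
    (h : Λ ≤ M ∨ (T : ℝ) ≤ M) :
    min (T : ℝ) (T * Λ / S) ≤ M * min (T : ℝ) (T / S) := by
  have hSR : (0 : ℝ) < S := by exact_mod_cast hS
  have hSTR : (S : ℝ) ≤ T := by exact_mod_cast hST
  have hT : (0 : ℝ) < T := hSR.trans_le hSTR
  have h0 : (T : ℝ) ≤ M * T := le_mul_of_one_le_left hT.le hM
  rw [mul_min_of_nonneg _ _ (by linarith : (0 : ℝ) ≤ M)]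
  refine le_min ((min_le_left _ _).trans h0) ?_
  rcases h with h | h
  · refine (min_le_right _ _).trans ?_
    calc T * Λ / S ≤ T * M / S := by gcongr
      _ = M * (T / S) := by ring
  · refine (min_le_left _ _).trans (h.trans (le_mul_of_one_le_right (by linarith) ?_))
    rw [le_div_iff₀ hSR]
    linarith

theorem log_four_le : Real.log 4 ≤ 2 := by
  have := Real.log_le_sub_one_of_pos (show (0 : ℝ) < 2 by norm_num)
  rw [show (4 : ℝ) = 2 ^ 2 by norm_num, Real.log_pow]
  push_cast
  linarith

theorem half_le_log {n : ℕ} (hn : 2 ≤ n) : 1 / 2 ≤ Real.log n := by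
  have h1 : Real.log 2 ≤ Real.log n := Real.log_le_log (by norm_num) (by exact_mod_cast hn)
  have := Real.log_two_gt_d9
  linarith

theorem log_le_log_mul_natLog {n : ℕ} (hn : 0 < n) (a : ℕ) (ha : 1 < a) :
    Real.log n ≤ Real.log a * (Nat.log a n + 1 : ℕ) := by
  have h := (Nat.lt_pow_succ_log_self ha n).le
  have h1 : (n : ℝ) ≤ (a : ℝ) ^ (Nat.log a n + 1) := by exact_mod_cast h
  have := Real.log_le_log (by exact_mod_cast hn) h1
  rw [Real.log_pow] at this
  linarith

/-- Taking `b` about `log₄ n` keeps `4 ^ (-b)` of order at least `1 / n`, so that some of `n`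
columns still deviates with constant probability. -/
theorem exists_expRegret_lower_bound : ∃ c : ℝ, 0 < c ∧ ∀ T n S : ℕ, 2 ≤ n → 1 ≤ S → S ≤ T →
    ∃ m : ℕ, 1 ≤ m ∧ m ≤ T ∧ ∀ A : PFEAlgorithm T n, A.IsBudget S →
      c * min (T : ℝ) (T * Real.log n / S) ≤ A.expRegret (batchedBernoulli T n m) := by
  obtain ⟨c, hc, h⟩ := exists_batched_expRegret
  refine ⟨c / 2, by positivity, fun T n S hn hS hST => ?_⟩
  set b' := Nat.log 4 n + 1 with hb'
  have hn0 : (0 : ℝ) < n := by positivity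
  have h1 : 1 / n ≤ 4 * (1 / 4 : ℝ) ^ min T b' := by
    calc 1 / (n : ℝ) ≤ 1 / 4 ^ Nat.log 4 n := by
          gcongr
          exact_mod_cast Nat.pow_log_le_self 4 (by omega)
      _ = 4 * (1 / 4 : ℝ) ^ b' := by rw [hb', pow_succ, one_div_pow]; ring
      _ ≤ _ := by
          gcongr ?_ * ?_
          exact pow_le_pow_of_le_one (by norm_num) (by norm_num) (min_le_right _ _)
  obtain ⟨m, hm, hmT, hA⟩ := h T n S (min T b') hn (by omega) (min_le_left _ _) hS h1
  refine ⟨m, hm, hmT, fun A hb => le_trans ?_ (hA A hb)⟩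
  have h2 : Real.log n ≤ 2 * b' := by
    refine (log_le_log_mul_natLog (by omega) 4 (by norm_num)).trans ?_
    push_cast
    have := log_four_le
    gcongr
    rw [hb']
    push_cast
    rfl
  have h3 := min_mul_div_le hS hST (by norm_num) h2
  nlinarith

/-- The lower bound for small failure probabilities. -/
theorem exists_batched_small : ∃ c : ℝ, 0 < c ∧ ∀ (T n S : ℕ) (δ : ℝ), 2 ≤ n → 1 ≤ S → S ≤ T →
    0 < δ → δ ≤ 1 / 16 → Real.log n ≤ Real.log (1 / δ) →
    ∃ m : ℕ, 1 ≤ m ∧ m ≤ T ∧ ∀ A : PFEAlgorithm T n, A.IsBudget S →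
      δ ≤ (A.law (batchedBernoulli T n m)).real
        {p | c * min (T : ℝ) (T * (Real.log n + √(Real.log (1 / δ))) / S) ≤ A.regret p} := by
  obtain ⟨c, hc, h⟩ := exists_batched_of_player
  refine ⟨c / 12, by positivity, fun T n S δ hn hS hST hδ hδ' hlog => ?_⟩
  set l := Real.log (1 / δ) with hl
  have h4 : 0 < Real.log 4 := Real.log_pos (by norm_num)
  have hl2 : 2 * Real.log 4 ≤ l := by
    have h5 : Real.log ((4 : ℝ) ^ 2) ≤ l := by
      refine Real.log_le_log (by norm_num) ?_
      rw [le_div_iff₀ hδ]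
      linarith
    rw [Real.log_pow] at h5
    exact_mod_cast h5
  -- `4 ^ (-r) ≥ δ`; using `r - 1` blocks absorbs the factor `1 / 4` in the probability.
  set r := ⌊l / Real.log 4⌋₊ with hr
  have h6 : 2 ≤ r := Nat.le_floor (by rw [le_div_iff₀ h4]; exact_mod_cast hl2)
  have h7 : r * Real.log 4 ≤ l := by
    rw [← le_div_iff₀ h4]
    exact Nat.floor_le (div_nonneg (by linarith) h4.le)
  have h8 : l ≤ (r + 1) * Real.log 4 := by
    rw [← div_le_iff₀ h4]
    exact (Nat.lt_floor_add_one _).le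
  have h9 : δ ≤ (1 / 4 : ℝ) ^ (min T (r - 1)) / 4 := by
    calc δ = Real.exp (-l) := by rw [hl, one_div, Real.log_inv, neg_neg, Real.exp_log hδ]
      _ ≤ Real.exp (-(r * Real.log 4)) := Real.exp_le_exp.mpr (by linarith)
      _ = (1 / 4) ^ (r - 1 + 1) := by
          rw [Nat.sub_add_cancel (by omega), ← mul_neg, ← Real.log_inv, mul_comm, ← Real.rpow_natCast,
            Real.rpow_def_of_pos (by norm_num), one_div]
      _ = (1 / 4 : ℝ) ^ (r - 1) / 4 := by rw [pow_succ]; ring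
      _ ≤ _ := by
          gcongr ?_ / 4
          exact pow_le_pow_of_le_one (by norm_num) (by norm_num) (min_le_right _ _)
  obtain ⟨m, hm, hmT, hA⟩ := h T n S (min T (r - 1)) hn (by omega) (min_le_left _ _) hS
  refine ⟨m, hm, hmT, fun A hb => le_law_mono (hA A hb) h9 ?_⟩
  have h10 : (2 : ℝ) ≤ r := by exact_mod_cast h6
  -- The number of blocks has the order of `l`, which here dominates both `log n` and `√l`.
  have h11 : Real.log n + √l ≤ 12 * ((r - 1 : ℕ) : ℝ) := by
    rw [Nat.cast_sub (by omega), Nat.cast_one]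
    have h12 := Real.sqrt_nonneg l
    have h13 := Real.sq_sqrt (show 0 ≤ l by linarith)
    have := log_four_le
    have h14 : 1 ≤ l := by
      have := half_le_log (show 2 ≤ 4 by norm_num)
      push_cast at this
      linarith
    have h15 : √l ≤ l := by
      rw [Real.sqrt_le_left (by linarith)]
      nlinarith
    nlinarith
  have h16 := min_mul_div_le hS hST (by norm_num) h11
  nlinarith

/-- The lower bound for many actions and failure probabilities that are not small. -/
theorem exists_batched_many : ∃ (c : ℝ) (n₀ N : ℕ), 0 < c ∧ ∀ (T n S : ℕ) (l : ℝ), n₀ ≤ n → 1 ≤ S →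
    S ≤ T → N ≤ T → l ≤ 2 * Real.log n →
    ∃ m : ℕ, 1 ≤ m ∧ m ≤ T ∧ ∀ A : PFEAlgorithm T n, A.IsBudget S →
      1 / 2 ≤ (A.law (batchedBernoulli T n m)).real
        {p | c * min (T : ℝ) (T * (Real.log n + √l) / S) ≤ A.regret p} := by
  obtain ⟨c, hc, h⟩ := exists_batched_best
  -- Only `1152 ≤ K` is used; hiding the value keeps `16 ^ K` symbolic.
  obtain ⟨K, hK⟩ : ∃ K : ℕ, 1152 ≤ K := ⟨_, le_rfl⟩
  refine ⟨c / 20, 16 ^ K, K, by positivity, fun T n S l hn hS hST hT hl => ?_⟩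
  have hn256 : 256 ≤ n := by
    calc 256 = 16 ^ 2 := by norm_num
      _ ≤ 16 ^ K := Nat.pow_le_pow_right (by norm_num) (by omega)
      _ ≤ n := hn
  -- Base `16` makes `4 ^ (-b)` of order `1 / √n` instead of `1 / n`, so that a good column exists
  -- with high probability.
  set b' := Nat.log 16 n + 1 with hb'
  have hKb : K ≤ Nat.log 16 n := Nat.le_log_of_pow_le (by norm_num) hn
  have h1 : 1 / √n ≤ 4 * (1 / 4 : ℝ) ^ min T b' := by
    calc 1 / √(n : ℝ) ≤ 1 / 4 ^ Nat.log 16 n := by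
          gcongr
          refine Real.le_sqrt_of_sq_le ?_
          rw [← pow_mul, mul_comm, pow_mul]
          norm_num
          exact_mod_cast Nat.pow_log_le_self 16 (by omega)
      _ = 4 * (1 / 4 : ℝ) ^ b' := by rw [hb', pow_succ, one_div_pow]; ring
      _ ≤ _ := by
          gcongr ?_ * ?_
          exact pow_le_pow_of_le_one (by norm_num) (by norm_num) (min_le_right _ _)
  obtain ⟨m, hm, hmT, hA⟩ := h T n S (min T b') hn256 (by omega) (min_le_left _ _) hS h1
  refine ⟨m, hm, hmT, fun A hb => le_law_mono (hA A hb) le_rfl ?_⟩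
  have h2 : Real.log n + √l ≤ 20 * (b' : ℝ) := by
    have h3 := log_le_log_mul_natLog (n := n) (by omega) 16 (by norm_num)
    have h4 : Real.log (16 : ℕ) ≤ 4 := by
      have := log_four_le
      rw [show ((16 : ℕ) : ℝ) = 4 ^ 2 by norm_num, Real.log_pow]
      push_cast
      linarith
    have h5 : Real.log n ≤ 4 * b' := h3.trans (by gcongr)
    have h6 := half_le_log (show 2 ≤ n by omega)
    have h7 : √l ≤ 4 * Real.log n := by
      rw [Real.sqrt_le_left (by linarith)]
      nlinarith
    linarith
  have h16 := min_mul_div_le hS hST (by norm_num) h2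
  nlinarith

end Coins

/-! ### The lower bound with high probability, all cases -/

namespace Coins

theorem exists_lower_bound_law : ∃ n₀ : ℕ, ∀ δ₀ : ℝ, δ₀ < 1 / 2 → ∃ c : ℝ, 0 < c ∧
    ∀ (T n S : ℕ) (δ : ℝ), 2 ≤ n → 1 ≤ S → S ≤ T → 0 < δ → δ < 1 / 2 → (δ ≤ δ₀ ∨ n₀ ≤ n) →
      ∃ D : Adversary T n,
        (δ ≤ 1 / 4 → ∃ m : ℕ, 1 ≤ m ∧ m ≤ T ∧ D = batchedBernoulli T n m) ∧
        ∀ A : PFEAlgorithm T n, A.IsBudget S →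
          δ ≤ (A.law D).real
            {p | c * min (T : ℝ) (T * (Real.log n + √(Real.log (1 / δ))) / S) ≤ A.regret p} := by
  obtain ⟨c₁, hc₁, small⟩ := exists_batched_small
  obtain ⟨c₂, n₀, N₁, hc₂, many⟩ := exists_batched_many
  obtain ⟨c₃, hc₃, quarter⟩ := exists_batched_quarter
  refine ⟨n₀, fun δ₀ hδ₀ => ?_⟩
  obtain ⟨c₄, N₂, hc₄, two⟩ := exists_twoClass (η := 1 / 2 - δ₀) (by linarith)
  have hL : 0 ≤ Real.log n₀ := Real.log_natCast_nonneg n₀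
  -- Bounds `log n + √l` or `T` whenever an adversary without a logarithmic gain is used; `c / M`
  -- then makes up for the missing factor.
  set M : ℝ := 8 + 3 * Real.log n₀ + N₁ with hM
  have hM1 : 1 ≤ M := by
    have : (0 : ℝ) ≤ N₁ := Nat.cast_nonneg _
    linarith
  have hM0 : 0 < M := by linarith
  obtain ⟨c, hc, hcc₁, hcc₂, hcc₃, hcc₄, hcc₅⟩ : ∃ c : ℝ, 0 < c ∧ c ≤ c₁ ∧ c ≤ c₂ ∧ c ≤ c₃ / M ∧
      c ≤ c₄ / M ∧ c ≤ 1 / (N₁ + N₂ + 1) :=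
    ⟨min c₁ (min c₂ (min (c₃ / M) (min (c₄ / M) (1 / (N₁ + N₂ + 1))))), by positivity, by simp,
      by simp, by simp, by simp, by simp⟩
  refine ⟨c, hc, fun T n S δ hn hS hST hδ hδ2 hcase => ?_⟩
  set l := Real.log (1 / δ) with hl
  have hl0 : 0 ≤ l := Real.log_nonneg (by rw [le_div_iff₀ hδ]; linarith)
  have hlog := half_le_log hn
  have hSR : (0 : ℝ) < S := by exact_mod_cast hS
  set y := min (T : ℝ) (T * (Real.log n + √l) / S) with hy
  have hy0 : 0 ≤ y := le_min (by positivity) (by positivity)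
  have hz0 : 0 ≤ min (T : ℝ) (T / S) := le_min (by positivity) (by positivity)
  have hsq : √l ≤ 1 + l := by
    rw [Real.sqrt_le_left (by linarith)]
    nlinarith
  have hbound : ∀ c', 0 < c' → c ≤ c' / M → (Real.log n + √l ≤ M ∨ (T : ℝ) ≤ M) →
      c * y ≤ c' * min (T : ℝ) (T / S) := by
    intro c' hc' hle h
    have h1 := min_mul_div_le_of_bounded hS hST hM1 h
    calc c * y ≤ c' / M * (M * min (T : ℝ) (T / S)) := by gcongr
      _ = _ := by field_simp
  have hn0 : n < n₀ → Real.log n ≤ Real.log n₀ := fun h =>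
    Real.log_le_log (by positivity) (by exact_mod_cast h.le)
  have hNN : (0 : ℝ) ≤ N₁ ∧ (0 : ℝ) ≤ N₂ := ⟨Nat.cast_nonneg _, Nat.cast_nonneg _⟩
  rcases le_or_gt δ (1 / 4) with hδ4 | hδ4
  · have hQ : (Real.log n + √l ≤ M ∨ (T : ℝ) ≤ M) → ∃ D : Adversary T n,
        (δ ≤ 1 / 4 → ∃ m : ℕ, 1 ≤ m ∧ m ≤ T ∧ D = batchedBernoulli T n m) ∧
        ∀ A : PFEAlgorithm T n, A.IsBudget S → δ ≤ (A.law D).real {p | c * y ≤ A.regret p} := by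
      intro h
      obtain ⟨m, hm, hmT, hA⟩ := quarter T n S hn hS hST
      exact ⟨_, fun _ => ⟨m, hm, hmT, rfl⟩, fun A hb =>
        le_law_mono (hA A hb) hδ4 (hbound c₃ hc₃ hcc₃ h)⟩
    rcases le_or_gt (Real.log n) l with h1 | h1
    · rcases le_or_gt δ (1 / 16) with h2 | h2
      · obtain ⟨m, hm, hmT, hA⟩ := small T n S δ hn hS hST hδ h2 h1
        exact ⟨_, fun _ => ⟨m, hm, hmT, rfl⟩, fun A hb => le_law_mono (hA A hb) le_rfl (by gcongr)⟩
      · refine hQ (Or.inl ?_)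
        have h3 : l ≤ 4 := by
          have h4 : l ≤ Real.log ((4 : ℝ) ^ 2) := Real.log_le_log (by positivity) (by
            rw [div_le_iff₀ hδ]; linarith)
          rw [Real.log_pow] at h4
          push_cast at h4
          linarith [log_four_le]
        have h4 : √l ≤ 2 := by
          rw [Real.sqrt_le_left (by norm_num)]
          linarith
        linarith
    · rcases lt_or_ge n n₀ with h2 | h2
      · refine hQ (Or.inl ?_)
        have := hn0 h2
        linarith
      · rcases le_or_gt N₁ T with h3 | h3
        · obtain ⟨m, hm, hmT, hA⟩ := many T n S l h2 hS hST h3 (by linarith)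
          exact ⟨_, fun _ => ⟨m, hm, hmT, rfl⟩, fun A hb =>
            le_law_mono (hA A hb) (by linarith) (by gcongr)⟩
        · refine hQ (Or.inr ?_)
          have : (T : ℝ) ≤ N₁ := by exact_mod_cast h3.le
          linarith
  · have hl4 : l ≤ Real.log 4 := Real.log_le_log (by positivity) (by
      rw [div_le_iff₀ hδ]; linarith)
    -- For a bounded horizon the target is below one after scaling by `c`, so a single unit of
    -- regret suffices.
    rcases lt_or_ge T (N₁ + N₂) with h1 | h1
    · have : Nonempty (Fin n) := ⟨⟨0, by omega⟩⟩
      refine ⟨_, fun h => absurd h (by linarith), fun A _ =>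
        le_law_mono (half_le_law_hidden hn (by omega) A) hδ2.le ?_⟩
      have h2 : (T : ℝ) ≤ N₁ + N₂ + 1 := by exact_mod_cast (by omega : T ≤ N₁ + N₂ + 1)
      calc c * y ≤ 1 / (N₁ + N₂ + 1) * (N₁ + N₂ + 1) := by
            gcongr
            exact (min_le_left _ _).trans h2
        _ = 1 := by field_simp
    · rcases le_or_gt n₀ n with h2 | h2
      · have h3 : Real.log 4 ≤ 2 * Real.log n := by
          rw [show (4 : ℝ) = 2 ^ 2 by norm_num, Real.log_pow]
          push_cast
          gcongr
          exact_mod_cast hn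
        obtain ⟨m, hm, hmT, hA⟩ := many T n S l h2 hS hST (by omega) (by linarith)
        exact ⟨_, fun _ => ⟨m, hm, hmT, rfl⟩, fun A hb =>
          le_law_mono (hA A hb) hδ2.le (by gcongr)⟩
      -- Few actions and `δ > 1 / 4`: only here is `δ ≤ δ₀` needed, because the probability falls
      -- short of `1 / 2` by `1 / 2 - δ₀`.
      · obtain ⟨D, hD⟩ := two T n S hn (by omega) hS
        have h3 : δ ≤ δ₀ := hcase.resolve_right (by omega)
        refine ⟨D, fun h => absurd h (by linarith), fun A hb =>
          le_law_mono (hD A hb) (by linarith) (hbound c₄ hc₄ hcc₄ (Or.inl ?_))⟩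
        have := hn0 h2
        linarith [log_four_le]

end Coins

/-! ### The minimax rate and the theorem -/

theorem minimaxRegret_le {T n S : ℕ} {R : ℝ} (hn : 0 < n) {A : PFEAlgorithm T n} (hA : A.IsBudget S)
    (h : ∀ D, A.expRegret D ≤ R) : minimaxRegret T n S ≤ ((min (T : ℝ) R : ℝ) : EReal) := by
  refine (iInf₂_le A hA).trans (iSup_le fun D => EReal.coe_le_coe_iff.mpr (le_min ?_ (h D)))
  have := integral_mono (A.integrable_regret hn D) (integrable_const (T : ℝ)) fun p =>
    regretOf_le hn (fun t => A.act t p.1 p.2) p.1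
  simpa [PFEAlgorithm.expRegret] using this

theorem le_minimaxRegret {T n S : ℕ} {R : ℝ} (D : Adversary T n)
    (h : ∀ A : PFEAlgorithm T n, A.IsBudget S → R ≤ A.expRegret D) :
    (R : EReal) ≤ minimaxRegret T n S :=
  le_iInf₂ fun A hA => le_iSup_of_le D (EReal.coe_le_coe_iff.mpr (h A hA))

theorem mainTheorem3 (C : ℝ) (hC : 0 < C) :
    -- the optimal rate
    (∃ c K : ℝ, 0 < c ∧ 0 < K ∧ ∀ T n S : ℕ, 2 ≤ T → LowSwitching C T n S →
      ((c * min (T : ℝ) (T * Real.log n / S) : ℝ) : EReal) ≤ minimaxRegret T n S ∧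
      minimaxRegret T n S ≤ ((min (T : ℝ) (K * (T * Real.log n * Real.log T / S)) : ℝ) : EReal)) ∧
    -- upper bound in expectation, by one efficient program
    (∃ (K : ℝ) (k : ℕ) (P : RAM.Program), ∀ T n S : ℕ, 2 ≤ T → LowSwitching C T n S →
      ∃ A : PFEAlgorithm T n, A.IsBudget S ∧
        P.Implements [T, n, S] [] A (k * (n * T) ^ k) ∧
        ∀ D : Adversary T n, A.expRegret D ≤ K * (T * Real.log n * Real.log T / S)) ∧
    -- upper bound with high probability, by one efficient program
    (∃ (K : ℝ) (k : ℕ) (P : RAM.Program), ∀ (T n S : ℕ) (δ : ℝ), LowSwitching C T n S →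
      0 < δ → δ < 1 / 2 →
      ∃ A : PFEAlgorithm T n, A.IsBudget S ∧
        P.Implements [T, n, S] [δ] A (k * (n * T) ^ k) ∧
        ∀ D : Adversary T n,
          1 - δ ≤ (A.law D).real
            {p | A.regret p ≤ K * (T * Real.log n * Real.log (1 / δ) / S)}) ∧
    -- lower bound in expectation
    (∃ c : ℝ, 0 < c ∧ ∀ T n S : ℕ, LowSwitching C T n S →
      ∃ m : ℕ, 1 ≤ m ∧ m ≤ T ∧ ∀ A : PFEAlgorithm T n, A.IsBudget S →
        c * min (T : ℝ) (T * Real.log n / S) ≤ A.expRegret (batchedBernoulli T n m)) ∧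
    -- lower bound with high probability
    (∃ n₀ : ℕ, ∀ δ₀ : ℝ, δ₀ < 1 / 2 → ∃ c : ℝ, 0 < c ∧ ∀ (T n S : ℕ) (δ : ℝ),
      LowSwitching C T n S → 0 < δ → δ < 1 / 2 → (δ ≤ δ₀ ∨ n₀ ≤ n) →
      ∃ D : Adversary T n,
        (δ ≤ 1 / 4 → ∃ m : ℕ, 1 ≤ m ∧ m ≤ T ∧ D = batchedBernoulli T n m) ∧
        ∀ A : PFEAlgorithm T n, A.IsBudget S →
          δ ≤ (A.law D).real
            {p | c * min (T : ℝ) (T * (Real.log n + √(Real.log (1 / δ))) / S) ≤ A.regret p}) := by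
  have pos : ∀ {T n S : ℕ}, LowSwitching C T n S → 0 < T := fun h => h.2.1.trans h.2.2.1
  refine ⟨?_, ?_, ?_, ?_, ?_⟩
  · obtain ⟨c, hc, h⟩ := Coins.exists_expRegret_lower_bound
    refine ⟨c, 4204 + 8 * C ^ 2, hc, by positivity, fun T n S hT hL => ⟨?_, ?_⟩⟩
    · obtain ⟨m, -, -, hA⟩ := h T n S hL.1 hL.2.1 hL.2.2.1
      exact le_minimaxRegret _ hA
    · have hT' : (0 : ℝ) < T := by exact_mod_cast pos hL
      refine minimaxRegret_le (by have := hL.1; omega)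
        (FPL.player_isBudget hL.1 (pos hL) (δ := 1 / (T + 1)) ?_)
        fun D => FPL.player_expRegret hC hL hT D
      rw [div_lt_one (by positivity)]
      linarith
  · refine ⟨4204 + 8 * C ^ 2, RAM.stepExponent, RAM.programExp, fun T n S hT hL => ?_⟩
    have hT' : (0 : ℝ) < T := by exact_mod_cast pos hL
    refine ⟨FPL.player T n S (1 / (T + 1)) hL.1, FPL.player_isBudget hL.1 (pos hL) ?_,
      FPL.programExp_implements hL.1 (pos hL), fun D => FPL.player_expRegret hC hL hT D⟩
    rw [div_lt_one (by positivity)]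
    linarith
  · exact ⟨2100 + 4 * C ^ 2, RAM.stepExponent, RAM.program, fun T n S δ hL hδ hδ2 =>
      ⟨FPL.player T n S δ hL.1, FPL.player_isBudget hL.1 (pos hL) (by linarith),
        FPL.program_implements hL.1 (pos hL), FPL.player_regret hC hL hδ hδ2⟩⟩
  · obtain ⟨c, hc, h⟩ := Coins.exists_expRegret_lower_bound
    exact ⟨c, hc, fun T n S hL => h T n S hL.1 hL.2.1 hL.2.2.1⟩
  · obtain ⟨n₀, h⟩ := Coins.exists_lower_bound_law
    refine ⟨n₀, fun δ₀ hδ₀ => ?_⟩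
    obtain ⟨c, hc, h⟩ := h δ₀ hδ₀
    exact ⟨c, hc, fun T n S δ hL => h T n S δ hL.1 hL.2.1 hL.2.2.1⟩
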